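/- Let $\mathcal X$ be a nonempty measurable space, $\mathcal Y=[-1,1]$, $\mathcal Z=\mathcal X\times\mathcal Y$, and let $\mathcal F\subseteq\mathcal Y^{\mathcal X}$ be nonempty. Let $\ell((x,y),f)=|y-f(x)|$ be the absolute loss. Assume the usual measurability of the class: every $f\in\mathcal F$ is measurable, and for all $m\in\mathbb N$ and $a\in\mathbb R^m$ the map $(z_1,\dots,z_m)\mapsto\sup_{f\in\mathcal F}\sum_i a_i\,\ell(z_i,f)$ on $\mathcal Z^m$ is universally measurable. Expectations of possibly non-measurable nonnegative quantities are upper expectations. A complete binary tree of depth $n$ with labels in a set $A$ is a sequence of maps $\mathbf x_t:\{\pm1\}^{t-1}\to A$, $1\le t\le n$. For $\gamma>0$, $\mathrm{sfat}_\gamma(\mathcal F)$ is the supremum of the $n$ for which there are an $\mathcal X$-valued tree $\mathbf x$ and a real-valued tree $\mathbf s$ of depth $n$ such that for every $\epsilon\in\{\pm1\}^n$ there is $f\in\mathcal F$ with $\epsilon_t\bigl(f(\mathbf x_t(\epsilon_{1:t-1}))-\mathbf s_t(\epsilon_{1:t-1})\bigr)\ge\gamma$ for all $t$. The sequential Rademacher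 complexity is $\mathfrak R_n(\mathcal F)=\sup_{\mathbf x}\mathbb E_\epsilon\sup_{f\in\mathcal F}\frac1n\sum_{t=1}^n\epsilon_t f(\mathbf x_t(\epsilon_{1:t-1}))$, with $\epsilon$ uniform on $\{\pm1\}^n$. Then the following are equivalent. 1. $\mathcal F$ is online learnable: $$\limsup_{n\to\infty}\ \inf_{\hat f_0,\dots,\hat f_{n-1}}\ \sup_{z_{1:n}\in\mathcal Z^n}\ \mathbb E\Bigl[\tfrac1n\Bigl(\sum_{t=1}^n\ell(z_t,\hat f_{t-1})-\inf_{f\in\mathcal F}\sum_{t=1}^n\ell(z_t,f)\Bigr)\Bigr]=0,$$ where $\hat f_t$ maps $z_{1:t}$ to a possibly random element of $\mathcal F$. 2. The uniform martingale law of large numbers holds: $$\limsup_{n\to\infty}\ \sup\ \mathbb E\Bigl[\sup_{f\in\mathcal F}\Bigl|\tfrac1n\sum_{t=1}^n\bigl(f(X_t)-\mathbb E[f(X_t)\mid\mathcal A_{t-1}]\bigr)\Bigr|\Bigr]=0,$$ where the outer supremum is over all $\mathcal X$-valued processes $(X_t)$ adapted to a filtration $(\mathcal A_t)$ on a probability space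 with regular conditional probabilities given the $\mathcal A_t$ (for instance any standard Borel one), from which the conditional expectations are computed. 3. $\mathrm{sfat}_\gamma(\mathcal F)<\infty$ for every $\gamma>0$. 4. $\limsup_{n\to\infty}\mathfrak R_n(\mathcal F)=0$. 5. $\mathcal F$ is process learnable: $$\limsup_{n\to\infty}\ \inf_{\hat f_n:\mathcal Z^n\to\mathcal F}\ \sup_{\mathbf P}\ \mathbb E\Bigl[\tfrac1n\sum_{t=1}^n\ell(P_t,\hat f_n)-\inf_{f\in\mathcal F}\tfrac1n\sum_{t=1}^n\ell(P_t,f)\Bigr]=0,$$ where $\hat f_n$ stands for $\hat f_n(Z_{1:n})$, $\mathbf P$ ranges over the joint laws of $Z_{1:n}$ on $\mathcal Z^n$ with regular conditional distributions $P_t$ of $Z_t$ given $Z_{1:t-1}$ (all joint laws, if $\mathcal X$ is standard Borel), and $\ell(P,f)=\mathbb E_{z\sim P}\,\ell(z,f)$. -/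

import Mathlib

open MeasureTheory ProbabilityTheory Filter
open scoped ENNReal

namespace ProcLearn

universe u

/-- The output space `[-1, 1]` of the regression problem. -/
abbrev Label : Type := Set.Icc (-1 : ℝ) 1

/-- Input-output pairs `z = (x, y)`. -/
abbrev Sample (X : Type u) : Type u := X × Label

/-- The absolute loss `ℓ((x, y), f) = |y - f x|`. -/
def loss {X : Type u} (z : Sample X) (f : X → Label) : ℝ :=
  |(z.2 : ℝ) - (f z.1 : ℝ)|

/-- The first `t` entries of a sequence of length `n`. -/
def past {A : Type u} {n : ℕ} (t : Fin n) (z : Fin n → A) : Fin (t : ℕ) → A :=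
  fun i => z (Fin.castLE t.isLt.le i)

/-- The upper (outer) expectation of a nonnegative function. It is the usual integral for
measurable functions, and it needs no measurability to make sense. -/
noncomputable def upperExp {Ω : Type u} [MeasurableSpace Ω] (μ : Measure Ω)
    (g : Ω → ℝ≥0∞) : ℝ≥0∞ :=
  ⨅ (h : Ω → ℝ≥0∞) (_ : Measurable h) (_ : ∀ ω, g ω ≤ h ω), ∫⁻ ω, h ω ∂μ

theorem upperExp_eq_lintegral {Ω : Type u} [MeasurableSpace Ω] (μ : Measure Ω)
    {g : Ω → ℝ≥0∞} (hg : Measurable g) : upperExp μ g = ∫⁻ ω, g ω ∂μ :=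
  le_antisymm (iInf_le_of_le g (iInf_le_of_le hg (iInf_le _ fun _ => le_rfl)))
    (le_iInf fun _ => le_iInf fun _ => le_iInf fun hh => lintegral_mono hh)

/-- The usual measurability convention on a function class: its members are measurable, and the
suprema over the class of finite weighted sums of losses are universally measurable
(measurable for the completion of every law of the sample). Weighted sums of function values are
covered as well, since `|1 - f x| = 1 - f x`. -/
structure IsMeasurableClass {X : Type u} [MeasurableSpace X] (F : Set (X → Label)) : Prop where
  measurable_mem : ∀ f ∈ F, Measurable f
  aemeasurable_iSup : ∀ (m : ℕ) (a : Fin m → ℝ) (μ : Measure (Fin m → Sample X)),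
    IsProbabilityMeasure μ →
      AEMeasurable (fun z => ⨆ f : F, ∑ i, a i * loss (z i) (f : X → Label)) μ

/-! ### Complete binary trees -/

/-- The sign `±1` encoded by a Boolean. -/
def sgn (b : Bool) : ℝ := if b then 1 else -1

/-- A complete binary tree of depth `n` with labels in `A`: level `t` is a function of the first
`t` signs (levels are numbered `0, …, n - 1`). -/
abbrev BinTree (A : Type u) (n : ℕ) : Type u := (t : Fin n) → (Fin (t : ℕ) → Bool) → A

/-- `F` shatters the tree `x` at scale `γ`. -/
def Shatters {X : Type u} (F : Set (X → Label)) (γ : ℝ) {n : ℕ} (x : BinTree X n) : Prop :=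
  ∃ s : BinTree ℝ n, ∀ ε : Fin n → Bool, ∃ f ∈ F, ∀ t : Fin n,
    γ ≤ sgn (ε t) * ((f (x t (past t ε)) : ℝ) - s t (past t ε))

/-- The sequential fat-shattering dimension at scale `γ`. -/
noncomputable def sfat {X : Type u} (F : Set (X → Label)) (γ : ℝ) : ℕ∞ :=
  ⨆ (n : ℕ) (_ : ∃ x : BinTree X n, Shatters F γ x), (n : ℕ∞)

/-- The sequential Rademacher complexity of `F` on the tree `x`; the expectation over the
Rademacher signs is the average over all `2 ^ n` sign vectors. -/
noncomputable def seqRadTree {X : Type u} (F : Set (X → Label)) {n : ℕ} (x : BinTree X n) : ℝ :=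
  (∑ ε : Fin n → Bool,
    ⨆ f : F, (1 / (n : ℝ)) * ∑ t : Fin n, sgn (ε t) * ((f : X → Label) (x t (past t ε)) : ℝ))
      / 2 ^ n

/-- The sequential Rademacher complexity of `F`. -/
noncomputable def seqRad {X : Type u} (F : Set (X → Label)) (n : ℕ) : EReal :=
  ⨆ x : BinTree X n, (seqRadTree F x : EReal)

/-! ### Online learning -/

/-- A (possibly randomized) sequence of `n` online learning rules with values in `F`. The `t`-th
rule sees the first `t` examples and the internal randomness `ω`. -/
structure OnlineRule {X : Type u} (F : Set (X → Label)) (n : ℕ) where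
  Ω : Type u
  [mΩ : MeasurableSpace Ω]
  prob : Measure Ω
  [isProb : IsProbabilityMeasure prob]
  rule : (t : Fin n) → (Fin (t : ℕ) → Sample X) → Ω → F
  measurable_rule : ∀ t z x, Measurable fun ω => (rule t z ω : X → Label) x

attribute [instance] OnlineRule.mΩ OnlineRule.isProb

/-- The expected normalized regret of a sequence of rules on the sequence `z`. -/
noncomputable def OnlineRule.regret {X : Type u} {F : Set (X → Label)} {n : ℕ}
    (R : OnlineRule F n) (z : Fin n → Sample X) : ℝ :=
  ∫ ω, (1 / (n : ℝ)) * (∑ t : Fin n, loss (z t) (R.rule t (past t z) ω : X → Label)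
    - (⨅ f : F, ∑ t : Fin n, loss (z t) (f : X → Label))) ∂(R.prob)

/-- The minimax value of online learning. -/
noncomputable def onlineValue {X : Type u} (F : Set (X → Label)) (n : ℕ) : EReal :=
  ⨅ R : OnlineRule F n, ⨆ z : Fin n → Sample X, (R.regret z : EReal)

def OnlineLearnable {X : Type u} (F : Set (X → Label)) : Prop :=
  limsup (fun n => onlineValue F n) atTop = 0

/-! ### The uniform martingale law of large numbers -/

/-- A process in `X` on a filtered probability space, with `X_{t+1} = val t` measurable at time
`t + 1`. The conditional laws given `𝒜 t` are taken from a regular conditional probability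
`cond t`, so that `E[f(X_{t+1}) | 𝒜 t]` is determined simultaneously for all `f`. -/
structure AdaptedProcess (X : Type u) [MeasurableSpace X] where
  Ω : Type u
  [mΩ : MeasurableSpace Ω]
  prob : Measure Ω
  [isProb : IsProbabilityMeasure prob]
  filt : Filtration ℕ mΩ
  val : ℕ → Ω → X
  measurable_val : ∀ t, Measurable[filt (t + 1)] (val t)
  cond : (t : ℕ) → @Kernel Ω Ω (filt t) mΩ
  isMarkov_cond : ∀ t, @IsMarkovKernel Ω Ω (filt t) mΩ (cond t)
  isCond : ∀ (t : ℕ) (s : Set Ω), MeasurableSet s →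
    (fun ω => (cond t ω).real s) =ᵐ[prob] prob⟦s | filt t⟧

attribute [instance] AdaptedProcess.mΩ AdaptedProcess.isProb

/-- On a standard Borel probability space every filtration and every adapted process qualify. -/
noncomputable def AdaptedProcess.ofStandardBorel {X : Type u} [MeasurableSpace X] {Ω : Type u}
    [mΩ : MeasurableSpace Ω] [StandardBorelSpace Ω] (μ : Measure Ω) [IsProbabilityMeasure μ]
    (𝒜 : Filtration ℕ mΩ) (V : ℕ → Ω → X) (hV : ∀ t, Measurable[𝒜 (t + 1)] (V t)) :
    AdaptedProcess X where
  Ω := Ω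
  prob := μ
  filt := 𝒜
  val := V
  measurable_val := hV
  cond := fun t => condExpKernel μ (𝒜 t)
  isMarkov_cond := fun _ => inferInstance
  isCond := fun t _ hs => condExpKernel_ae_eq_condExp (𝒜.le t) hs

/-- `(1/n) ∑_t (f(X_t) - E[f(X_t) | 𝒜_{t-1}])`. -/
noncomputable def AdaptedProcess.deviation {X : Type u} [MeasurableSpace X]
    (S : AdaptedProcess X) (n : ℕ) (f : X → Label) (ω : S.Ω) : ℝ :=
  (1 / (n : ℝ)) * ∑ t ∈ Finset.range n,
    ((f (S.val t ω) : ℝ) - ∫ ω', (f (S.val t ω') : ℝ) ∂(S.cond t ω))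

/-- The uniform martingale law of large numbers. -/
def UMLLN {X : Type u} [MeasurableSpace X] (F : Set (X → Label)) : Prop :=
  limsup (fun n : ℕ => ⨆ S : AdaptedProcess X,
    upperExp S.prob fun ω => ⨆ f : F, ENNReal.ofReal |S.deviation n (f : X → Label) ω|) atTop = 0

/-! ### Learning under general stochastic processes -/

/-- A joint law of `Z_1, …, Z_n`, together with the conditional distribution `cond t` of each
entry given the preceding ones. -/
structure ProcessLaw (Z : Type u) [MeasurableSpace Z] (n : ℕ) where
  law : Measure (Fin n → Z)
  [isProb : IsProbabilityMeasure law]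
  cond : (t : Fin n) → Kernel (Fin (t : ℕ) → Z) Z
  [isMarkov_cond : ∀ t, IsMarkovKernel (cond t)]
  isCond : ∀ t, law.map (fun z => (past t z, z t)) = (law.map (past t)) ⊗ₘ (cond t)

attribute [instance] ProcessLaw.isProb ProcessLaw.isMarkov_cond

/-- On a standard Borel space every joint law qualifies. -/
theorem ProcessLaw.exists_of_standardBorel {Z : Type u} [MeasurableSpace Z] [StandardBorelSpace Z]
    [Nonempty Z] {n : ℕ} (μ : Measure (Fin n → Z)) [IsProbabilityMeasure μ] :
    ∃ P : ProcessLaw Z n, P.law = μ :=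
  ⟨{ law := μ
     cond := fun t => condDistrib (fun z => z t) (past t) μ
     isCond := fun t => (compProd_map_condDistrib (measurable_pi_apply t).aemeasurable).symm }, rfl⟩

/-- `(1/n) ∑_t ℓ(P_t, f)`, where `P_t` is the conditional distribution of `Z_t` given the
realized past. -/
noncomputable def ProcessLaw.risk {X : Type u} [MeasurableSpace X] {n : ℕ}
    (P : ProcessLaw (Sample X) n) (z : Fin n → Sample X) (f : X → Label) : ℝ :=
  (1 / (n : ℝ)) * ∑ t : Fin n, ∫ w, loss w f ∂(P.cond t (past t z))

/-- The value of a learning rule; the quantity inside the expectation is nonnegative because the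
rule takes values in `F`. -/
noncomputable def processValueOf {X : Type u} [MeasurableSpace X] (F : Set (X → Label)) {n : ℕ}
    (fhat : (Fin n → Sample X) → F) : ℝ≥0∞ :=
  ⨆ P : ProcessLaw (Sample X) n, upperExp P.law fun z =>
    ENNReal.ofReal (P.risk z (fhat z : X → Label) - ⨅ f : F, P.risk z (f : X → Label))

/-- The minimax value over all learning rules. -/
noncomputable def processValue {X : Type u} [MeasurableSpace X] (F : Set (X → Label))
    (n : ℕ) : ℝ≥0∞ :=
  ⨅ fhat : (Fin n → Sample X) → F, processValueOf F fhat

def ProcessLearnable {X : Type u} [MeasurableSpace X] (F : Set (X → Label)) : Prop :=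
  limsup (fun n => processValue F n) atTop = 0

end ProcLearn

/-! Everything passes through condition 3, finiteness of `sfat` at every scale; the implications are
3 → 1 → 4 → 3, 2 ↔ 3 and 3 ↔ 5.

The central object is `pot e n g`, the value of an `n`-round game in which an adversary picks an
atom `a` and a fair coin adds or subtracts `e a`. With `g = 0` it plays the role of `n` times a
sequential Rademacher complexity, unfolded one round at a time. If `sfat` is finite at every scale,
then `pot e n 0 = o(n)` for bounded `e` that are Lipschitz in the values of the class
(`eventually_pot_zero_le`). No sequential cover is built: the potential is bounded by its
exponential version `expPot`, which is subadditive in the weights. At each atom the class is cut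
into bins of width `2γ`. Bins that still shatter depth `d` lie within two adjacent bins, since
otherwise depth `d + 1` would be shattered; each other bin has smaller dimension. The resulting
recursion gives a factor polynomial in `n` (`expPot_le_of_not_shattersDepth`).

3 → 1: the learner plays by backward induction, with the potential of the remaining rounds as a
relaxation (`exists_strategy`). Each round needs a minimax theorem without compactness. If it
failed, alternating best responses would produce an infinite half-graph of mixed strategies, and
half-graphs force linear growth of the potential (`exists_distr_expect_le`).

3 → 2 and 3 → 5: given the realized path, each conditional mean is an integral over an independent
tangent copy. Conditionally on the past, an observation and its copy are exchangeable, so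
symmetrization bounds the expected uniform deviation by the potential of `2 • e`
(`exists_measurable_majorant`). Applied to function values this is the law of large numbers; applied
to losses it shows that approximate empirical risk minimization learns.

1 → 4 → 3: an adversary that walks down a tree with random signs as labels makes the mean loss of
every learner equal to 1 per round, so the regret is at least the Rademacher complexity; a shattered
tree keeps that complexity above `γ`.

2 → 3: the process visits the next node of a shattered tree or a fixed base point according to a
fair sign, so its deviations are half the signed sums on the tree, up to a term of order `√n`.

5 → 3: the sample follows a branch and then visits it again with noisy opposite labels. If the
branch is drawn along the way, the first half is uninformative for the conditional risk, and a good
learner must be negatively correlated with the branch signs; if the branch is fixed in advance, the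
first half dominates and a good learner must be positively correlated. For a uniform branch the
samples have the same law in both cases, so no learner does well in both (`le_processValueOf`). -/

namespace ProcLearn

/-! ### The sequential Rademacher potential -/

section Potential

variable {A I : Type*}

/-- The value of the game in which, for `k` rounds, an adversary picks an atom `a` and a fair coin
decides whether `e a` is added to or subtracted from the payoff vector `g`; the final payoff is
the supremum of the payoff vector. -/
noncomputable def pot (e : A → I → ℝ) : ℕ → (I → ℝ) → ℝ
  | 0, g => ⨆ i, g i
  | k + 1, g => ⨆ a, (pot e k (g + e a) + pot e k (g - e a)) / 2

variable {e : A → I → ℝ} {B : ℝ}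

theorem bddAbove_range_add {g h : I → ℝ} (hg : BddAbove (Set.range g)) (hh : ∀ i, |h i| ≤ B) :
    BddAbove (Set.range (g + h)) := by
  obtain ⟨C, hC⟩ := hg
  refine ⟨C + B, ?_⟩
  rintro _ ⟨i, rfl⟩
  have := hC ⟨i, rfl⟩
  have := (abs_le.1 (hh i)).2
  simp only [Pi.add_apply]
  linarith

theorem bddAbove_range_sub {g h : I → ℝ} (hg : BddAbove (Set.range g)) (hh : ∀ i, |h i| ≤ B) :
    BddAbove (Set.range (g - h)) := by
  rw [sub_eq_add_neg]
  exact bddAbove_range_add hg (B := B) (fun i => by simpa using hh i)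

theorem bddAbove_range_of_abs_le {g : I → ℝ} (hg : ∀ i, |g i| ≤ B) : BddAbove (Set.range g) :=
  ⟨B, by rintro _ ⟨i, rfl⟩; exact (abs_le.1 (hg i)).2⟩

/-- A real supremum carries information only over a bounded family. This a priori bound is what
makes the suprema over atoms in later rounds genuine. -/
theorem pot_le_of_le [Nonempty A] [Nonempty I] (he : ∀ a i, |e a i| ≤ B) (k : ℕ) :
    ∀ {g : I → ℝ} {C : ℝ}, (∀ i, g i ≤ C) → pot e k g ≤ C + k * B := by
  induction k with
  | zero => intro g C hg; simpa [pot] using ciSup_le hg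
  | succ k ih =>
    intro g C hg
    refine ciSup_le fun a => ?_
    have h1 : pot e k (g + e a) ≤ (C + B) + k * B := ih fun i => by
      have := (abs_le.1 (he a i)).2
      have := hg i
      simp only [Pi.add_apply]
      linarith
    have h2 : pot e k (g - e a) ≤ (C + B) + k * B := ih fun i => by
      have := (abs_le.1 (he a i)).1
      have := hg i
      simp only [Pi.sub_apply]
      linarith
    push_cast
    linarith

theorem bddAbove_pot_step [Nonempty A] [Nonempty I] (he : ∀ a i, |e a i| ≤ B) (k : ℕ)
    {g : I → ℝ} (hg : BddAbove (Set.range g)) :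
    BddAbove (Set.range fun a => (pot e k (g + e a) + pot e k (g - e a)) / 2) := by
  obtain ⟨C, hC⟩ := hg
  have hC : ∀ i, g i ≤ C := fun i => hC ⟨i, rfl⟩
  refine ⟨(C + B) + k * B, ?_⟩
  rintro _ ⟨a, rfl⟩
  have h1 : pot e k (g + e a) ≤ (C + B) + k * B := pot_le_of_le he k fun i => by
    have := (abs_le.1 (he a i)).2
    have := hC i
    simp only [Pi.add_apply]
    linarith
  have h2 : pot e k (g - e a) ≤ (C + B) + k * B := pot_le_of_le he k fun i => by
    have := (abs_le.1 (he a i)).1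
    have := hC i
    simp only [Pi.sub_apply]
    linarith
  dsimp only
  linarith

theorem pot_step_le [Nonempty A] [Nonempty I] (he : ∀ a i, |e a i| ≤ B) (k : ℕ)
    {g : I → ℝ} (hg : BddAbove (Set.range g)) (a : A) :
    (pot e k (g + e a) + pot e k (g - e a)) / 2 ≤ pot e (k + 1) g :=
  le_ciSup (bddAbove_pot_step he k hg) a

theorem pot_mono [Nonempty A] [Nonempty I] (he : ∀ a i, |e a i| ≤ B) (k : ℕ) :
    ∀ {g g' : I → ℝ}, BddAbove (Set.range g') → g ≤ g' → pot e k g ≤ pot e k g' := by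
  induction k with
  | zero => intro g g' hb h; exact ciSup_mono hb h
  | succ k ih =>
    intro g g' hb h
    refine ciSup_mono (bddAbove_pot_step he k hb) fun a => ?_
    have h1 := ih (bddAbove_range_add hb (he a)) (add_le_add_left h (e a))
    have h2 := ih (bddAbove_range_sub hb (he a)) (sub_le_sub_right h (e a))
    linarith

theorem pot_add_const [Nonempty A] [Nonempty I] (he : ∀ a i, |e a i| ≤ B) (k : ℕ) (c : ℝ) :
    ∀ {g : I → ℝ}, BddAbove (Set.range g) → pot e k (fun i => g i + c) = pot e k g + c := by
  induction k with
  | zero => intro g hb; exact (ciSup_add hb c).symm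
  | succ k ih =>
    intro g hb
    simp only [pot]
    rw [ciSup_add (bddAbove_pot_step he k hb)]
    congr 1
    ext a
    have h1 := ih (bddAbove_range_add hb (he a))
    have h2 := ih (bddAbove_range_sub hb (he a))
    have e1 : (fun i => g i + c) + e a = fun i => (g + e a) i + c := by
      ext i; simp; ring
    have e2 : (fun i => g i + c) - e a = fun i => (g - e a) i + c := by
      ext i; simp; ring
    rw [e1, e2, h1, h2]
    ring

theorem convex_bddAbove_range : Convex ℝ {g : I → ℝ | BddAbove (Set.range g)} := by
  intro g ⟨C, hC⟩ g' ⟨C', hC'⟩ a b ha hb _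
  refine ⟨a * C + b * C', ?_⟩
  rintro _ ⟨i, rfl⟩
  have h1 := mul_le_mul_of_nonneg_left (hC ⟨i, rfl⟩) ha
  have h2 := mul_le_mul_of_nonneg_left (hC' ⟨i, rfl⟩) hb
  simpa using add_le_add h1 h2

/-- Translations, averages and suprema preserve convexity. Convexity is the source of both
symmetrization and the Jensen inequality for mixed strategies. -/
theorem convexOn_pot [Nonempty A] [Nonempty I] (he : ∀ a i, |e a i| ≤ B) (k : ℕ) :
    ConvexOn ℝ {g : I → ℝ | BddAbove (Set.range g)} (pot e k) := by
  refine ⟨convex_bddAbove_range, ?_⟩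
  induction k with
  | zero =>
    intro g hg g' hg' a b ha hb hab
    refine ciSup_le fun i => ?_
    have h1 := mul_le_mul_of_nonneg_left (le_ciSup hg i) ha
    have h2 := mul_le_mul_of_nonneg_left (le_ciSup hg' i) hb
    simpa [pot] using add_le_add h1 h2
  | succ k ih =>
    intro g hg g' hg' a b ha hb hab
    refine ciSup_le fun z => ?_
    have e1 : a • g + b • g' + e z = a • (g + e z) + b • (g' + e z) := by
      rw [smul_add, smul_add]
      nth_rw 1 [← one_smul ℝ (e z), ← hab, add_smul]
      abel
    have e2 : a • g + b • g' - e z = a • (g - e z) + b • (g' - e z) := by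
      rw [smul_sub, smul_sub]
      nth_rw 1 [← one_smul ℝ (e z), ← hab, add_smul]
      abel
    have h1 := ih (bddAbove_range_add hg (he z)) (bddAbove_range_add hg' (he z)) ha hb hab
    have h2 := ih (bddAbove_range_sub hg (he z)) (bddAbove_range_sub hg' (he z)) ha hb hab
    have h3 := mul_le_mul_of_nonneg_left (pot_step_le he k hg z) ha
    have h4 := mul_le_mul_of_nonneg_left (pot_step_le he k hg' z) hb
    rw [e1, e2]
    simp only [smul_eq_mul] at *
    linarith

theorem pot_smul {c : ℝ} (hc : 0 ≤ c) (k : ℕ) :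
    ∀ g : I → ℝ, pot (c • e) k (c • g) = c * pot e k g := by
  induction k with
  | zero => intro g; simp [pot, Real.mul_iSup_of_nonneg hc]
  | succ k ih =>
    intro g
    simp only [pot, Real.mul_iSup_of_nonneg hc, Pi.smul_apply]
    congr 1
    ext a
    rw [← smul_add, ← smul_sub, ih, ih]
    ring

theorem abs_two_smul_le (he : ∀ a i, |e a i| ≤ B) (a : A) (i : I) :
    |((2 : ℝ) • e) a i| ≤ 2 * B := by
  simpa [abs_mul] using he a i

/-- One step of symmetrization, with two atoms. -/
theorem pot_add_sub_le [Nonempty A] [Nonempty I] (he : ∀ a i, |e a i| ≤ B) (k : ℕ)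
    {g : I → ℝ} (hg : BddAbove (Set.range g)) (a b : A) :
    pot ((2 : ℝ) • e) k (g + e a - e b) ≤
      (pot ((2 : ℝ) • e) k (g + ((2 : ℝ) • e) a) +
        pot ((2 : ℝ) • e) k (g - ((2 : ℝ) • e) b)) / 2 := by
  have he2 : ∀ a i, |((2 : ℝ) • e) a i| ≤ 2 * B := abs_two_smul_le he
  have h := (convexOn_pot he2 k).2 (bddAbove_range_add hg (he2 a)) (bddAbove_range_sub hg (he2 b))
    (show (0 : ℝ) ≤ 1 / 2 by norm_num) (show (0 : ℝ) ≤ 1 / 2 by norm_num) (by norm_num)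
  have e1 : g + e a - e b = (1 / 2 : ℝ) • (g + ((2 : ℝ) • e) a) +
      (1 / 2 : ℝ) • (g - ((2 : ℝ) • e) b) := by
    ext i; simp; ring
  rw [e1]
  refine h.trans (le_of_eq ?_)
  simp only [smul_eq_mul]
  ring

end Potential

/-! ### Exponential potentials and the combinatorial bound -/

section Shattering

variable {X I J : Type*}

/-- Shattering of depth `d` at scale `γ`, by recursion on the depth. -/
def ShattersDepth (u : I → X → ℝ) (γ : ℝ) : ℕ → Set I → Prop
  | 0, G => G.Nonempty
  | d + 1, G => ∃ (x : X) (s : ℝ), ShattersDepth u γ d {i ∈ G | s + γ ≤ u i x} ∧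
      ShattersDepth u γ d {i ∈ G | u i x ≤ s - γ}

theorem ShattersDepth.map {u : I → X → ℝ} {v : J → X → ℝ} {γ : ℝ} (φ : I → J)
    (huv : ∀ i x, v (φ i) x = u i x) (d : ℕ) :
    ∀ {G : Set I} {H : Set J}, Set.MapsTo φ G H → ShattersDepth u γ d G →
      ShattersDepth v γ d H := by
  induction d with
  | zero => intro G H h ⟨i, hi⟩; exact ⟨φ i, h hi⟩
  | succ d ih =>
    rintro G H h ⟨x, s, h1, h2⟩
    refine ⟨x, s, ih (fun i hi => ⟨h hi.1, ?_⟩) h1, ih (fun i hi => ⟨h hi.1, ?_⟩) h2⟩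
    · rw [huv]; exact hi.2
    · rw [huv]; exact hi.2

theorem ShattersDepth.mono {u : I → X → ℝ} {γ : ℝ} {d : ℕ} {G H : Set I} (h : G ⊆ H)
    (hG : ShattersDepth u γ d G) : ShattersDepth u γ d H :=
  hG.map id (fun _ _ => rfl) d h

end Shattering

/-! ### The exponential potential and its subadditivity -/

section ExpPotential

variable {A I : Type*}

/-- The exponential counterpart of `pot`. -/
noncomputable def expPot (e : A → I → ℝ) : ℕ → (I → ℝ≥0∞) → ℝ≥0∞
  | 0, w => ⨆ i, w i
  | k + 1, w => ⨆ a, (expPot e k (fun i => w i * ENNReal.ofReal (Real.exp (e a i))) +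
      expPot e k (fun i => w i * ENNReal.ofReal (Real.exp (-e a i)))) / 2

variable {e : A → I → ℝ}

theorem expPot_mono (k : ℕ) : ∀ {w w' : I → ℝ≥0∞}, w ≤ w' → expPot e k w ≤ expPot e k w' := by
  induction k with
  | zero => intro w w' h; exact iSup_mono h
  | succ k ih =>
    intro w w' h
    refine iSup_mono fun a => ?_
    gcongr
    · exact ih fun i => by dsimp only; gcongr; exact h i
    · exact ih fun i => by dsimp only; gcongr; exact h i

/-- Subadditivity is the reason for exponentiating: a class can be split into pieces whose
potentials are bounded separately and added. -/
theorem expPot_add_le (k : ℕ) :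
    ∀ w w' : I → ℝ≥0∞, expPot e k (w + w') ≤ expPot e k w + expPot e k w' := by
  induction k with
  | zero =>
    intro w w'
    exact iSup_le fun i => add_le_add (le_iSup w i) (le_iSup w' i)
  | succ k ih =>
    intro w w'
    refine iSup_le fun a => ?_
    have key : ∀ r : I → ℝ, expPot e k (fun i => (w + w') i * ENNReal.ofReal (r i)) ≤
        expPot e k (fun i => w i * ENNReal.ofReal (r i)) +
          expPot e k (fun i => w' i * ENNReal.ofReal (r i)) := fun r => by
      refine le_trans (le_of_eq ?_) (ih _ _)
      congr 1
      ext i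
      simp [add_mul]
    have h1 := key fun i => Real.exp (e a i)
    have h2 := key fun i => Real.exp (-e a i)
    calc _ ≤ _ := ENNReal.div_le_div_right (add_le_add h1 h2) 2
      _ = (expPot e k (fun i => w i * ENNReal.ofReal (Real.exp (e a i))) +
            expPot e k (fun i => w i * ENNReal.ofReal (Real.exp (-e a i)))) / 2 +
          (expPot e k (fun i => w' i * ENNReal.ofReal (Real.exp (e a i))) +
            expPot e k (fun i => w' i * ENNReal.ofReal (Real.exp (-e a i)))) / 2 := by
          rw [← ENNReal.add_div]; congr 1; ring
      _ ≤ _ := add_le_add (le_iSup (fun a => (expPot e k (fun i => w i *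
            ENNReal.ofReal (Real.exp (e a i))) + expPot e k (fun i => w i *
              ENNReal.ofReal (Real.exp (-e a i)))) / 2) a)
          (le_iSup (fun a => (expPot e k (fun i => w' i *
            ENNReal.ofReal (Real.exp (e a i))) + expPot e k (fun i => w' i *
              ENNReal.ofReal (Real.exp (-e a i)))) / 2) a)

theorem expPot_zero (k : ℕ) : expPot e k 0 = 0 := by
  induction k with
  | zero => simp [expPot]
  | succ k ih =>
    have : (fun _ : I => (0 : ℝ≥0∞)) = 0 := rfl
    simp [expPot, this, ih]

theorem expPot_sum_le {ι : Type*} (s : Finset ι) (k : ℕ) (w : ι → I → ℝ≥0∞) :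
    expPot e k (∑ j ∈ s, w j) ≤ ∑ j ∈ s, expPot e k (w j) := by
  classical
  induction s using Finset.induction_on with
  | empty => simp [expPot_zero]
  | insert j s hj ih =>
    rw [Finset.sum_insert hj, Finset.sum_insert hj]
    exact (expPot_add_le k _ _).trans (add_le_add le_rfl ih)

/-- Jensen's inequality for `exp`, round by round. The form with a real bound `c` excludes infinite
values of `expPot`. -/
theorem exp_pot_le [Nonempty A] [Nonempty I] (k : ℕ) :
    ∀ (g : I → ℝ) (c : ℝ), expPot e k (fun i => ENNReal.ofReal (Real.exp (g i))) ≤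
      ENNReal.ofReal (Real.exp c) → pot e k g ≤ c := by
  induction k with
  | zero =>
    intro g c h
    refine ciSup_le fun i => ?_
    have := (le_iSup (fun i => ENNReal.ofReal (Real.exp (g i))) i).trans h
    rwa [ENNReal.ofReal_le_ofReal_iff (Real.exp_pos _).le, Real.exp_le_exp] at this
  | succ k ih =>
    intro g c h
    refine ciSup_le fun a => ?_
    have h' := (le_iSup (fun a => (expPot e k (fun i => ENNReal.ofReal (Real.exp (g i)) *
      ENNReal.ofReal (Real.exp (e a i))) + expPot e k (fun i => ENNReal.ofReal (Real.exp (g i)) *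
        ENNReal.ofReal (Real.exp (-e a i)))) / 2) a).trans h
    simp only [← ENNReal.ofReal_mul (Real.exp_pos _).le, ← Real.exp_add] at h'
    rw [ENNReal.div_le_iff (by norm_num) (by norm_num)] at h'
    set P := expPot e k fun i => ENNReal.ofReal (Real.exp (g i + e a i)) with hP
    set Q := expPot e k fun i => ENNReal.ofReal (Real.exp (g i + -e a i)) with hQ
    have hfin : P + Q ≠ ∞ := ne_top_of_le_ne_top (by finiteness) h'
    have hPf : P ≠ ∞ := fun h => hfin (by simp [h])
    have hQf : Q ≠ ∞ := fun h => hfin (by simp [h])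
    have hle : P.toReal + Q.toReal ≤ Real.exp c * 2 := by
      rw [← ENNReal.toReal_add hPf hQf]
      have := ENNReal.toReal_mono (by finiteness) h'
      simpa [ENNReal.toReal_ofReal (Real.exp_pos c).le] using this
    have bound : ∀ {R : ℝ≥0∞} (f : I → ℝ), R ≠ ∞ →
        R = expPot e k (fun i => ENNReal.ofReal (Real.exp (f i))) →
        Real.exp (pot e k f) ≤ R.toReal := by
      intro R f hR hRe
      -- The induction hypothesis needs a bound of the form `exp c`, so `R.toReal`, not known to be
      -- positive, is approached from above by positive `b = exp (log b)`.
      refine le_of_forall_gt_imp_ge_of_dense fun b hb => ?_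
      have hb0 : 0 < b := lt_of_le_of_lt ENNReal.toReal_nonneg hb
      rw [← Real.exp_log hb0, Real.exp_le_exp]
      refine ih f _ ?_
      rw [Real.exp_log hb0, ← hRe, ← ENNReal.ofReal_toReal hR]
      exact ENNReal.ofReal_le_ofReal hb.le
    have h1 := bound (g + e a) hPf hP
    have h2 := bound (g - e a) hQf (by simp only [hQ, sub_eq_add_neg]; rfl)
    have hconv := convexOn_exp.2 (Set.mem_univ (pot e k (g + e a)))
      (Set.mem_univ (pot e k (g - e a))) (show (0 : ℝ) ≤ 1 / 2 by norm_num)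
      (show (0 : ℝ) ≤ 1 / 2 by norm_num) (by norm_num)
    simp only [smul_eq_mul] at hconv
    rw [← Real.exp_le_exp]
    calc _ = Real.exp (1 / 2 * pot e k (g + e a) + 1 / 2 * pot e k (g - e a)) := by ring_nf
      _ ≤ _ := hconv
      _ ≤ _ := by linarith

end ExpPotential

/-! ### Sublinear growth of the potential in finite dimension -/

section Bound

variable {A I X : Type*} {e : A → I → ℝ} {B : ℝ}

/-- On `P` each exponent can be replaced by its value at one point `i₀` at the price of a factor
`exp δ`; averaging over the sign then leaves `cosh (e a i₀) ≤ exp (B ^ 2 / 2)`. -/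
theorem expPot_step_le_of_osc (hB : ∀ a i, |e a i| ≤ B) {k : ℕ} {a : A} {P : Set I}
    {δ : ℝ} {M c : ℝ≥0∞} {w : I → ℝ≥0∞} (hw : ∀ i, w i ≤ P.indicator (fun _ => c) i)
    (hosc : ∀ i ∈ P, ∀ j ∈ P, |e a i - e a j| ≤ δ)
    (hM : ∀ (c' : ℝ≥0∞) (w' : I → ℝ≥0∞), (∀ i, w' i ≤ P.indicator (fun _ => c') i) →
      expPot e k w' ≤ c' * M) :
    (expPot e k (fun i => w i * ENNReal.ofReal (Real.exp (e a i))) +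
      expPot e k (fun i => w i * ENNReal.ofReal (Real.exp (-e a i)))) / 2 ≤
      c * ENNReal.ofReal (Real.exp (δ + B ^ 2 / 2)) * M := by
  rcases P.eq_empty_or_nonempty with rfl | ⟨i₀, hi₀⟩
  · have hw0 : ∀ i, w i = 0 := fun i => by simpa using hw i
    have : (fun _ : I => (0 : ℝ≥0∞)) = 0 := rfl
    simp [hw0, this, expPot_zero]
  have key : ∀ (f : I → ℝ), (∀ i ∈ P, f i ≤ f i₀ + δ) →
      expPot e k (fun i => w i * ENNReal.ofReal (Real.exp (f i))) ≤
        c * ENNReal.ofReal (Real.exp (f i₀ + δ)) * M := by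
    intro f hf
    refine hM _ _ fun i => ?_
    by_cases hi : i ∈ P
    · have h1 := hw i
      simp only [Set.indicator_of_mem hi] at h1 ⊢
      gcongr
      exact hf i hi
    · have h1 := hw i
      simp only [Set.indicator_of_notMem hi] at h1 ⊢
      simp [le_antisymm h1 zero_le]
  have h1 := key (fun i => e a i) fun i hi => by linarith [(abs_le.1 (hosc i hi i₀ hi₀)).2]
  have h2 := key (fun i => -e a i) fun i hi => by linarith [(abs_le.1 (hosc i hi i₀ hi₀)).1]
  have hcosh : (ENNReal.ofReal (Real.exp (e a i₀ + δ)) +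
      ENNReal.ofReal (Real.exp (-e a i₀ + δ))) / 2 ≤
        ENNReal.ofReal (Real.exp (δ + B ^ 2 / 2)) := by
    rw [ENNReal.div_le_iff (by norm_num) (by norm_num),
      ← ENNReal.ofReal_add (Real.exp_pos _).le (Real.exp_pos _).le,
      ← ENNReal.ofReal_ofNat 2, ← ENNReal.ofReal_mul (Real.exp_pos _).le]
    refine ENNReal.ofReal_le_ofReal ?_
    have h3 := Real.cosh_le_exp_half_sq (e a i₀)
    have h4 : Real.exp (e a i₀ ^ 2 / 2) ≤ Real.exp (B ^ 2 / 2) := by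
      rw [Real.exp_le_exp]
      have := sq_le_sq' (abs_le.1 (hB a i₀)).1 (abs_le.1 (hB a i₀)).2
      linarith
    rw [Real.cosh_eq] at h3
    rw [Real.exp_add, Real.exp_add, Real.exp_add]
    have h5 := mul_le_mul_of_nonneg_right (h3.trans h4) (Real.exp_pos δ).le
    linarith
  calc _ ≤ (c * ENNReal.ofReal (Real.exp (e a i₀ + δ)) * M +
        c * ENNReal.ofReal (Real.exp (-e a i₀ + δ)) * M) / 2 :=
        ENNReal.div_le_div_right (add_le_add h1 h2) 2
    _ = c * ((ENNReal.ofReal (Real.exp (e a i₀ + δ)) +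
        ENNReal.ofReal (Real.exp (-e a i₀ + δ))) / 2) * M := by
        simp only [div_eq_mul_inv]; ring
    _ ≤ _ := by gcongr

theorem not_shattersDepth_empty (u : I → X → ℝ) (γ : ℝ) (d : ℕ) :
    ¬ ShattersDepth u γ d (∅ : Set I) := by
  induction d with
  | zero => exact Set.not_nonempty_empty
  | succ d ih =>
    rintro ⟨x, s, h, -⟩
    exact ih (h.mono fun i hi => hi.1)

/-- With `N k d = ((K + 1) (k + 1)) ^ d`, this is the recursion `N k (d + 1) + K * N k d ≤ N (k + 1)
(d + 1)`: one piece keeps its dimension and `K` pieces lose one. -/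
theorem covering_recursion_le (K k d : ℕ) :
    ((K + 1 : ℝ) * (k + 1)) ^ (d + 1) + K * ((K + 1 : ℝ) * (k + 1)) ^ d ≤
      ((K + 1 : ℝ) * (k + 1 + 1)) ^ (d + 1) := by
  have h : ((K + 1 : ℝ) * (k + 1)) ^ d ≤ ((K + 1 : ℝ) * (k + 1 + 1)) ^ d := by
    gcongr; linarith
  have h0 : 0 ≤ ((K + 1 : ℝ) * (k + 1)) ^ d := by positivity
  have hK : (0 : ℝ) ≤ K := K.cast_nonneg
  calc _ = ((K + 1 : ℝ) * (k + 1)) ^ d * ((K + 1 : ℝ) * (k + 1) + K) := by ring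
    _ ≤ ((K + 1 : ℝ) * (k + 1 + 1)) ^ d * ((K + 1 : ℝ) * (k + 1 + 1)) := by
      gcongr
      nlinarith
    _ = _ := by ring

/-- Induction on the number of rounds. The atom played cuts `G` into one piece `H` that may keep the
dimension and at most `K` pieces of smaller dimension. Every piece has oscillation at most `4 * L *
γ` at this atom, hence pays a factor `ρ`. -/
theorem expPot_le_of_not_shattersDepth {u : I → X → ℝ} (hu : ∀ i x, |u i x| ≤ 1) {π : A → X}
    {L γ : ℝ} (hγ : 0 < γ) (hL0 : 0 ≤ L) (hB : ∀ a i, |e a i| ≤ B)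
    {K : ℕ} (hK : 1 / γ < K) (k : ℕ) :
    ∀ (d : ℕ) (G : Set I),
      (∀ a, ∀ i ∈ G, ∀ j ∈ G, |e a i - e a j| ≤ L * |u i (π a) - u j (π a)|) →
      ¬ ShattersDepth u γ d G → ∀ (c : ℝ≥0∞) (w : I → ℝ≥0∞),
      (∀ i, w i ≤ G.indicator (fun _ => c) i) →
      expPot e k w ≤ c * ENNReal.ofReal (((K + 1 : ℝ) * (k + 1)) ^ d *
        Real.exp (4 * L * γ + B ^ 2 / 2) ^ k) := by
  induction k with
  | zero =>
    intro d G _ _ c w hw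
    refine iSup_le fun i => (hw i).trans ?_
    have h1 : (1 : ℝ) ≤ ((K + 1 : ℝ) * ((0 : ℕ) + 1)) ^ d :=
      one_le_pow₀ (by have : (0 : ℝ) ≤ K := K.cast_nonneg
                      simp)
    refine (Set.indicator_le_self' (fun _ _ => zero_le) i).trans ?_
    calc c = c * ENNReal.ofReal 1 := by simp
      _ ≤ _ := by
        gcongr
        simpa using h1
  | succ k ih =>
    intro d G hL hG c w hw
    cases d with
    | zero =>
      have hG' : G = ∅ := Set.not_nonempty_iff_eq_empty.1 hG
      have : w = 0 := by
        ext i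
        simpa [hG'] using hw i
      rw [this, expPot_zero]
      exact zero_le
    | succ d =>
      classical
      refine iSup_le fun a => ?_
      set ρ := Real.exp (4 * L * γ + B ^ 2 / 2) with hρ
      -- Bins of width `2 * γ` covering `[-1, 1]`; since `1 / γ < K`, the indices stay below `K`.
      let bin : I → ℕ := fun i => ⌊(u i (π a) + 1) / (2 * γ)⌋₊
      have hnn : ∀ i, 0 ≤ (u i (π a) + 1) / (2 * γ) := fun i =>
        div_nonneg (by linarith [(abs_le.1 (hu i (π a))).1]) (by linarith)
      have hbin_le : ∀ i, 2 * γ * bin i ≤ u i (π a) + 1 := fun i => by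
        have := Nat.floor_le (hnn i)
        rw [le_div_iff₀ (by linarith)] at this
        linarith
      have hbin_lt : ∀ i, u i (π a) + 1 < 2 * γ * (bin i + 1) := fun i => by
        have := Nat.lt_floor_add_one ((u i (π a) + 1) / (2 * γ))
        rw [div_lt_iff₀ (by linarith)] at this
        linarith
      have hbinK : ∀ i, bin i < K := fun i => by
        rw [Nat.floor_lt (hnn i)]
        refine lt_of_le_of_lt ?_ hK
        rw [div_le_div_iff₀ (by linarith) hγ]
        nlinarith [(abs_le.1 (hu i (π a))).2]
      let full : ℕ → Prop := fun j => ShattersDepth u γ d {i ∈ G | bin i = j}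
      have hfull : ∀ j j', full j → full j' → j' ≤ j + 1 := by
        intro j j' hj hj'
        by_contra! hlt
        -- The threshold is the midpoint of bin `j + 1`: bin `j` lies below it by at least `γ`, and
        -- every bin from `j + 2` on lies above it by at least `γ`. Two full bins that far apart
        -- would shatter one more level.
        refine hG ⟨π a, 2 * γ * (j + 1) - 1 + γ, hj'.mono fun i hi => ⟨hi.1, ?_⟩,
          hj.mono fun i hi => ⟨hi.1, ?_⟩⟩
        · have h1 := hbin_le i
          have h2 : ((j : ℝ) + 2) ≤ bin i := by
            rw [hi.2]; exact_mod_cast hlt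
          nlinarith
        · have h1 := hbin_lt i
          rw [hi.2] at h1
          linarith
      -- `H` collects the full bins, which are pairwise equal or adjacent; `P j` is bin `j` when it
      -- is not full, and empty otherwise.
      let H : Set I := {i ∈ G | full (bin i)}
      let P : ℕ → Set I := fun j => {i ∈ G | bin i = j ∧ ¬ full j}
      have hosc : ∀ i ∈ G, ∀ j ∈ G, bin i ≤ bin j + 1 → bin j ≤ bin i + 1 →
          |e a i - e a j| ≤ 4 * L * γ := by
        intro i hi j hj h1 h2
        have h1' : (bin i : ℝ) ≤ bin j + 1 := by exact_mod_cast h1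
        have h2' : (bin j : ℝ) ≤ bin i + 1 := by exact_mod_cast h2
        have h3 : |u i (π a) - u j (π a)| ≤ 4 * γ := by
          rw [abs_le]
          constructor
          · nlinarith [hbin_le i, hbin_lt j]
          · nlinarith [hbin_le j, hbin_lt i]
        calc _ ≤ _ := hL a i hi j hj
          _ ≤ L * (4 * γ) := by gcongr
          _ = _ := by ring
      have hHsh : ¬ ShattersDepth u γ (d + 1) H := fun h => hG (h.mono fun i hi => hi.1)
      have hPsh : ∀ j, ¬ ShattersDepth u γ d (P j) := fun j h => by
        by_cases hj : full j
        · have : P j = ∅ := by ext i; simp [P, hj]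
          rw [this] at h
          exact not_shattersDepth_empty u γ d h
        · exact hj (h.mono fun i hi => ⟨hi.1, hi.2.1⟩)
      set N : ℕ → ℝ≥0∞ := fun d => ENNReal.ofReal (((K + 1 : ℝ) * (k + 1)) ^ d * ρ ^ k) with hN
      let Q : (I → ℝ) → (I → ℝ≥0∞) → ℝ≥0∞ := fun f v =>
        expPot e k (fun i => v i * ENNReal.ofReal (Real.exp (f i)))
      have hind : ∀ (S : Set I), S ⊆ G → ∀ i, S.indicator w i ≤ S.indicator (fun _ => c) i := by
        intro S hS i
        by_cases hi : i ∈ S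
        · have := hw i
          rw [Set.indicator_of_mem (hS hi)] at this
          simpa [hi] using this
        · simp [hi]
      have hsplit : w ≤ H.indicator w + ∑ j ∈ Finset.range K, (P j).indicator w := by
        intro i
        simp only [Pi.add_apply, Finset.sum_apply]
        by_cases hi : i ∈ G
        · by_cases hf : full (bin i)
          · have : i ∈ H := ⟨hi, hf⟩
            simp [this]
          · have hP : i ∈ P (bin i) := ⟨hi, rfl, hf⟩
            have h1 := Finset.single_le_sum (f := fun j => (P j).indicator w i)
              (fun j _ => zero_le) (Finset.mem_range.2 (hbinK i))
            simp only [Set.indicator_of_mem hP] at h1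
            exact h1.trans le_add_self
        · have := hw i
          rw [Set.indicator_of_notMem hi] at this
          exact this.trans zero_le
      have hQ : ∀ f, Q f w ≤ Q f (H.indicator w) +
          ∑ j ∈ Finset.range K, Q f ((P j).indicator w) := by
        intro f
        calc Q f w ≤ expPot e k ((fun i => H.indicator w i * ENNReal.ofReal (Real.exp (f i))) +
              ∑ j ∈ Finset.range K, fun i => (P j).indicator w i *
                ENNReal.ofReal (Real.exp (f i))) := by
              refine expPot_mono k fun i => ?_
              have := mul_le_mul_left (hsplit i) (ENNReal.ofReal (Real.exp (f i)))
              simpa [add_mul, Finset.sum_mul] using this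
          _ ≤ _ := (expPot_add_le k _ _).trans (add_le_add le_rfl (expPot_sum_le _ k _))
      have hstepH : (Q (e a) (H.indicator w) + Q (fun i => -e a i) (H.indicator w)) / 2 ≤
          c * ENNReal.ofReal ρ * N (d + 1) :=
        expPot_step_le_of_osc hB (hind H fun i hi => hi.1)
          (fun i hi j hj => hosc i hi.1 j hj.1 (hfull _ _ hj.2 hi.2) (hfull _ _ hi.2 hj.2))
          (fun c' w' h => ih (d + 1) H (fun a i hi j hj => hL a i hi.1 j hj.1) hHsh c' w' h)
      have hstepP : ∀ j, (Q (e a) ((P j).indicator w) +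
          Q (fun i => -e a i) ((P j).indicator w)) / 2 ≤ c * ENNReal.ofReal ρ * N d := fun j =>
        expPot_step_le_of_osc hB (hind (P j) fun i hi => hi.1)
          (fun i hi i' hi' => hosc i hi.1 i' hi'.1 (by rw [hi.2.1, hi'.2.1]; omega)
            (by rw [hi.2.1, hi'.2.1]; omega))
          (fun c' w' h => ih d (P j) (fun a i hi j hj => hL a i hi.1 j hj.1) (hPsh j) c' w' h)
      calc _ ≤ (Q (e a) (H.indicator w) + Q (fun i => -e a i) (H.indicator w)) / 2 +
            ∑ j ∈ Finset.range K, (Q (e a) ((P j).indicator w) +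
              Q (fun i => -e a i) ((P j).indicator w)) / 2 := by
            refine (ENNReal.div_le_div_right (add_le_add (hQ _) (hQ _)) 2).trans (le_of_eq ?_)
            simp only [div_eq_mul_inv]
            rw [← Finset.sum_mul, ← add_mul, Finset.sum_add_distrib]
            congr 1
            ring
        _ ≤ c * ENNReal.ofReal ρ * N (d + 1) +
            ∑ j ∈ Finset.range K, c * ENNReal.ofReal ρ * N d :=
            add_le_add hstepH (Finset.sum_le_sum fun j _ => hstepP j)
        _ = c * ENNReal.ofReal ((((K + 1 : ℝ) * (k + 1)) ^ (d + 1) +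
              K * ((K + 1 : ℝ) * (k + 1)) ^ d) * ρ ^ (k + 1)) := by
            have hρ0 : 0 ≤ ρ := (Real.exp_pos _).le
            rw [Finset.sum_const, Finset.card_range, nsmul_eq_mul, hN, mul_assoc, mul_assoc,
              ← ENNReal.ofReal_mul hρ0, ← ENNReal.ofReal_mul hρ0,
              ← ENNReal.ofReal_natCast, mul_left_comm (ENNReal.ofReal (K : ℝ)) c, ← ENNReal.ofReal_mul (by positivity), ← mul_add,
              ← ENNReal.ofReal_add (by positivity) (by positivity)]
            congr 2
            ring
        _ ≤ _ := by
            have hρ0 : 0 ≤ ρ := (Real.exp_pos _).le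
            have := covering_recursion_le K k d
            push_cast
            gcongr

/-- The exponential bound is applied to `t • e` and the logarithm is divided by `t`, with `t` left
free for optimization. The term `log 2` comes from covering the index set by the two pieces `G` and
`G'`. -/
theorem pot_zero_le_of_not_shattersDepth [Nonempty A] [Nonempty I] {u : I → X → ℝ}
    (hu : ∀ i x, |u i x| ≤ 1) {π : A → X} {L γ : ℝ} (hγ : 0 < γ) (hL0 : 0 ≤ L)
    (hB : ∀ a i, |e a i| ≤ B) {K : ℕ} (hK : 1 / γ < K) {d : ℕ} {G G' : Set I}
    (hL : ∀ a, ∀ i ∈ G, ∀ j ∈ G, |e a i - e a j| ≤ L * |u i (π a) - u j (π a)|)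
    (hLG : ∀ a, ∀ i ∈ G', ∀ j ∈ G', |e a i - e a j| ≤ L * |u i (π a) - u j (π a)|)
     (hGG : G ∪ G' = Set.univ)
    (hG : ¬ ShattersDepth u γ d G) (hG' : ¬ ShattersDepth u γ d G') {t : ℝ} (ht : 0 < t) (n : ℕ) :
    pot e n 0 ≤ (Real.log 2 + d * (Real.log (K + 1) + Real.log (n + 1))) / t +
      n * (4 * L * γ + t * B ^ 2 / 2) := by
  classical
  have hB' : ∀ a i, |(t • e) a i| ≤ t * B := fun a i => by
    simpa [abs_mul, abs_of_pos ht] using mul_le_mul_of_nonneg_left (hB a i) ht.le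
  have hL' : ∀ {S : Set I}, (∀ a, ∀ i ∈ S, ∀ j ∈ S, |e a i - e a j| ≤ L * |u i (π a) - u j (π a)|) →
      ∀ a, ∀ i ∈ S, ∀ j ∈ S, |(t • e) a i - (t • e) a j| ≤ (t * L) * |u i (π a) - u j (π a)| := by
    intro S hS a i hi j hj
    have := mul_le_mul_of_nonneg_left (hS a i hi j hj) ht.le
    simpa [← mul_sub, abs_mul, abs_of_pos ht, mul_assoc] using this
  have hb : ∀ S : Set I, ¬ ShattersDepth u γ d S → _ → _ := fun S hS hLS =>
    expPot_le_of_not_shattersDepth (e := t • e) hu hγ (by positivity) hB' hK n d S (hL' hLS) hS 1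
      (S.indicator fun _ => 1) fun _ => le_rfl
  set ρ := Real.exp (4 * (t * L) * γ + (t * B) ^ 2 / 2)
  have h1 : expPot (t • e) n (fun i => ENNReal.ofReal (Real.exp ((0 : I → ℝ) i))) ≤
      ENNReal.ofReal (Real.exp (Real.log 2 + d * (Real.log (K + 1) + Real.log (n + 1)) +
        n * (4 * (t * L) * γ + (t * B) ^ 2 / 2))) := by
    calc _ ≤ expPot (t • e) n ((G.indicator fun _ => 1) + (G'.indicator fun _ => 1)) := by
          refine expPot_mono n fun i => ?_
          have : i ∈ G ∪ G' := hGG ▸ Set.mem_univ i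
          rcases this with hi | hi <;> simp [hi]
      _ ≤ _ := (expPot_add_le n _ _).trans (add_le_add (hb G hG hL) (hb G' hG' hLG))
      _ = _ := by
          rw [one_mul, ← two_mul, ← ENNReal.ofReal_ofNat 2, ← ENNReal.ofReal_mul (by norm_num)]
          congr 1
          have hK0 : (0 : ℝ) < K + 1 := by positivity
          have hn0 : (0 : ℝ) < n + 1 := by positivity
          rw [Real.exp_add, Real.exp_add, Real.exp_log (by norm_num), mul_comm (d : ℝ),
            Real.exp_mul, Real.exp_add, Real.exp_log hK0, Real.exp_log hn0, Real.rpow_natCast,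
            mul_comm (n : ℝ), Real.exp_mul, Real.rpow_natCast]
          ring
  have h2 := exp_pot_le n _ _ h1
  have h3 : pot (t • e) n (0 : I → ℝ) = t * pot e n 0 := by
    simpa using pot_smul (e := e) ht.le n 0
  rw [h3] at h2
  have h4 : pot e n 0 ≤ (Real.log 2 + d * (Real.log (K + 1) + Real.log (n + 1)) +
        n * (4 * (t * L) * γ + (t * B) ^ 2 / 2)) / t := by
    rw [le_div_iff₀ ht]; linarith
  refine h4.trans (le_of_eq ?_)
  field_simp

/-- If the shattering depth is finite at every scale, the potential grows sublinearly. -/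
theorem eventually_pot_zero_le [Nonempty A] [Nonempty I] {u : I → X → ℝ}
    (hu : ∀ i x, |u i x| ≤ 1) {π : A → X} {L : ℝ} (hL0 : 0 ≤ L)
    (hB : ∀ a i, |e a i| ≤ B) {G G' : Set I}
    (hL : ∀ a, ∀ i ∈ G, ∀ j ∈ G, |e a i - e a j| ≤ L * |u i (π a) - u j (π a)|)
    (hLG : ∀ a, ∀ i ∈ G', ∀ j ∈ G', |e a i - e a j| ≤ L * |u i (π a) - u j (π a)|)
    (hGG : G ∪ G' = Set.univ)
    (hsh : ∀ γ : ℝ, 0 < γ → ∃ d, ¬ ShattersDepth u γ d G ∧ ¬ ShattersDepth u γ d G')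
    {δ : ℝ} (hδ : 0 < δ) : ∀ᶠ n : ℕ in atTop, pot e n 0 ≤ δ * n := by
  -- `γ` and `t` are chosen so that `4 * L * γ` and `t * B ^ 2 / 2` are at most `δ / 4` each; the
  -- remaining `δ / 2` absorbs the logarithmic term for large `n`.
  set γ := δ / (16 * (L + 1)) with hγd
  have hγ : 0 < γ := by positivity
  set t := δ / (2 * (B ^ 2 + 1)) with htd
  have ht : 0 < t := by positivity
  obtain ⟨d, hG, hG'⟩ := hsh γ hγ
  obtain ⟨K, hK⟩ := exists_nat_gt (1 / γ)
  have hlog : Tendsto (fun n : ℕ => ((Real.log 2 + d * (Real.log (K + 1) +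
      Real.log (n + 1))) / t) / n) atTop (nhds 0) := by
    have h1 : Tendsto (fun n : ℕ => Real.log (n + 1) / n) atTop (nhds 0) := by
      have h := (Real.tendsto_pow_log_div_mul_add_atTop 1 (-1) 1 one_ne_zero).comp
        (tendsto_natCast_atTop_atTop.atTop_add (tendsto_const_nhds (x := (1 : ℝ))))
      refine h.congr fun n => ?_
      simp
    have h2 : Tendsto (fun n : ℕ => (1 : ℝ) / n) atTop (nhds 0) :=
      tendsto_one_div_atTop_nhds_zero_nat
    have h3 := (h2.const_mul ((Real.log 2 + d * Real.log (K + 1)) / t)).add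
      (h1.const_mul (d / t))
    simp only [mul_zero, add_zero] at h3
    refine h3.congr fun n => ?_
    ring
  filter_upwards [hlog.eventually (gt_mem_nhds (show (0 : ℝ) < δ / 2 by linarith)),
    eventually_gt_atTop 0] with n hn hn0
  have hn0' : (0 : ℝ) < n := by exact_mod_cast hn0
  refine (pot_zero_le_of_not_shattersDepth hu hγ hL0 hB hK hL hLG hGG hG hG' ht n).trans ?_
  rw [div_lt_iff₀ hn0'] at hn
  have h1 : 4 * L * γ ≤ δ / 4 := by
    rw [hγd, mul_div_assoc', div_le_div_iff₀ (by positivity) (by norm_num)]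
    nlinarith
  have h2 : t * B ^ 2 / 2 ≤ δ / 4 := by
    rw [htd, div_mul_eq_mul_div, div_div, div_le_div_iff₀ (by positivity) (by norm_num)]
    nlinarith [sq_nonneg B]
  nlinarith

end Bound

universe u

/-! ### Trees and the sequential fat-shattering dimension -/

section Trees

variable {A : Type u}

/-- The tree with root `a` and subtrees `T true` and `T false`. -/
def BinTree.cons {n : ℕ} (a : A) (T : Bool → BinTree A n) : BinTree A (n + 1) :=
  Fin.cases (fun _ => a) (fun t (p : Fin (t + 1) → Bool) => T (p 0) t (Fin.tail p))

theorem BinTree.cons_succ_past {n : ℕ} (a : A) (T : Bool → BinTree A n) (ε : Fin (n + 1) → Bool)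
    (t : Fin n) : BinTree.cons a T t.succ (past t.succ ε) = T (ε 0) t (past t (Fin.tail ε)) :=
  rfl

end Trees

section Sfat

variable {X : Type u}

/-- The point and threshold of each recursion step become a root, and the witnesses for the two
halves become its subtrees. -/
theorem ShattersDepth.exists_binTree {γ : ℝ} (d : ℕ) : ∀ {G : Set (X → Label)},
    ShattersDepth (fun f x => (f x : ℝ)) γ d G → ∃ x : BinTree X d, Shatters G γ x := by
  induction d with
  | zero =>
    rintro G ⟨f, hf⟩
    exact ⟨fun t => t.elim0, fun t => t.elim0, fun ε => ⟨f, hf, fun t => t.elim0⟩⟩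
  | succ d ih =>
    rintro G ⟨x, s, h1, h2⟩
    obtain ⟨x1, s1, hs1⟩ := ih h1
    obtain ⟨x2, s2, hs2⟩ := ih h2
    refine ⟨BinTree.cons x fun b => if b then x1 else x2,
      BinTree.cons s fun b => if b then s1 else s2, fun ε => ?_⟩
    rcases hb : ε 0 with _ | _
    · obtain ⟨f, hf, hft⟩ := hs2 (Fin.tail ε)
      refine ⟨f, hf.1, Fin.cases ?_ fun t => ?_⟩
      · have := hf.2
        simp only [hb, sgn, BinTree.cons, Fin.cases_zero, Bool.false_eq_true, if_false]
        linarith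
      · rw [BinTree.cons_succ_past, BinTree.cons_succ_past, hb]
        exact hft t
    · obtain ⟨f, hf, hft⟩ := hs1 (Fin.tail ε)
      refine ⟨f, hf.1, Fin.cases ?_ fun t => ?_⟩
      · have := hf.2
        simp only [hb, sgn, BinTree.cons, Fin.cases_zero, if_true]
        linarith
      · rw [BinTree.cons_succ_past, BinTree.cons_succ_past, hb]
        exact hft t

theorem exists_not_shattersDepth {F : Set (X → Label)} {γ : ℝ} (h : sfat F γ < ⊤) :
    ∃ d, ¬ ShattersDepth (fun (f : X → Label) x => (f x : ℝ)) γ d F := by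
  by_contra! hd
  refine h.ne (ENat.eq_top_iff_forall_ge.2 fun n => ?_)
  exact le_iSup₂_of_le n ((hd n).exists_binTree) le_rfl

theorem frequently_shatters {F : Set (X → Label)} {γ : ℝ} (h : ¬ sfat F γ < ⊤) :
    ∃ᶠ n : ℕ in atTop, ∃ x : BinTree X n, Shatters F γ x := by
  rw [frequently_atTop]
  intro N
  by_contra! hN
  refine h (lt_of_le_of_lt (iSup₂_le fun n hn => ?_) (ENat.natCast_lt_top N))
  by_contra! hlt
  exact (hN n (by exact_mod_cast hlt.le)) hn.choose hn.choose_spec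

theorem abs_label_le (y : Label) : |(y : ℝ)| ≤ 1 := abs_le.2 y.2

theorem not_shattersDepth_of_val {I : Type*} {F : Set (X → Label)} {γ : ℝ} {d : ℕ}
    (h : ¬ ShattersDepth (fun (f : X → Label) x => (f x : ℝ)) γ d F) {u : I → X → ℝ} {G : Set I}
    (φ : I → F) (hu : ∀ i x, u i x = (φ i : X → Label) x) : ¬ ShattersDepth u γ d G := fun hs =>
  h (hs.map (fun i => (φ i : X → Label)) (fun i x => (hu i x).symm) d fun i _ => (φ i).2)

/-- The potential of a function that depends in a Lipschitz way on the values of the class grows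
sublinearly if the dimension is finite at every scale. -/
theorem eventually_pot_le {A : Type*} [Nonempty A] {F : Set (X → Label)} (hF : F.Nonempty)
    (h : ∀ γ : ℝ, 0 < γ → sfat F γ < ⊤) {e : A → F → ℝ} {π : A → X} {B L : ℝ} (hL0 : 0 ≤ L)
    (hB : ∀ a f, |e a f| ≤ B) (hL : ∀ a (f f' : F),
      |e a f - e a f'| ≤ L * |((f : X → Label) (π a) : ℝ) - (f' : X → Label) (π a)|)
    {δ : ℝ} (hδ : 0 < δ) : ∀ᶠ n : ℕ in atTop, pot e n 0 ≤ δ * n := by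
  have : Nonempty F := hF.to_subtype
  refine eventually_pot_zero_le (u := fun (f : F) x => ((f : X → Label) x : ℝ))
    (G := Set.univ) (G' := Set.univ) (fun f x => abs_label_le _) hL0 hB
    (fun a i _ j _ => hL a i j) (fun a i _ j _ => hL a i j) (by simp) (fun γ hγ => ?_) hδ
  obtain ⟨d, hd⟩ := exists_not_shattersDepth (h γ hγ)
  have := not_shattersDepth_of_val hd (u := fun (f : F) x => ((f : X → Label) x : ℝ))
    (G := Set.univ) id (fun _ _ => rfl)
  exact ⟨d, this, this⟩

theorem abs_sgn (b : Bool) : |sgn b| = 1 := by cases b <;> simp [sgn]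

/-- The two-sided version of `eventually_pot_le`. -/
theorem eventually_pot_signed_le {A : Type*} [Nonempty A] {F : Set (X → Label)} (hF : F.Nonempty)
    (h : ∀ γ : ℝ, 0 < γ → sfat F γ < ⊤) {e : A → F → ℝ} {π : A → X} {B L : ℝ} (hL0 : 0 ≤ L)
    (hB : ∀ a f, |e a f| ≤ B) (hL : ∀ a (f f' : F),
      |e a f - e a f'| ≤ L * |((f : X → Label) (π a) : ℝ) - (f' : X → Label) (π a)|)
    {δ : ℝ} (hδ : 0 < δ) :
    ∀ᶠ n : ℕ in atTop, pot (fun a (p : F × Bool) => sgn p.2 * e a p.1) n 0 ≤ δ * n := by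
  have : Nonempty F := hF.to_subtype
  -- The signed payoff is Lipschitz in the values of the class only for a fixed sign, so the two
  -- signs form the two pieces.
  refine eventually_pot_zero_le (u := fun (p : F × Bool) x => ((p.1 : X → Label) x : ℝ)) (B := B)
    (π := π) (G := {p | p.2 = true}) (G' := {p | p.2 = false}) (fun f x => abs_label_le _) hL0
    (fun a p => ?_) ?_ ?_ ?_ (fun γ hγ => ?_) hδ
  · rw [abs_mul, abs_sgn, one_mul]; exact hB a p.1
  · rintro a ⟨f, b⟩ rfl ⟨f', b'⟩ rfl
    simpa [sgn] using hL a f f'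
  · rintro a ⟨f, b⟩ rfl ⟨f', b'⟩ rfl
    simpa [sgn, abs_sub_comm, ← sub_eq_neg_add] using hL a f f'
  · ext ⟨f, b⟩; cases b <;> simp
  · obtain ⟨d, hd⟩ := exists_not_shattersDepth (h γ hγ)
    exact ⟨d, not_shattersDepth_of_val hd Prod.fst (fun _ _ => rfl),
      not_shattersDepth_of_val hd Prod.fst (fun _ _ => rfl)⟩

theorem abs_loss_le (z : Sample X) (f : X → Label) : |loss z f| ≤ 2 := by
  rw [loss, abs_abs]
  have h1 := abs_le.1 (abs_label_le z.2)
  have h2 := abs_le.1 (abs_label_le (f z.1))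
  exact abs_le.2 ⟨by linarith, by linarith⟩

theorem abs_loss_sub_loss_le (z : Sample X) (f f' : X → Label) :
    |loss z f - loss z f'| ≤ |(f z.1 : ℝ) - f' z.1| := by
  have := abs_abs_sub_abs_le_abs_sub ((z.2 : ℝ) - f z.1) ((z.2 : ℝ) - f' z.1)
  rw [loss, loss]
  refine this.trans (le_of_eq ?_)
  rw [abs_sub_comm]
  congr 1
  ring

instance : Nonempty Label := ⟨⟨0, by norm_num⟩⟩

end Sfat

/-! ### Finitely supported distributions and the minimax theorem -/

section Minimax

variable {I Z : Type*}

/-- The integral of `h` against the finitely supported signed measure `q`. -/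
noncomputable def expect (q : I →₀ ℝ) (h : I → ℝ) : ℝ := Finsupp.linearCombination ℝ h q

theorem expect_eq_sum (q : I →₀ ℝ) (h : I → ℝ) : expect q h = ∑ i ∈ q.support, q i * h i := by
  simp [expect, Finsupp.linearCombination_apply, Finsupp.sum]

/-- Finitely supported probability distributions. -/
def distr (I : Type*) : Set (I →₀ ℝ) := {q | (∀ i, 0 ≤ q i) ∧ expect q (fun _ => 1) = 1}

theorem convex_distr : Convex ℝ (distr I) := by
  intro q hq q' hq' a b ha hb hab
  refine ⟨fun i => ?_, ?_⟩
  · have := mul_nonneg ha (hq.1 i)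
    have := mul_nonneg hb (hq'.1 i)
    simp only [Finsupp.add_apply, Finsupp.smul_apply, smul_eq_mul]
    linarith
  · have h1 := hq.2
    have h2 := hq'.2
    simp only [expect] at *
    simp [h1, h2, hab]

theorem single_mem_distr (i : I) : Finsupp.single i (1 : ℝ) ∈ distr I :=
  ⟨fun j => Finsupp.single_nonneg.2 zero_le_one j, by simp [expect]⟩

@[simp]
theorem expect_single (i : I) (h : I → ℝ) : expect (Finsupp.single i 1) h = h i := by
  simp [expect]

theorem expect_add (q : I →₀ ℝ) (h h' : I → ℝ) :
    expect q (fun i => h i + h' i) = expect q h + expect q h' := by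
  simp only [expect_eq_sum, mul_add, Finset.sum_add_distrib]

theorem expect_neg (q : I →₀ ℝ) (h : I → ℝ) : expect q (fun i => -h i) = -expect q h := by
  simp only [expect_eq_sum, mul_neg, Finset.sum_neg_distrib]

theorem expect_sub (q : I →₀ ℝ) (h h' : I → ℝ) :
    expect q (fun i => h i - h' i) = expect q h - expect q h' := by
  simp only [expect_eq_sum, mul_sub, Finset.sum_sub_distrib]

theorem expect_const {q : I →₀ ℝ} (hq : q ∈ distr I) (c : ℝ) : expect q (fun _ => c) = c := by
  have := hq.2
  rw [expect_eq_sum] at this ⊢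
  rw [← Finset.sum_mul]
  simp only [mul_one] at this
  rw [this, one_mul]

theorem expect_mono {q : I →₀ ℝ} (hq : q ∈ distr I) {h h' : I → ℝ} (hh : ∀ i, h i ≤ h' i) :
    expect q h ≤ expect q h' := by
  rw [expect_eq_sum, expect_eq_sum]
  exact Finset.sum_le_sum fun i _ => mul_le_mul_of_nonneg_left (hh i) (hq.1 i)

theorem abs_expect_le {q : I →₀ ℝ} (hq : q ∈ distr I) {h : I → ℝ} {B : ℝ} (hh : ∀ i, |h i| ≤ B) :
    |expect q h| ≤ B := by
  rw [abs_le]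
  constructor
  · rw [← expect_const hq (-B)]
    exact expect_mono hq fun i => (abs_le.1 (hh i)).1
  · rw [← expect_const hq B]
    exact expect_mono hq fun i => (abs_le.1 (hh i)).2

theorem expect_comm (q : I →₀ ℝ) (p : Z →₀ ℝ) (φ : Z → I → ℝ) :
    expect q (fun i => expect p fun z => φ z i) = expect p fun z => expect q (φ z) := by
  simp only [expect_eq_sum, Finset.mul_sum]
  rw [Finset.sum_comm]
  exact Finset.sum_congr rfl fun z _ => Finset.sum_congr rfl fun i _ => by ring

/-- Jensen's inequality for the convex potential under a finitely supported mixture. -/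
theorem pot_expect_le {A : Type*} [Nonempty A] [Nonempty I] {e : A → I → ℝ} {B : ℝ}
    (he : ∀ a i, |e a i| ≤ B) (k : ℕ) {p : Z →₀ ℝ} (hp : p ∈ distr Z) {G : Z → I → ℝ}
    (hG : ∀ z, BddAbove (Set.range (G z))) :
    pot e k (fun i => expect p fun z => G z i) ≤ expect p fun z => pot e k (G z) := by
  have h := (convexOn_pot he k).map_sum_le (t := p.support) (w := fun z => p z) (p := G)
    (fun z _ => hp.1 z) (by simpa [expect_eq_sum] using hp.2) (fun z _ => hG z)
  simp only [smul_eq_mul] at h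
  rw [expect_eq_sum]
  refine le_trans (le_of_eq ?_) h
  congr 1
  ext i
  simp [expect_eq_sum]

/-- A convex set that meets every half space `c' ≤ ⟨w, y⟩`, `w` in the simplex, has a point all of
whose coordinates exceed `c < c'`. -/
theorem exists_forall_lt_of_convex {J : Type*} [Fintype J] {C : Set (J → ℝ)} (hC : Convex ℝ C)
    (hne : C.Nonempty) {c c' : ℝ} (hcc : c < c')
    (h : ∀ w : J → ℝ, (∀ j, 0 ≤ w j) → ∑ j, w j = 1 → ∃ y ∈ C, c' ≤ ∑ j, w j * y j) :
    ∃ y ∈ C, ∀ j, c < y j := by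
  classical
  by_contra! hcon
  have hD : Convex ℝ {y : J → ℝ | ∀ j, c < y j} := by
    have : {y : J → ℝ | ∀ j, c < y j} = Set.univ.pi fun _ => Set.Ioi c := by ext; simp
    rw [this]
    exact convex_pi fun _ _ => convex_Ioi c
  have hDo : IsOpen {y : J → ℝ | ∀ j, c < y j} := by
    simp only [Set.ofPred_forall]
    exact isOpen_iInter_of_finite fun j => isOpen_lt continuous_const (continuous_apply j)
  obtain ⟨f, u, hf1, hf2⟩ := geometric_hahn_banach_open hD hDo hC
    (Set.disjoint_left.2 fun y hy hyC => by
      obtain ⟨j, hj⟩ := hcon y hyC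
      exact absurd (hy j) (not_lt.2 hj))
  set a : J → ℝ := fun j => f (Pi.single j 1) with ha
  have hfa : ∀ y, f y = ∑ j, y j * a j := fun y => by
    conv_lhs => rw [← Finset.univ_sum_single y, map_sum]
    refine Finset.sum_congr rfl fun j _ => ?_
    rw [ha, ← smul_eq_mul, ← map_smul, ← Pi.single_smul, smul_eq_mul, mul_one]
  -- The open orthant is unbounded in each positive direction and `f < u` on it, so no coordinate of
  -- the separating functional is positive. Normalizing `-a` gives the weights that contradict `h`.
  have ha0 : ∀ j, a j ≤ 0 := by
    intro j
    by_contra! hj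
    have h1 : ∀ s : ℝ, 0 ≤ s → f (fun _ => c') + s * a j < u := by
      intro s hs
      have := hf1 ((fun _ => c') + s • Pi.single j 1) fun i => by
        simp only [Pi.add_apply, Pi.smul_apply, smul_eq_mul]
        have : 0 ≤ s * (Pi.single j (1 : ℝ) : J → ℝ) i := mul_nonneg hs (by
          by_cases hij : i = j
          · subst hij; simp
          · simp [hij])
        linarith
      simpa [map_add, map_smul] using this
    have h2 := h1 (|u - f (fun _ => c')| / a j) (by positivity)
    rw [div_mul_cancel₀ _ hj.ne'] at h2
    linarith [le_abs_self (u - f fun _ => c')]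
  set S := ∑ j, -a j with hS
  have hS0 : 0 ≤ S := Finset.sum_nonneg fun j _ => by linarith [ha0 j]
  have hfc : f (fun _ => c') < u := hf1 _ fun _ => hcc
  have hfc' : f (fun _ => c') = -(c' * S) := by
    rw [hfa, hS, ← Finset.mul_sum, Finset.sum_neg_distrib]; ring
  obtain ⟨y₀, hy₀⟩ := hne
  rcases hS0.eq_or_lt with hS0 | hS0
  · have hz : ∀ j, a j = 0 := fun j => by
      have := (Finset.sum_eq_zero_iff_of_nonneg (fun j _ => by linarith [ha0 j])).1 hS0.symm j
        (Finset.mem_univ j)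
      linarith
    have h1 := hf2 y₀ hy₀
    rw [hfa] at h1 hfc
    simp only [hz, mul_zero, Finset.sum_const_zero] at h1 hfc
    linarith
  · obtain ⟨y, hyC, hy⟩ := h (fun j => -a j / S) (fun j => div_nonneg (by linarith [ha0 j]) hS0.le)
      (by rw [← Finset.sum_div, div_self hS0.ne'])
    have h1 := hf2 y hyC
    have h2 : ∑ j, -a j / S * y j = -f y / S := by
      rw [hfa, ← Finset.sum_neg_distrib, Finset.sum_div]
      exact Finset.sum_congr rfl fun j _ => by ring
    rw [h2, le_div_iff₀ hS0] at hy
    linarith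

/-- Minimax against finitely many mixtures: the payoff vectors of `distr I` form a convex set in a
finite-dimensional space, and each weighting of the mixtures in `s` is again in `distr Z`, where `h`
supplies a pure response. Only one side has to be finite. -/
theorem exists_distr_forall_lt [Nonempty I] (φ : Z → I → ℝ) {c c' : ℝ} (hcc : c < c')
    (h : ∀ p ∈ distr Z, ∃ i, expect p (fun z => φ z i) ≤ c) (s : Finset (Z →₀ ℝ))
    (hs : ∀ p ∈ s, p ∈ distr Z) :
    ∃ q ∈ distr I, ∀ p ∈ s, expect q (fun i => expect p fun z => φ z i) < c' := by
  let T : (I →₀ ℝ) →ₗ[ℝ] (s → ℝ) := LinearMap.pi fun p : s =>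
    Finsupp.linearCombination ℝ fun i => -expect (p : Z →₀ ℝ) fun z => φ z i
  have hT : ∀ q p, T q p = -expect q fun i => expect (p : Z →₀ ℝ) fun z => φ z i := fun q p =>
    expect_neg q _
  obtain ⟨_, ⟨q, hq, rfl⟩, hlt⟩ := exists_forall_lt_of_convex
    (convex_distr.linear_image T) ⟨_, _, single_mem_distr (Classical.arbitrary I), rfl⟩
    (neg_lt_neg hcc) fun w hw0 hw1 => by
      have hmem : ∑ p : s, w p • (p : Z →₀ ℝ) ∈ distr Z :=
        convex_distr.sum_mem (fun p _ => hw0 p) hw1 fun p _ => hs p p.2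
      obtain ⟨i, hi⟩ := h _ hmem
      refine ⟨_, ⟨_, single_mem_distr i, rfl⟩, ?_⟩
      simp only [hT, expect_single, mul_neg, Finset.sum_neg_distrib]
      have : expect (∑ p : s, w p • (p : Z →₀ ℝ)) (fun z => φ z i) =
          ∑ p : s, w p * expect (p : Z →₀ ℝ) fun z => φ z i := by
        simp [expect, map_sum]
      linarith
  refine ⟨q, hq, fun p hp => ?_⟩
  have := hlt ⟨p, hp⟩
  rw [hT] at this
  linarith

/-- Long half-graphs between finitely supported mixtures force linear growth of the potential. -/
theorem add_mul_le_pot_of_halfgraph [Nonempty I] [Nonempty Z] {e : Z → I → ℝ} {B : ℝ}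
    (he : ∀ z i, |e z i| ≤ B) (V : Z → ℝ) {a b : ℝ} {q : ℕ → I →₀ ℝ} {p : ℕ → Z →₀ ℝ}
    (hq : ∀ j, q j ∈ distr I) (hp : ∀ j, p j ∈ distr Z)
    (ha : ∀ i j, i < j → expect (q j) (fun f => expect (p i) fun z => e z f + V z) ≤ a)
    (hb : ∀ i j, i < j → b ≤ expect (q i) (fun f => expect (p j) fun z => e z f + V z)) (n : ℕ) :
    ∀ (s : ℕ) (g : I → ℝ) (C : ℝ), BddAbove (Set.range g) →
      (∀ i, s ≤ i → i < s + 3 ^ n → C ≤ expect (q i) g) → C + n * ((b - a) / 2) ≤ pot e n g := by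
  induction n with
  | zero =>
    intro s g C hg hC
    have h1 := hC s le_rfl (by simp)
    have h2 := expect_mono (hq s) fun i => le_ciSup hg i
    rw [expect_const (hq s)] at h2
    simpa [pot] using h1.trans h2
  | succ n ih =>
    intro s g C hg hC
    -- The mixture `p t` is played in the middle of the block. The indices before `t` see a payoff
    -- of at least `b`, those after it at most `a`; recentred at `m`, each of the two branches gains
    -- `(b - a) / 2` on its own sub-block of length `3 ^ n`.
    set t := s + 3 ^ n with ht
    have h3 : (3 : ℕ) ^ (n + 1) = 3 ^ n + 3 ^ n + 3 ^ n := by ring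
    have h30 : 0 < 3 ^ n := by positivity
    set m := (a + b) / 2 with hm
    set ψ : I → ℝ := fun f => expect (p t) fun z => e z f + V z with hψ
    have hψe : ∀ f, ψ f - m = expect (p t) (fun z => e z f) + (expect (p t) V - m) := fun f => by
      rw [hψ]; simp only [expect_add]; ring
    have hbd : ∀ f, |expect (p t) (fun z => e z f)| ≤ B := fun f =>
      abs_expect_le (hp t) fun z => he z f
    have hbd' : ∀ f, |ψ f - m| ≤ B + |expect (p t) V - m| := fun f => by
      rw [hψe]; exact (abs_add_le _ _).trans (add_le_add (hbd f) le_rfl)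
    have hplus : (C + (b - a) / 2) + n * ((b - a) / 2) ≤ pot e n (g + fun f => ψ f - m) := by
      refine ih s _ _ (bddAbove_range_add hg hbd') fun i hi1 hi2 => ?_
      have h1 := hC i hi1 (by omega)
      have h2 := hb i t hi2
      have : expect (q i) (g + fun f => ψ f - m) = expect (q i) g + (expect (q i) ψ - m) := by
        rw [← expect_const (hq i) m, ← expect_sub, expect_const (hq i), ← expect_add]; rfl
      rw [this]
      linarith
    have hminus : (C + (b - a) / 2) + n * ((b - a) / 2) ≤ pot e n (g - fun f => ψ f - m) := by
      refine ih (t + 1) _ _ (bddAbove_range_sub hg hbd') fun i hi1 hi2 => ?_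
      have h1 := hC i (by omega) (by omega)
      have h2 := ha t i (by omega)
      have : expect (q i) (g - fun f => ψ f - m) = expect (q i) g - (expect (q i) ψ - m) := by
        rw [← expect_const (hq i) m, ← expect_sub, expect_const (hq i), ← expect_sub]; rfl
      rw [this]
      linarith
    have hJ1 : pot e n (g + fun f => ψ f - m) ≤
        expect (p t) fun z => pot e n (g + e z) + (V z - m) := by
      refine le_trans (le_of_eq ?_) ((pot_expect_le he n (hp t)
        (G := fun z f => (g + e z) f + (V z - m)) fun z => ?_).trans (le_of_eq ?_))
      · congr 1
        ext f
        simp only [Pi.add_apply, hψ]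
        simp only [expect_add, expect_sub, expect_const (hp t)]
        ring
      · exact bddAbove_range_add (bddAbove_range_add hg (he z))
          (B := |V z - m|) (h := fun _ => V z - m) fun _ => le_rfl
      · congr 1
        ext z
        exact pot_add_const he n _ (bddAbove_range_add hg (he z))
    have hJ2 : pot e n (g - fun f => ψ f - m) ≤
        expect (p t) fun z => pot e n (g - e z) + (m - V z) := by
      refine le_trans (le_of_eq ?_) ((pot_expect_le he n (hp t)
        (G := fun z f => (g - e z) f + (m - V z)) fun z => ?_).trans (le_of_eq ?_))
      · congr 1
        ext f
        simp only [Pi.sub_apply, hψ]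
        simp only [expect_add, expect_sub, expect_const (hp t)]
        ring
      · exact bddAbove_range_add (bddAbove_range_sub hg (he z))
          (B := |m - V z|) (h := fun _ => m - V z) fun _ => le_rfl
      · congr 1
        ext z
        exact pot_add_const he n _ (bddAbove_range_sub hg (he z))
    have hstep := expect_mono (hp t) fun z => pot_step_le he n hg z
    rw [expect_const (hp t)] at hstep
    -- The term `V` and the centre `m` do not depend on the index and enter the two branches with
    -- opposite signs, so they cancel.
    have hsum : expect (p t) (fun z => pot e n (g + e z) + (V z - m)) +
        expect (p t) (fun z => pot e n (g - e z) + (m - V z)) =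
          2 * expect (p t) fun z => (pot e n (g + e z) + pot e n (g - e z)) / 2 := by
      rw [← expect_add]
      simp only [expect_eq_sum, Finset.mul_sum]
      exact Finset.sum_congr rfl fun z _ => by ring
    push_cast
    linarith

/-- The minimax theorem for finitely supported mixtures, for a payoff with sublinear potential. -/
theorem exists_distr_expect_le [Nonempty I] [Nonempty Z] {e : Z → I → ℝ} {B : ℝ}
    (he : ∀ z i, |e z i| ≤ B) (hgrow : ∀ δ : ℝ, 0 < δ → ∀ᶠ n : ℕ in atTop, pot e n 0 ≤ δ * n)
    (V : Z → ℝ) {c ε : ℝ} (hε : 0 < ε)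
    (h : ∀ p ∈ distr Z, ∃ i, expect p (fun z => e z i + V z) ≤ c) :
    ∃ q ∈ distr I, ∀ z, expect q (e z) + V z ≤ c + ε := by
  classical
  by_contra! hcon
  have hcon' : ∀ q ∈ distr I, ∃ z, expect q (fun i => -(e z i + V z)) ≤ -(c + ε) := by
    intro q hq
    obtain ⟨z, hz⟩ := hcon q hq
    refine ⟨z, ?_⟩
    rw [expect_neg, expect_add, expect_const hq]
    linarith
  -- Alternating best responses: each new `q` is good against all earlier `p`, each new `p` is bad
  -- for all earlier `q`. The gap is `ε / 2`, so the potential grows at rate at least `ε / 4`,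
  -- against the rate `ε / 8` taken from `hgrow`.
  obtain ⟨x, hx, hr⟩ := exists_seq_of_forall_finset_exists
    (fun x : (I →₀ ℝ) × (Z →₀ ℝ) => x.1 ∈ distr I ∧ x.2 ∈ distr Z)
    (fun x y => expect y.1 (fun f => expect x.2 fun z => e z f + V z) ≤ c + ε / 4 ∧
      c + 3 * ε / 4 ≤ expect x.1 (fun f => expect y.2 fun z => e z f + V z)) (by
    intro s hs
    obtain ⟨q, hq, hqs⟩ := exists_distr_forall_lt (fun z i => e z i + V z)
      (show c < c + ε / 4 by linarith) h (s.image Prod.snd) (by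
        intro p hp
        obtain ⟨y, hy, rfl⟩ := Finset.mem_image.1 hp
        exact (hs y hy).2)
    obtain ⟨p, hp, hps⟩ := exists_distr_forall_lt (fun i z => -(e z i + V z))
      (show -(c + ε) < -(c + 3 * ε / 4) by linarith) hcon' (s.image Prod.fst) (by
        intro p hp
        obtain ⟨y, hy, rfl⟩ := Finset.mem_image.1 hp
        exact (hs y hy).1)
    refine ⟨(q, p), ⟨hq, hp⟩, fun y hy => ⟨(hqs _ (Finset.mem_image_of_mem _ hy)).le, ?_⟩⟩
    have := hps _ (Finset.mem_image_of_mem Prod.fst hy)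
    simp only [expect_neg] at this
    rw [expect_comm (φ := fun z f => e z f + V z)]
    linarith)
  obtain ⟨n, hn, hn0⟩ := ((hgrow (ε / 8) (by linarith)).and (eventually_gt_atTop 0)).exists
  have h1 := add_mul_le_pot_of_halfgraph he V (fun j => (hx j).1) (fun j => (hx j).2)
    (fun i j hij => (hr i j hij).1) (fun i j hij => (hr i j hij).2) n 0 0 0
    (bddAbove_range_of_abs_le (B := 0) (by simp))
    (fun i _ _ => le_of_eq (expect_const (hx i).1 0).symm)
  have hn' : (0 : ℝ) < n := by exact_mod_cast hn0
  nlinarith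

end Minimax

theorem iSup_neg_eq {ι : Type*} (f : ι → ℝ) : ⨆ i, -f i = -⨅ i, f i := by
  rw [iInf, Real.sInf_def, neg_neg, iSup]
  congr 1
  ext x
  simp only [Set.mem_range, Set.mem_neg]
  exact exists_congr fun i => neg_eq_iff_eq_neg

/-! ### Randomized online strategies by backward induction -/

section Strategy

/-- The potential of the remaining rounds is an admissible relaxation. By minimax it suffices to
answer a known mixture `p` of the adversary, and there symmetrization applies. Each round loses `ε`,
half of it in the minimax theorem. -/
theorem exists_strategy {Z : Type u} {I : Type*} [Nonempty I] [Nonempty Z] {e : Z → I → ℝ} {B : ℝ}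
    (he : ∀ z i, |e z i| ≤ B) (hgrow : ∀ δ : ℝ, 0 < δ → ∀ᶠ n : ℕ in atTop, pot e n 0 ≤ δ * n)
    {ε : ℝ} (hε : 0 < ε) (n : ℕ) : ∀ g : I → ℝ, BddAbove (Set.range g) →
      ∃ q : (t : Fin n) → (Fin (t : ℕ) → Z) → I →₀ ℝ, (∀ t p, q t p ∈ distr I) ∧
        ∀ z : Fin n → Z, ∑ t, expect (q t (past t z)) (e (z t)) +
          ⨆ i, (g i - ∑ t, e (z t) i) ≤ pot ((2 : ℝ) • e) n g + n * ε := by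
  have he2 := abs_two_smul_le he
  induction n with
  | zero =>
    intro g _
    exact ⟨fun t => t.elim0, fun t => t.elim0, fun z => by simp [pot]⟩
  | succ n ih =>
    intro g hg
    obtain ⟨q₀, hq₀, hq₀z⟩ := exists_distr_expect_le he hgrow
      (fun z => pot ((2 : ℝ) • e) n (g - e z)) (c := pot ((2 : ℝ) • e) (n + 1) g + ε / 2)
      (half_pos hε) (by
        intro p hp
        by_contra! hcon
        set c := pot ((2 : ℝ) • e) (n + 1) g
        set V : Z → ℝ := fun z => pot ((2 : ℝ) • e) n (g - e z) with hV
        set v := c + ε / 2 - expect p V with hv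
        have hb : ∀ z, BddAbove (Set.range (g - e z)) := fun z => bddAbove_range_sub hg (he z)
        have hbd : ∀ i, |expect p (fun z => e z i)| ≤ B := fun i => abs_expect_le hp fun z => he z i
        -- If every response to `p` were bad, the constant `v` would lie below the mean payoff of
        -- every index. It is absorbed into `g - e z` as that mean, Jensen turns the mean into an
        -- independent copy `z'`, and convexity separates `z'` from `z`. Averaging over `z` leaves a
        -- symmetric step, at most `c`.
        have h1 : ∀ z, V z + v ≤ expect p fun z' => (pot ((2 : ℝ) • e) n (g + ((2 : ℝ) • e) z') +
            pot ((2 : ℝ) • e) n (g - ((2 : ℝ) • e) z)) / 2 := by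
          intro z
          calc V z + v = pot ((2 : ℝ) • e) n fun i => (g - e z) i + v :=
                (pot_add_const he2 n v (hb z)).symm
            _ ≤ pot ((2 : ℝ) • e) n fun i => expect p fun z' => (g + e z' - e z) i := by
                have : (fun i => expect p fun z' => (g + e z' - e z) i) =
                    (g - e z) + fun i => expect p fun z' => e z' i := by
                  ext i
                  simp only [Pi.add_apply, Pi.sub_apply, expect_add, expect_sub, expect_const hp]
                  ring
                rw [this]
                refine pot_mono he2 n (bddAbove_range_add (hb z) hbd) fun i => ?_
                have := hcon i
                rw [expect_add] at this
                simp only [Pi.add_apply, hv]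
                linarith
            _ ≤ expect p fun z' => pot ((2 : ℝ) • e) n (g + e z' - e z) :=
                pot_expect_le he2 n hp fun z' =>
                  bddAbove_range_sub (bddAbove_range_add hg (he z')) (he z)
            _ ≤ _ := expect_mono hp fun z' => pot_add_sub_le he n hg z' z
        have h2 := expect_mono hp h1
        have h3 : expect p (fun z => expect p fun z' =>
            (pot ((2 : ℝ) • e) n (g + ((2 : ℝ) • e) z') +
              pot ((2 : ℝ) • e) n (g - ((2 : ℝ) • e) z)) / 2) =
            expect p fun z => (pot ((2 : ℝ) • e) n (g + ((2 : ℝ) • e) z) +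
              pot ((2 : ℝ) • e) n (g - ((2 : ℝ) • e) z)) / 2 := by
          simp only [add_div, expect_add, expect_const hp]
        have h4 := expect_mono hp fun z => pot_step_le he2 n hg z
        rw [expect_const hp] at h4
        rw [expect_add, expect_const hp, h3] at h2
        linarith)
    choose q hq hqz using fun z => ih (g - e z) (bddAbove_range_sub hg (he z))
    refine ⟨Fin.cases (fun _ => q₀) fun t (p : Fin (t + 1) → Z) => q (p 0) t (Fin.tail p),
      Fin.cases (fun _ => hq₀) fun t p => hq _ _ _, fun z => ?_⟩
    have h1 := hq₀z (z 0)
    have h2 := hqz (z 0) (Fin.tail z)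
    have h3 : ∀ i, g i - ∑ t, e (z t) i = (g - e (z 0)) i - ∑ t, e (Fin.tail z t) i := fun i => by
      rw [Fin.sum_univ_succ]
      simp only [Pi.sub_apply, Fin.tail]
      ring
    simp only [h3]
    rw [Fin.sum_univ_succ]
    have h4 : ∀ t : Fin n, (Fin.cases (fun _ => q₀)
        (fun t (p : Fin (t + 1) → Z) => q (p 0) t (Fin.tail p)) : (t : Fin (n + 1)) →
          (Fin (t : ℕ) → Z) → I →₀ ℝ) t.succ (past t.succ z) =
          q (z 0) t (past t (Fin.tail z)) := fun t => rfl
    simp only [h4, Fin.cases_zero]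
    push_cast
    simp only [Fin.tail] at h2 ⊢
    linarith

theorem exists_measurable_sampler {I : Type*} {q : I →₀ ℝ} (hq : q ∈ distr I) :
    ∃ φ : unitInterval → I, ∀ h : I → ℝ, Measurable (fun ω => h (φ ω)) ∧
      ∫ ω, h (φ ω) = expect q h := by
  let _ : MeasurableSpace q.support := ⊤
  have _ : DiscreteMeasurableSpace q.support := ⟨fun _ => trivial⟩
  have hsum : ∑ i : q.support, q i = 1 := by
    have := hq.2
    rw [expect_eq_sum] at this
    rw [← this, ← Finset.sum_coe_sort q.support fun i => q i * 1]
    simp only [mul_one]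
  have _ : Nonempty q.support := by
    by_contra hne
    rw [not_nonempty_iff] at hne
    simp at hsum
  let μ : Measure q.support := ∑ i : q.support, ENNReal.ofReal (q i) • Measure.dirac i
  have _ : IsProbabilityMeasure μ := ⟨by
    simp only [μ, Measure.finsetSum_apply, Measure.smul_apply, measure_univ, smul_eq_mul, mul_one]
    rw [← ENNReal.ofReal_sum_of_nonneg fun (i : q.support) _ => hq.1 i, hsum, ENNReal.ofReal_one]⟩
  obtain ⟨φ, hφ, hφμ⟩ := μ.exists_measurable_map_eq
  refine ⟨fun ω => φ ω, fun h => ⟨(measurable_of_countable fun i : q.support => h i).comp hφ, ?_⟩⟩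
  have h1 : ∫ ω, h (φ ω) = ∫ i : q.support, h i ∂μ := by
    rw [← hφμ, integral_map hφ.aemeasurable (measurable_of_countable _).aestronglyMeasurable]
  rw [h1, integral_finsetSum_measure fun i _ => ?_]
  · simp only [integral_smul_measure, integral_dirac, ENNReal.toReal_ofReal (hq.1 _), smul_eq_mul]
    rw [expect_eq_sum, ← Finset.sum_coe_sort q.support fun i => q i * h i]
  · exact Integrable.of_finite.smul_measure ENNReal.ofReal_ne_top

end Strategy

section OnlineUpper

variable {X : Type u}

theorem onlineValue_le [Nonempty X] {F : Set (X → Label)} (hF : F.Nonempty)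
    (h : ∀ γ : ℝ, 0 < γ → sfat F γ < ⊤) {δ : ℝ} (hδ : 0 < δ) :
    ∀ᶠ n : ℕ in atTop, onlineValue F n ≤ (δ : EReal) := by
  have : Nonempty F := hF.to_subtype
  let e : Sample X → F → ℝ := fun z f => loss z (f : X → Label)
  have he : ∀ z f, |e z f| ≤ 2 := fun z f => abs_loss_le z _
  have hL : ∀ z (f f' : F), |e z f - e z f'| ≤
      1 * |((f : X → Label) z.1 : ℝ) - (f' : X → Label) z.1| := fun z f f' => by
    simpa using abs_loss_sub_loss_le z _ _
  have hgrow : ∀ δ : ℝ, 0 < δ → ∀ᶠ n : ℕ in atTop, pot e n 0 ≤ δ * n := fun δ hδ =>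
    eventually_pot_le hF h zero_le_one he hL hδ
  have hgrow2 : ∀ᶠ n : ℕ in atTop, pot ((2 : ℝ) • e) n 0 ≤ (δ / 2) * n :=
    eventually_pot_le hF h (L := 2) (π := Prod.fst) zero_le_two (abs_two_smul_le he)
      (fun z f f' => by
        have := hL z f f'
        simp only [Pi.smul_apply, smul_eq_mul, ← mul_sub, abs_mul, abs_two]
        linarith) (half_pos hδ)
  filter_upwards [hgrow2, eventually_gt_atTop 0] with n hn hn0
  have hn' : (0 : ℝ) < n := by exact_mod_cast hn0
  obtain ⟨q, hq, hqz⟩ := exists_strategy he hgrow (half_pos hδ) n 0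
    (bddAbove_range_of_abs_le (B := 0) (by simp))
  choose φ hφ using fun t p => exists_measurable_sampler (hq t p)
  let R : OnlineRule F n :=
    { Ω := ULift.{u} unitInterval
      prob := (volume : Measure unitInterval).map ULift.up
      isProb := Measure.isProbabilityMeasure_map measurable_up.aemeasurable
      rule := fun t p ω => φ t p ω.down
      measurable_rule := fun t p x => by
        have h1 := (hφ t p fun f => ((f : X → Label) x : ℝ)).1
        exact Measurable.subtype_mk (h1.comp measurable_down) }
  refine iInf_le_of_le R (iSup_le fun z => ?_)
  rw [EReal.coe_le_coe_iff]
  have hR : R.regret z = (1 / (n : ℝ)) * (∑ t, expect (q t (past t z)) (e (z t)) -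
      ⨅ f : F, ∑ t, loss (z t) (f : X → Label)) := by
    have hm : ∀ t, Measurable fun ω : unitInterval => e (z t) (φ t (past t z) ω) := fun t =>
      (hφ t _ _).1
    have hint : ∀ t, Integrable fun ω : unitInterval => e (z t) (φ t (past t z) ω) := fun t =>
      Integrable.of_bound (hm t).aestronglyMeasurable 2 (ae_of_all _ fun ω => he _ _)
    have hmm : Measurable fun ω : ULift.{u} unitInterval => (1 / (n : ℝ)) *
        (∑ t, e (z t) (φ t (past t z) ω.down) - ⨅ f : F, ∑ t, loss (z t) (f : X → Label)) :=
      ((Finset.measurable_sum _ fun t _ => (hm t).comp measurable_down).sub_const _).const_mul _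
    change ∫ ω, _ ∂(volume : Measure unitInterval).map ULift.up = _
    rw [integral_map measurable_up.aemeasurable hmm.aestronglyMeasurable, integral_const_mul,
      integral_sub (integrable_finsetSum _ fun t _ => hint t) (integrable_const _),
      integral_finsetSum _ fun t _ => hint t]
    simp only [(hφ _ _ _).2, integral_const, probReal_univ, one_smul]
  rw [hR]
  have h1 := hqz z
  have h2 : (⨆ f : F, ((0 : F → ℝ) f - ∑ t, e (z t) f)) =
      -⨅ f : F, ∑ t, loss (z t) (f : X → Label) := by
    rw [← iSup_neg_eq]
    simp [e]
  rw [h2] at h1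
  rw [one_div, inv_mul_le_iff₀ hn']
  linarith

end OnlineUpper

/-! ### Decoupling along a chain of kernels -/

section PotLower

variable {A I : Type*} [Nonempty A] [Nonempty I] {e : A → I → ℝ} {B : ℝ}

/-- By convexity, one more round with any atom cannot lower the potential. -/
theorem pot_le_pot_succ (he : ∀ a i, |e a i| ≤ B) (k : ℕ) {g : I → ℝ}
    (hg : BddAbove (Set.range g)) : pot e k g ≤ pot e (k + 1) g := by
  obtain ⟨a⟩ := ‹Nonempty A›
  have : Nonempty A := ⟨a⟩
  have h := (convexOn_pot he k).2 (bddAbove_range_add hg (he a)) (bddAbove_range_sub hg (he a))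
    (show (0 : ℝ) ≤ 1 / 2 by norm_num) (show (0 : ℝ) ≤ 1 / 2 by norm_num) (by norm_num)
  have e1 : (1 / 2 : ℝ) • (g + e a) + (1 / 2 : ℝ) • (g - e a) = g := by
    ext i; simp; ring
  rw [e1] at h
  refine (h.trans (le_of_eq ?_)).trans (pot_step_le he k hg a)
  simp only [smul_eq_mul]
  ring

theorem le_pot (he : ∀ a i, |e a i| ≤ B) (k : ℕ) {g : I → ℝ} (hg : BddAbove (Set.range g))
    {c : ℝ} (hc : ∀ i, c ≤ g i) : c ≤ pot e k g := by
  induction k with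
  | zero =>
    obtain ⟨i⟩ := ‹Nonempty I›
    exact (hc i).trans (le_ciSup hg i)
  | succ k ih => exact ih.trans (pot_le_pot_succ he k hg)

end PotLower

theorem ofReal_integral_le_lintegral {α : Type*} [MeasurableSpace α] {μ : Measure α} {f : α → ℝ}
    (hf : Integrable f μ) : ENNReal.ofReal (∫ x, f x ∂μ) ≤ ∫⁻ x, ENNReal.ofReal (f x) ∂μ := by
  calc ENNReal.ofReal (∫ x, f x ∂μ) ≤ ENNReal.ofReal (∫ x, max (f x) 0 ∂μ) :=
        ENNReal.ofReal_le_ofReal (integral_mono hf hf.pos_part fun x => le_max_left _ _)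
    _ = ∫⁻ x, ENNReal.ofReal (max (f x) 0) ∂μ :=
        ofReal_integral_eq_lintegral_ofReal hf.pos_part (ae_of_all _ fun x => le_max_right _ _)
    _ = _ := by simp [ENNReal.ofReal_max]

theorem measurable_fin_cons {α C : Type*} [MeasurableSpace α] [MeasurableSpace C] {n : ℕ}
    {f : α → C} {g : α → Fin n → C} (hf : Measurable f) (hg : Measurable g) :
    Measurable fun x => (Fin.cons (f x) (g x) : Fin (n + 1) → C) := by
  refine measurable_pi_iff.2 (Fin.cases ?_ fun i => ?_)
  · simpa using hf
  · simp only [Fin.cons_succ]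
    exact (measurable_pi_apply i).comp hg

section Chain

variable {A : Type*} [MeasurableSpace A] {S : ℕ → Type*} [∀ t, MeasurableSpace (S t)]
  (κ : ∀ t, Kernel (S t) (S (t + 1))) (obs : ∀ t, S (t + 1) → A)

/-- The law of `n` pairs of a chain started at time `t` and its tangent sequence. -/
noncomputable def tangent : (n t : ℕ) → Kernel (S t) (Fin n → A × A)
  | 0, t => Kernel.const (S t) (Measure.dirac default)
  | n + 1, t => ((κ t ×ₖ κ t) ⊗ₖ (Kernel.prodMkLeft (S t)
      ((tangent n (t + 1)).comap Prod.fst measurable_fst))).map fun p =>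
        Fin.cons (obs t p.1.1, obs t p.1.2) p.2

/-- The conditional law of a realized chain together with its tangent sequence. -/
noncomputable def decoupled {Ω : Type*} [MeasurableSpace Ω] {π : ∀ t, Ω → S t}
    (hπ : ∀ t, Measurable (π t)) : (n t : ℕ) → Kernel Ω (Fin n → A × A)
  | 0, _ => Kernel.const Ω (Measure.dirac default)
  | n + 1, t => (Kernel.id ×ₖ ((κ t).comap (π t) (hπ t) ×ₖ decoupled hπ n (t + 1))).map fun p =>
        Fin.cons (obs t (π (t + 1) p.1), obs t p.2.1) p.2.2

variable {κ obs} [∀ t, IsMarkovKernel (κ t)]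

theorem measurable_tangent_cons (hobs : ∀ t, Measurable (obs t)) (n t : ℕ) :
    Measurable fun p : (S (t + 1) × S (t + 1)) × (Fin n → A × A) =>
      (Fin.cons (obs t p.1.1, obs t p.1.2) p.2 : Fin (n + 1) → A × A) :=
  measurable_fin_cons (((hobs t).comp (measurable_fst.comp measurable_fst)).prodMk
    ((hobs t).comp (measurable_snd.comp measurable_fst))) measurable_snd

theorem isMarkovKernel_tangent (hobs : ∀ t, Measurable (obs t)) (n : ℕ) :
    ∀ t, IsMarkovKernel (tangent κ obs n t) := by
  induction n with
  | zero => intro t; rw [tangent]; infer_instance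
  | succ n ih =>
    intro t
    have := ih (t + 1)
    rw [tangent]
    exact Kernel.IsMarkovKernel.map _ (measurable_tangent_cons hobs n t)

theorem lintegral_tangent_succ (hobs : ∀ t, Measurable (obs t)) (n t : ℕ) (s : S t)
    {W : (Fin (n + 1) → A × A) → ℝ≥0∞} (hW : Measurable W) :
    ∫⁻ v, W v ∂tangent κ obs (n + 1) t s =
      ∫⁻ x, ∫⁻ x', ∫⁻ v, W (Fin.cons (obs t x, obs t x') v) ∂tangent κ obs n (t + 1) x
        ∂κ t s ∂κ t s := by
  have := isMarkovKernel_tangent (κ := κ) hobs n (t + 1)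
  have hm : Measurable fun p : (S (t + 1) × S (t + 1)) × (Fin n → A × A) =>
      W (Fin.cons (obs t p.1.1, obs t p.1.2) p.2) := hW.comp (measurable_tangent_cons hobs n t)
  rw [tangent, Kernel.lintegral_map _ (measurable_tangent_cons hobs n t) _ hW,
    Kernel.lintegral_compProd _ _ _ hm]
  simp only [Kernel.prodMkLeft_apply, Kernel.comap_apply]
  rw [Kernel.lintegral_prod]
  exact hm.lintegral_kernel_prod_right'
    (κ := (tangent κ obs n (t + 1)).comap Prod.fst measurable_fst)

section Decoupled

variable {Ω : Type*} [MeasurableSpace Ω] {π : ∀ t, Ω → S t} (hπ : ∀ t, Measurable (π t))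

theorem measurable_decoupled_cons (hπ : ∀ t, Measurable (π t)) (hobs : ∀ t, Measurable (obs t))
    (n t : ℕ) : Measurable fun p : Ω × S (t + 1) × (Fin n → A × A) =>
      (Fin.cons (obs t (π (t + 1) p.1), obs t p.2.1) p.2.2 : Fin (n + 1) → A × A) :=
  measurable_fin_cons (((hobs t).comp ((hπ _).comp measurable_fst)).prodMk
    ((hobs t).comp (measurable_fst.comp measurable_snd))) (measurable_snd.comp measurable_snd)

theorem isMarkovKernel_decoupled (hobs : ∀ t, Measurable (obs t)) (n : ℕ) :
    ∀ t, IsMarkovKernel (decoupled κ obs hπ n t) := by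
  induction n with
  | zero => intro t; rw [decoupled]; infer_instance
  | succ n ih =>
    intro t
    have := ih (t + 1)
    rw [decoupled]
    exact Kernel.IsMarkovKernel.map _ (measurable_decoupled_cons hπ hobs n t)

theorem lintegral_decoupled_succ (hobs : ∀ t, Measurable (obs t)) (n t : ℕ) (ω : Ω)
    {W : (Fin (n + 1) → A × A) → ℝ≥0∞} (hW : Measurable W) :
    ∫⁻ v, W v ∂decoupled κ obs hπ (n + 1) t ω =
      ∫⁻ x', ∫⁻ v, W (Fin.cons (obs t (π (t + 1) ω), obs t x') v) ∂decoupled κ obs hπ n (t + 1) ω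
        ∂κ t (π t ω) := by
  have := isMarkovKernel_decoupled (κ := κ) hπ hobs n (t + 1)
  have hm : Measurable fun p : Ω × S (t + 1) × (Fin n → A × A) =>
      W (Fin.cons (obs t (π (t + 1) p.1), obs t p.2.1) p.2.2) :=
    hW.comp (measurable_decoupled_cons hπ hobs n t)
  have hm' : Measurable fun p : S (t + 1) × (Fin n → A × A) =>
      W (Fin.cons (obs t (π (t + 1) ω), obs t p.1) p.2) :=
    hW.comp (measurable_fin_cons (measurable_const.prodMk ((hobs t).comp measurable_fst))
      measurable_snd)
  rw [decoupled, Kernel.lintegral_map _ (measurable_decoupled_cons hπ hobs n t) _ hW,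
    Kernel.lintegral_id_prod hm, Kernel.lintegral_prod _ _ _ hm']
  rfl

/-- The realized chain with its tangent sequence has the law of the chain with its tangent
sequence. -/
theorem lintegral_decoupled_eq_tangent (hobs : ∀ t, Measurable (obs t)) {P : Measure Ω}
    [IsProbabilityMeasure P] {r : ∀ t, S (t + 1) → S t} (hr : ∀ t, Measurable (r t)) (n : ℕ) :
    ∀ t, (∀ j, t ≤ j → j < t + n → (∀ ω, r j (π (j + 1) ω) = π j ω) ∧
      P.map (fun ω => (π j ω, π (j + 1) ω)) = (P.map (π j)) ⊗ₘ κ j) →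
      ∀ W : S t × (Fin n → A × A) → ℝ≥0∞, Measurable W →
      ∫⁻ ω, ∫⁻ v, W (π t ω, v) ∂decoupled κ obs hπ n t ω ∂P =
        ∫⁻ ω, ∫⁻ v, W (π t ω, v) ∂tangent κ obs n t (π t ω) ∂P := by
  induction n with
  | zero => intro t _ W hW; rfl
  | succ n ih =>
    intro t ht W hW
    obtain ⟨hrt, hPt⟩ := ht t le_rfl (by omega)
    have hJ := isMarkovKernel_decoupled (κ := κ) hπ hobs n (t + 1)
    have hT := isMarkovKernel_tangent (κ := κ) hobs n (t + 1)
    -- `W'` integrates out the first tangent variable. The map `r t` recovers the state at time `t`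
    -- from the next one, so that `W'` is a function of the state at time `t + 1` and the induction
    -- applies.
    let W' : S (t + 1) × (Fin n → A × A) → ℝ≥0∞ := fun p =>
      ∫⁻ x', W (r t p.1, Fin.cons (obs t p.1, obs t x') p.2) ∂κ t (r t p.1)
    let H : S t × S (t + 1) → ℝ≥0∞ := fun p =>
      ∫⁻ v, ∫⁻ x', W (p.1, Fin.cons (obs t p.2, obs t x') v) ∂κ t p.1 ∂tangent κ obs n (t + 1) p.2
    have hm0 : Measurable fun p : ((S t × S (t + 1)) × (Fin n → A × A)) × S (t + 1) =>
        W (p.1.1.1, Fin.cons (obs t p.1.1.2, obs t p.2) p.1.2) := by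
      refine hW.comp (Measurable.prodMk (by fun_prop) (measurable_fin_cons ?_ (by fun_prop)))
      exact ((hobs t).comp (by fun_prop)).prodMk ((hobs t).comp (by fun_prop))
    have hm1 : Measurable fun p : (S t × S (t + 1)) × (Fin n → A × A) =>
        ∫⁻ x', W (p.1.1, Fin.cons (obs t p.1.2, obs t x') p.2) ∂κ t p.1.1 :=
      hm0.lintegral_kernel_prod_right' (κ := (κ t).comap
        (fun p : (S t × S (t + 1)) × (Fin n → A × A) => p.1.1) (by fun_prop))
    have hH : Measurable H := hm1.lintegral_kernel_prod_right'
      (κ := (tangent κ obs n (t + 1)).comap (fun p : S t × S (t + 1) => p.2) measurable_snd)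
    have hW' : Measurable W' := hm1.comp
      (f := fun p : S (t + 1) × (Fin n → A × A) => ((r t p.1, p.1), p.2))
      ((((hr t).comp measurable_fst).prodMk measurable_fst).prodMk measurable_snd)
    have hswap : ∀ (μ : Measure (Fin n → A × A)) [IsProbabilityMeasure μ] (s : S t) (x : S (t + 1)),
        ∫⁻ x', ∫⁻ v, W (s, Fin.cons (obs t x, obs t x') v) ∂μ ∂κ t s =
          ∫⁻ v, ∫⁻ x', W (s, Fin.cons (obs t x, obs t x') v) ∂κ t s ∂μ := fun μ _ s x =>
      lintegral_lintegral_swap (hm0.comp (f := fun p : S (t + 1) × (Fin n → A × A) =>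
        (((s, x), p.2), p.1)) (by fun_prop)).aemeasurable
    calc ∫⁻ ω, ∫⁻ v, W (π t ω, v) ∂decoupled κ obs hπ (n + 1) t ω ∂P
        = ∫⁻ ω, ∫⁻ v, W' (π (t + 1) ω, v) ∂decoupled κ obs hπ n (t + 1) ω ∂P := by
          refine lintegral_congr fun ω => ?_
          rw [lintegral_decoupled_succ hπ hobs n t ω (W := fun v => W (π t ω, v))
            (hW.comp measurable_prodMk_left), hswap]
          simp only [W', hrt]
      _ = ∫⁻ ω, ∫⁻ v, W' (π (t + 1) ω, v) ∂tangent κ obs n (t + 1) (π (t + 1) ω) ∂P :=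
          ih (t + 1) (fun j h1 h2 => ht j (by omega) (by omega)) W' hW'
      _ = ∫⁻ ω, H (π t ω, π (t + 1) ω) ∂P := by simp only [W', H, hrt]
      _ = ∫⁻ p, H p ∂P.map (fun ω => (π t ω, π (t + 1) ω)) :=
          (lintegral_map hH ((hπ t).prodMk (hπ (t + 1)))).symm
      _ = ∫⁻ ω, ∫⁻ x, H (π t ω, x) ∂κ t (π t ω) ∂P := by
          have := Measure.isProbabilityMeasure_map (μ := P) (hπ t).aemeasurable
          rw [hPt, Measure.lintegral_compProd hH, lintegral_map _ (hπ t)]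
          exact hH.lintegral_kernel_prod_right'
      _ = _ := by
          refine lintegral_congr fun ω => ?_
          rw [lintegral_tangent_succ hobs n t _ (W := fun v => W (π t ω, v))
            (hW.comp measurable_prodMk_left)]
          exact lintegral_congr fun x => (hswap _ _ _).symm

end Decoupled

section Bounds

variable {I : Type*} [Nonempty I] [Nonempty A] {e : A → I → ℝ} {B : ℝ}

/-- The two entries of a pair are exchangeable, and the inductive bound does not depend on the state
from which the chain continues; so the integrand may be averaged over the swap. The lower bound on
`g` keeps the potentials nonnegative, so that `ENNReal.ofReal` is additive on them. -/
theorem lintegral_tangent_le (hobs : ∀ t, Measurable (obs t)) (he : ∀ a i, |e a i| ≤ B) (n : ℕ) :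
    ∀ (t : ℕ) (s : S t) (g : I → ℝ) (L : (Fin n → A × A) → ℝ≥0∞), Measurable L →
      BddAbove (Set.range g) → (∀ i, 2 * n * B ≤ g i) →
      (∀ v, L v ≤ ENNReal.ofReal (⨆ i, (g i + ∑ j, (e (v j).1 i - e (v j).2 i)))) →
      ∫⁻ v, L v ∂tangent κ obs n t s ≤ ENNReal.ofReal (pot ((2 : ℝ) • e) n g) := by
  have he2 := abs_two_smul_le he
  have hB0 : 0 ≤ B := (abs_nonneg _).trans (he (Classical.arbitrary A) (Classical.arbitrary I))
  induction n with
  | zero =>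
    intro t s g L hL _ _ h
    rw [tangent, Kernel.const_apply, lintegral_dirac' _ hL]
    simpa [pot] using h default
  | succ n ih =>
    intro t s g L hL hg hgpos h
    have hT := isMarkovKernel_tangent (κ := κ) hobs n (t + 1)
    let H : S (t + 1) × S (t + 1) → ℝ≥0∞ := fun p =>
      ∫⁻ v, L (Fin.cons (obs t p.1, obs t p.2) v) ∂tangent κ obs n (t + 1) p.1
    have hH : Measurable H := (hL.comp (measurable_tangent_cons hobs n t)).lintegral_kernel_prod_right'
      (κ := (tangent κ obs n (t + 1)).comap Prod.fst measurable_fst)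
    have hbd : ∀ x x' : A, BddAbove (Set.range (g + e x - e x')) := fun x x' =>
      bddAbove_range_sub (bddAbove_range_add hg (he x)) (he x')
    have hpos : ∀ (x x' : A) i, 2 * n * B ≤ (g + e x - e x') i := fun x x' i => by
      have h1 := hgpos i
      have h2 := abs_le.1 (he x i)
      have h3 := abs_le.1 (he x' i)
      push_cast at h1
      simp only [Pi.add_apply, Pi.sub_apply]
      linarith
    have hHle : ∀ x x', H (x, x') ≤
        ENNReal.ofReal (pot ((2 : ℝ) • e) n (g + e (obs t x) - e (obs t x'))) := by
      intro x x'
      refine ih (t + 1) x _ _ (hL.comp (measurable_fin_cons measurable_const measurable_id))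
        (hbd _ _) (hpos _ _) fun v => (h _).trans (le_of_eq ?_)
      congr 1
      refine iSup_congr fun i => ?_
      rw [Fin.sum_univ_succ]
      simp only [Fin.cons_zero, Fin.cons_succ, Pi.add_apply, Pi.sub_apply]
      ring
    -- Convexity splits each order into a plus term at one atom and a minus term at the other; the
    -- sum over both orders regroups into one full round at each atom.
    have hsum : ∀ x x', H (x, x') + H (x', x) ≤
        2 * ENNReal.ofReal (pot ((2 : ℝ) • e) (n + 1) g) := by
      intro x x'
      have hn0 : 0 ≤ 2 * n * B := by positivity
      have h1 := pot_add_sub_le he n hg (obs t x) (obs t x')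
      have h2 := pot_add_sub_le he n hg (obs t x') (obs t x)
      have h3 := pot_step_le he2 n hg (obs t x)
      have h4 := pot_step_le he2 n hg (obs t x')
      refine (add_le_add (hHle x x') (hHle x' x)).trans ?_
      rw [← ENNReal.ofReal_add (hn0.trans (le_pot he2 n (hbd _ _) (hpos _ _)))
        (hn0.trans (le_pot he2 n (hbd _ _) (hpos _ _))), ← ENNReal.ofReal_ofNat 2,
        ← ENNReal.ofReal_mul zero_le_two]
      refine ENNReal.ofReal_le_ofReal ?_
      linarith
    rw [lintegral_tangent_succ hobs n t s hL]
    change ∫⁻ x, ∫⁻ x', H (x, x') ∂κ t s ∂κ t s ≤ _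
    have hsw : ∫⁻ x, ∫⁻ x', H (x, x') ∂κ t s ∂κ t s = ∫⁻ x, ∫⁻ x', H (x', x) ∂κ t s ∂κ t s :=
      lintegral_lintegral_swap hH.aemeasurable
    have h2 : 2 * ∫⁻ x, ∫⁻ x', H (x, x') ∂κ t s ∂κ t s ≤
        2 * ENNReal.ofReal (pot ((2 : ℝ) • e) (n + 1) g) := by
      calc _ = ∫⁻ x, ∫⁻ x', H (x, x') ∂κ t s ∂κ t s + ∫⁻ x, ∫⁻ x', H (x', x) ∂κ t s ∂κ t s := by
            rw [two_mul, ← hsw]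
        _ = ∫⁻ x, ∫⁻ x', (H (x, x') + H (x', x)) ∂κ t s ∂κ t s := by
            rw [← lintegral_add_left hH.lintegral_prod_right']
            refine lintegral_congr fun x => ?_
            exact (lintegral_add_left (f := fun x' => H (x, x')) (hH.comp measurable_prodMk_left) _).symm
        _ ≤ ∫⁻ _, ∫⁻ _, 2 * ENNReal.ofReal (pot ((2 : ℝ) • e) (n + 1) g) ∂κ t s ∂κ t s :=
            lintegral_mono fun x => lintegral_mono fun x' => hsum x x'
        _ = _ := by simp
    exact (ENNReal.mul_le_mul_iff_right (by norm_num) (by norm_num)).1 h2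

end Bounds

/-- With `ω` fixed, each conditional mean is an integral over a tangent variable, and the positive
part moves inside by Jensen, one coordinate at a time; `c` collects the coordinates already treated.
-/
theorem ofReal_le_lintegral_decoupled {B : ℝ} {Ω : Type*} [MeasurableSpace Ω] {π : ∀ t, Ω → S t}
    (hπ : ∀ t, Measurable (π t)) (hobs : ∀ t, Measurable (obs t)) {h : A → ℝ} (hh : Measurable h)
    (hB : ∀ a, |h a| ≤ B) (ω : Ω) (n : ℕ) : ∀ (t : ℕ) (c : ℝ),
      ENNReal.ofReal (c + ∑ j ∈ Finset.range n, (h (obs (t + j) (π (t + j + 1) ω)) -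
        ∫ x, h (obs (t + j) x) ∂κ (t + j) (π (t + j) ω))) ≤
      ∫⁻ v, ENNReal.ofReal (c + ∑ j, (h (v j).1 - h (v j).2)) ∂decoupled κ obs hπ n t ω := by
  induction n with
  | zero =>
    intro t c
    rw [decoupled, Kernel.const_apply, lintegral_dirac' _ (by simp)]
    simp
  | succ n ih =>
    intro t c
    have hm : Measurable fun v : Fin (n + 1) → A × A =>
        ENNReal.ofReal (c + ∑ j, (h (v j).1 - h (v j).2)) := by fun_prop
    rw [lintegral_decoupled_succ hπ hobs n t ω hm]
    have hmo := hh.comp (hobs t)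
    have hint : Integrable (fun x => h (obs t x)) (κ t (π t ω)) :=
      Integrable.of_bound hmo.aestronglyMeasurable B (ae_of_all _ fun x => hB _)
    set d := ∑ j ∈ Finset.range n, (h (obs (t + (j + 1)) (π (t + (j + 1) + 1) ω)) -
        ∫ x, h (obs (t + (j + 1)) x) ∂κ (t + (j + 1)) (π (t + (j + 1)) ω)) with hd
    have hint' : Integrable (fun x => c + h (obs t (π (t + 1) ω)) - h (obs t x)) (κ t (π t ω)) :=
      (integrable_const _).sub hint
    calc _ = ENNReal.ofReal (∫ x, (c + h (obs t (π (t + 1) ω)) - h (obs t x) + d)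
          ∂κ t (π t ω)) := by
          rw [Finset.sum_range_succ', ← hd, integral_add hint' (integrable_const _),
            integral_sub (integrable_const _) hint]
          simp only [integral_const, probReal_univ, one_smul]
          congr 1
          change c + (d + (h (obs t (π (t + 1) ω)) - ∫ x, h (obs t x) ∂κ t (π t ω))) = _
          ring
      _ ≤ ∫⁻ x, ENNReal.ofReal (c + h (obs t (π (t + 1) ω)) - h (obs t x) + d) ∂κ t (π t ω) :=
          ofReal_integral_le_lintegral (hint'.add (integrable_const _))
      _ ≤ _ := by
          refine lintegral_mono fun x => ?_
          have := ih (t + 1) (c + h (obs t (π (t + 1) ω)) - h (obs t x))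
          have hd' : d = ∑ j ∈ Finset.range n, (h (obs (t + 1 + j) (π (t + 1 + j + 1) ω)) -
              ∫ x, h (obs (t + 1 + j) x) ∂κ (t + 1 + j) (π (t + 1 + j) ω)) := by
            rw [hd]
            refine Finset.sum_congr rfl fun j _ => ?_
            have : ∀ m, m = t + 1 + j → h (obs m (π (m + 1) ω)) - ∫ x, h (obs m x) ∂κ m (π m ω) =
                h (obs (t + 1 + j) (π (t + 1 + j + 1) ω)) -
                  ∫ x, h (obs (t + 1 + j) x) ∂κ (t + 1 + j) (π (t + 1 + j) ω) := by
              rintro _ rfl; rfl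
            exact this _ (by omega)
          rw [hd']
          refine this.trans (le_of_eq (lintegral_congr fun v => ?_))
          rw [Fin.sum_univ_succ]
          simp only [Fin.cons_zero, Fin.cons_succ]
          congr 1
          ring

end Chain

/-- The deviations of a chain from its conditional means have a measurable majorant whose
expectation is bounded by the potential. -/
theorem exists_measurable_majorant {A : Type*} [MeasurableSpace A] [Nonempty A] {I : Type*}
    [Nonempty I] {S : ℕ → Type*} [∀ t, MeasurableSpace (S t)] {κ : ∀ t, Kernel (S t) (S (t + 1))}
    [∀ t, IsMarkovKernel (κ t)] {obs : ∀ t, S (t + 1) → A} (hobs : ∀ t, Measurable (obs t))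
    {Ω : Type*} [MeasurableSpace Ω] {P : Measure Ω} [IsProbabilityMeasure P]
    {π : ∀ t, Ω → S t} (hπ : ∀ t, Measurable (π t)) {r : ∀ t, S (t + 1) → S t}
    (hr : ∀ t, Measurable (r t)) {n : ℕ} (hrπ : ∀ j < n, ∀ ω, r j (π (j + 1) ω) = π j ω)
    (hP : ∀ j < n, P.map (fun ω => (π j ω, π (j + 1) ω)) = (P.map (π j)) ⊗ₘ κ j)
    {e : A → I → ℝ} {B : ℝ} (he : ∀ a i, |e a i| ≤ B) (hem : ∀ i, Measurable fun a => e a i)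
    (hnn : ∀ v : Fin n → A × A, 0 ≤ ⨆ i, ∑ j, (e (v j).1 i - e (v j).2 i))
    (hae : ∀ μ : Measure (Fin n → A × A), IsProbabilityMeasure μ →
      AEMeasurable (fun v => ⨆ i, ∑ j, (e (v j).1 i - e (v j).2 i)) μ) :
    ∃ h : Ω → ℝ≥0∞, Measurable h ∧
      (∀ ω i, ENNReal.ofReal (∑ j ∈ Finset.range n, (e (obs j (π (j + 1) ω)) i -
        ∫ x, e (obs j x) i ∂κ j (π j ω))) ≤ h ω) ∧
      ∫⁻ ω, h ω ∂P ≤ ENNReal.ofReal (pot ((2 : ℝ) • e) n 0) := by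
  have he2 := abs_two_smul_le he
  have hB0 : 0 ≤ B := (abs_nonneg _).trans (he (Classical.arbitrary A) (Classical.arbitrary I))
  have hJ := isMarkovKernel_decoupled (κ := κ) hπ hobs n 0
  have hT := isMarkovKernel_tangent (κ := κ) hobs n 0
  set c : ℝ := 2 * n * B with hc
  have hc0 : 0 ≤ c := by positivity
  set G : (Fin n → A × A) → ℝ := fun v => ⨆ i, ∑ j, (e (v j).1 i - e (v j).2 i) with hG
  have habs : ∀ (v : Fin n → A × A) i, |∑ j, (e (v j).1 i - e (v j).2 i)| ≤ c := by
    intro v i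
    refine (Finset.abs_sum_le_sum_abs _ _).trans ?_
    calc _ ≤ ∑ _j : Fin n, 2 * B := Finset.sum_le_sum fun j _ => by
          refine (abs_sub _ _).trans ?_
          linarith [he (v j).1 i, he (v j).2 i]
      _ = c := by rw [Finset.sum_const, Finset.card_univ, Fintype.card_fin, nsmul_eq_mul, hc]; ring
  have hbdd : ∀ v : Fin n → A × A,
      BddAbove (Set.range fun i => ∑ j, (e (v j).1 i - e (v j).2 i)) := fun v =>
    bddAbove_range_of_abs_le (habs v)
  have hGle : ∀ v, G v ≤ c := fun v => ciSup_le fun i => (abs_le.1 (habs v i)).2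
  set Λ : Measure (Fin n → A × A) := P.bind (decoupled κ obs hπ n 0) with hΛ
  have hΛp : IsProbabilityMeasure Λ := by rw [hΛ]; infer_instance
  -- The supremum `G` agrees with a measurable function only almost everywhere. Outside a measurable
  -- null set `N` the two coincide; on `N`, the majorant `U` takes the worst value `c` and the
  -- minorant `L`, shifted by `c`, takes `0`. Thus `U` dominates and `L` is dominated at every
  -- point, while `U + c = L` almost everywhere.
  obtain ⟨G₁, hG₁, hGG⟩ := hae Λ hΛp
  set N := toMeasurable Λ {v | ¬ G v = G₁ v} with hN
  have hNm : MeasurableSet N := measurableSet_toMeasurable _ _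
  have hN0 : Λ N = 0 := by rw [hN, measure_toMeasurable]; exact hGG
  have hNG : ∀ v, v ∉ N → G v = G₁ v := fun v hv => by
    by_contra hne
    exact hv (subset_toMeasurable _ _ hne)
  classical
  let U : (Fin n → A × A) → ℝ≥0∞ := fun v =>
    if v ∈ N then ENNReal.ofReal c else ENNReal.ofReal (G₁ v)
  let L : (Fin n → A × A) → ℝ≥0∞ := fun v => if v ∈ N then 0 else ENNReal.ofReal (c + G₁ v)
  have hU : Measurable U := Measurable.ite hNm measurable_const hG₁.ennreal_ofReal
  have hL : Measurable L := Measurable.ite hNm measurable_const (hG₁.const_add c).ennreal_ofReal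
  have hUG : ∀ v i, ENNReal.ofReal (∑ j, (e (v j).1 i - e (v j).2 i)) ≤ U v := by
    intro v i
    have h1 : ∑ j, (e (v j).1 i - e (v j).2 i) ≤ G v := le_ciSup (hbdd v) i
    by_cases hv : v ∈ N
    · simp only [U, hv, if_true]
      exact ENNReal.ofReal_le_ofReal (h1.trans (hGle v))
    · simp only [U, hv, if_false, ← hNG v hv]
      exact ENNReal.ofReal_le_ofReal h1
  have hLG : ∀ v, L v ≤ ENNReal.ofReal (⨆ i, (c + ∑ j, (e (v j).1 i - e (v j).2 i))) := by
    intro v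
    by_cases hv : v ∈ N
    · simp [L, hv]
    · simp only [L, hv, if_false, ← hNG v hv]
      refine ENNReal.ofReal_le_ofReal ?_
      rw [add_comm, hG]
      simp only [ciSup_add (hbdd v)]
      simp only [add_comm c]
      exact le_rfl
  have hint : ∀ {W : (Fin n → A × A) → ℝ≥0∞}, Measurable W →
      ∫⁻ v, W v ∂Λ = ∫⁻ ω, ∫⁻ v, W v ∂decoupled κ obs hπ n 0 ω ∂P := fun hW =>
    Measure.lintegral_bind (Kernel.measurable _).aemeasurable hW.aemeasurable
  refine ⟨fun ω => ∫⁻ v, U v ∂decoupled κ obs hπ n 0 ω,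
    (hU.comp measurable_snd).lintegral_kernel_prod_right', fun ω i => ?_, ?_⟩
  · have h1 := ofReal_le_lintegral_decoupled (κ := κ) hπ hobs (hem i) (fun a => he a i) ω n 0 0
    simp only [zero_add] at h1
    have hcast : ∀ m j, m = j → e (obs m (π (m + 1) ω)) i - ∫ x, e (obs m x) i ∂κ m (π m ω) =
        e (obs j (π (j + 1) ω)) i - ∫ x, e (obs j x) i ∂κ j (π j ω) := by rintro m _ rfl; rfl
    rw [Finset.sum_congr rfl fun j _ => hcast (0 + j) j (zero_add j)] at h1
    exact h1.trans (lintegral_mono fun v => hUG v i)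
  · have h1 : ∫⁻ v, U v ∂Λ + ENNReal.ofReal c = ∫⁻ v, L v ∂Λ := by
      have : ENNReal.ofReal c = ∫⁻ _, ENNReal.ofReal c ∂Λ := by simp
      rw [this, ← lintegral_add_left hU]
      refine lintegral_congr_ae ?_
      filter_upwards [measure_eq_zero_iff_ae_notMem.1 hN0] with v hv
      have hG0 : 0 ≤ G₁ v := hNG v hv ▸ hnn v
      simp only [U, L, hv, if_false]
      rw [← ENNReal.ofReal_add hG0 hc0, add_comm]
    have h2 : ∫⁻ v, L v ∂Λ = ∫⁻ ω, ∫⁻ v, L v ∂tangent κ obs n 0 (π 0 ω) ∂P := by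
      rw [hint hL]
      exact lintegral_decoupled_eq_tangent hπ hobs hr n 0
        (fun j _ hj => ⟨hrπ j (by omega), hP j (by omega)⟩) (fun p => L p.2)
        (hL.comp measurable_snd)
    have h3 : ∫⁻ ω, ∫⁻ v, L v ∂tangent κ obs n 0 (π 0 ω) ∂P ≤
        ENNReal.ofReal (pot ((2 : ℝ) • e) n 0) + ENNReal.ofReal c := by
      calc _ ≤ ∫⁻ _, ENNReal.ofReal (pot ((2 : ℝ) • e) n fun _ => c) ∂P :=
            lintegral_mono fun ω => lintegral_tangent_le hobs he n 0 (π 0 ω) (fun _ => c) L hL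
              (bddAbove_range_of_abs_le fun _ => le_rfl) (fun _ => le_rfl) hLG
        _ = ENNReal.ofReal (pot ((2 : ℝ) • e) n fun _ => c) := by simp
        _ ≤ _ := by
            have hb0 : BddAbove (Set.range (0 : I → ℝ)) :=
              bddAbove_range_of_abs_le (B := 0) (by simp)
            have := pot_add_const he2 n c hb0
            simp only [Pi.zero_apply, zero_add] at this
            rw [this, ENNReal.ofReal_add (le_pot he2 n hb0 fun _ => le_rfl) hc0]
    rw [← hint hU]
    refine (ENNReal.add_le_add_iff_right (a := ENNReal.ofReal c) ENNReal.ofReal_ne_top).1 ?_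
    rw [h1, h2]
    exact h3

/-! ### Uniform deviations over a class of finite dimension -/

section Signed

variable {X : Type u} {F : Set (X → Label)}

theorem iSup_sgn_mul {ι : Type*} [Nonempty ι] {s : ι → ℝ} {C : ℝ} (hs : ∀ i, |s i| ≤ C) :
    ⨆ p : ι × Bool, sgn p.2 * s p.1 = max (⨆ i, s i) (⨆ i, -s i) := by
  have hb : BddAbove (Set.range fun p : ι × Bool => sgn p.2 * s p.1) :=
    bddAbove_range_of_abs_le (B := C) fun p => by rw [abs_mul, abs_sgn, one_mul]; exact hs p.1
  have hb1 : BddAbove (Set.range s) := bddAbove_range_of_abs_le hs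
  have hb2 : BddAbove (Set.range fun i => -s i) :=
    bddAbove_range_of_abs_le (B := C) fun i => by rw [abs_neg]; exact hs i
  refine le_antisymm (ciSup_le fun p => ?_) (max_le (ciSup_le fun i => ?_) (ciSup_le fun i => ?_))
  · obtain ⟨i, b⟩ := p
    cases b
    · refine le_max_of_le_right ((le_ciSup hb2 i).trans' ?_)
      simp [sgn]
    · refine le_max_of_le_left ((le_ciSup hb1 i).trans' ?_)
      simp [sgn]
  · refine (le_ciSup hb (i, true)).trans' ?_
    simp [sgn]
  · refine (le_ciSup hb (i, false)).trans' ?_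
    simp [sgn]

theorem aemeasurable_iSup_mul_sum [MeasurableSpace X] (hmeas : IsMeasurableClass F) {A : Type*}
    [MeasurableSpace A] {ζ : A → Sample X} (hζ : Measurable ζ) (n : ℕ) (c : ℝ)
    (μ : Measure (Fin n → A × A)) [IsProbabilityMeasure μ] :
    AEMeasurable (fun v => ⨆ f : F, c * ∑ j, (loss (ζ (v j).1) (f : X → Label) -
      loss (ζ (v j).2) (f : X → Label))) μ := by
  let T : (Fin n → A × A) → Fin (n + n) → Sample X := fun v =>
    Fin.append (fun j => ζ (v j).1) (fun j => ζ (v j).2)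
  have hT : Measurable T := by
    refine measurable_pi_iff.2 (Fin.addCases (fun j => ?_) fun j => ?_)
    · simp only [T, Fin.append_left]
      exact hζ.comp (measurable_fst.comp (measurable_pi_apply j))
    · simp only [T, Fin.append_right]
      exact hζ.comp (measurable_snd.comp (measurable_pi_apply j))
  have h := (hmeas.aemeasurable_iSup (n + n) (Fin.append (fun _ => c) fun _ => -c) (μ.map T)
    (Measure.isProbabilityMeasure_map hT.aemeasurable)).comp_measurable hT
  refine h.congr (ae_of_all _ fun v => ?_)
  simp only [Function.comp_apply, Fin.sum_univ_add, Fin.append_left, Fin.append_right, T]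
  refine iSup_congr fun f => ?_
  rw [Finset.mul_sum, ← Finset.sum_add_distrib]
  exact Finset.sum_congr rfl fun j _ => by ring

/-- Absolute values are handled by the index set `F × Bool`. The hypothesis `hc` reduces
measurability of the suprema to that of weighted sums of `2 * n` losses, with weights `c` and `-c`.
-/
theorem exists_measurable_majorant_abs [MeasurableSpace X] (hF : F.Nonempty)
    (hmeas : IsMeasurableClass F) {A : Type*} [MeasurableSpace A] [Nonempty A] {S : ℕ → Type*}
    [∀ t, MeasurableSpace (S t)] {κ : ∀ t, Kernel (S t) (S (t + 1))}
    [∀ t, IsMarkovKernel (κ t)] {obs : ∀ t, S (t + 1) → A} (hobs : ∀ t, Measurable (obs t))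
    {Ω : Type*} [MeasurableSpace Ω] {P : Measure Ω} [IsProbabilityMeasure P]
    {π : ∀ t, Ω → S t} (hπ : ∀ t, Measurable (π t)) {r : ∀ t, S (t + 1) → S t}
    (hr : ∀ t, Measurable (r t)) {n : ℕ} (hrπ : ∀ j < n, ∀ ω, r j (π (j + 1) ω) = π j ω)
    (hP : ∀ j < n, P.map (fun ω => (π j ω, π (j + 1) ω)) = (P.map (π j)) ⊗ₘ κ j)
    {e : A → F → ℝ} {B : ℝ} (he : ∀ a f, |e a f| ≤ B) (hem : ∀ f, Measurable fun a => e a f)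
    {ζ : A → Sample X} (hζ : Measurable ζ) {c : ℝ} (hc : ∀ a b (f : F), e a f - e b f =
      c * (loss (ζ a) (f : X → Label) - loss (ζ b) (f : X → Label))) :
    ∃ h : Ω → ℝ≥0∞, Measurable h ∧
      (∀ ω f, ENNReal.ofReal |∑ j ∈ Finset.range n, (e (obs j (π (j + 1) ω)) f -
        ∫ x, e (obs j x) f ∂κ j (π j ω))| ≤ h ω) ∧
      ∫⁻ ω, h ω ∂P ≤ ENNReal.ofReal
        (pot ((2 : ℝ) • fun a (p : F × Bool) => sgn p.2 * e a p.1) n 0) := by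
  have : Nonempty F := hF.to_subtype
  have hB' : ∀ a (p : F × Bool), |sgn p.2 * e a p.1| ≤ B := fun a p => by
    rw [abs_mul, abs_sgn, one_mul]; exact he a p.1
  have hsum : ∀ (v : Fin n → A × A), (⨆ p : F × Bool, ∑ j, (sgn p.2 * e (v j).1 p.1 -
      sgn p.2 * e (v j).2 p.1)) = max (⨆ f : F, c * ∑ j, (loss (ζ (v j).1) (f : X → Label) -
        loss (ζ (v j).2) (f : X → Label))) (⨆ f : F, -c * ∑ j, (loss (ζ (v j).1) (f : X → Label) -
          loss (ζ (v j).2) (f : X → Label))) := by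
    intro v
    have h1 := iSup_sgn_mul (s := fun f : F => ∑ j, (e (v j).1 f - e (v j).2 f)) (C := n * (2 * B))
      fun f => by
        refine (Finset.abs_sum_le_sum_abs _ _).trans ?_
        calc _ ≤ ∑ _j : Fin n, 2 * B := Finset.sum_le_sum fun j _ => by
              refine (abs_sub _ _).trans ?_
              linarith [he (v j).1 f, he (v j).2 f]
          _ = _ := by simp
    simp only [hc, ← Finset.mul_sum] at h1
    simp only [← mul_sub, ← Finset.mul_sum, hc, h1, neg_mul]
  have hnn : ∀ (v : Fin n → A × A), 0 ≤ ⨆ p : F × Bool, ∑ j, (sgn p.2 * e (v j).1 p.1 -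
      sgn p.2 * e (v j).2 p.1) := by
    intro v
    rw [hsum]
    by_contra! hlt
    obtain ⟨h1, h2⟩ := max_lt_iff.1 hlt
    obtain ⟨f⟩ := ‹Nonempty F›
    have hbd : ∀ f : F, |c * ∑ j, (loss (ζ (v j).1) (f : X → Label) -
        loss (ζ (v j).2) (f : X → Label))| ≤ |c| * (n * 4) := fun f => by
      rw [abs_mul]
      refine mul_le_mul_of_nonneg_left ((Finset.abs_sum_le_sum_abs _ _).trans ?_) (abs_nonneg _)
      calc _ ≤ ∑ _j : Fin n, (4 : ℝ) := Finset.sum_le_sum fun j _ => by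
            refine (abs_sub _ _).trans ?_
            linarith [abs_loss_le (ζ (v j).1) (f : X → Label),
              abs_loss_le (ζ (v j).2) (f : X → Label)]
        _ = _ := by simp
    have h3 := le_ciSup (bddAbove_range_of_abs_le hbd) f
    have h4 := le_ciSup (bddAbove_range_of_abs_le (g := fun f : F => -c * ∑ j, (loss (ζ (v j).1)
      (f : X → Label) - loss (ζ (v j).2) (f : X → Label))) (B := |c| * (n * 4)) fun f => by
        rw [neg_mul, abs_neg]; exact hbd f) f
    linarith
  obtain ⟨h, hm, hle, hint⟩ := exists_measurable_majorant hobs hπ hr hrπ hP hB'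
    (fun p => (hem p.1).const_mul _) hnn fun μ hμ => by
      simp only [hsum]
      exact (aemeasurable_iSup_mul_sum hmeas hζ n c μ).sup
        (aemeasurable_iSup_mul_sum hmeas hζ n (-c) μ)
  refine ⟨h, hm, fun ω f => ?_, hint⟩
  have h1 := hle ω (f, true)
  have h2 := hle ω (f, false)
  simp only [sgn, if_true, one_mul, Bool.false_eq_true, if_false, neg_one_mul, integral_neg,
    sub_neg_eq_add] at h1 h2
  rcases abs_choice (∑ j ∈ Finset.range n, (e (obs j (π (j + 1) ω)) f -
        ∫ x, e (obs j x) f ∂κ j (π j ω))) with h3 | h3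
  · rw [h3]; exact h1
  · rw [h3, ← Finset.sum_neg_distrib]
    refine le_trans (le_of_eq ?_) h2
    congr 1
    exact Finset.sum_congr rfl fun j _ => by ring

theorem upperExp_le_lintegral {Ω : Type u} [MeasurableSpace Ω] (μ : Measure Ω)
    {g h : Ω → ℝ≥0∞} (hh : Measurable h) (hgh : ∀ ω, g ω ≤ h ω) :
    upperExp μ g ≤ ∫⁻ ω, h ω ∂μ :=
  iInf_le_of_le h (iInf_le_of_le hh (iInf_le _ hgh))

end Signed

/-! ### Adapted processes as chains of kernels -/

section Adapted

variable {X : Type u} [MeasurableSpace X] (S : AdaptedProcess X)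

/-- The probability space of an adapted process with the `σ`-algebra of time `t`. -/
def AdaptedProcess.State (_t : ℕ) : Type u := S.Ω

instance (t : ℕ) : MeasurableSpace (S.State t) := S.filt t

/-- A point of the probability space, seen at time `t`. -/
def AdaptedProcess.toState (t : ℕ) (ω : S.Ω) : S.State t := ω

/-- The conditional law given the past as a kernel between consecutive times. -/
noncomputable def AdaptedProcess.step (t : ℕ) : Kernel (S.State t) (S.State (t + 1)) :=
  Kernel.map (mα := S.filt t) (S.cond t) (S.toState (t + 1))

/-- The value that becomes known at time `t + 1`. -/
def AdaptedProcess.obs (t : ℕ) : S.State (t + 1) → X := S.val t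

theorem AdaptedProcess.measurable_obs (t : ℕ) : Measurable (S.obs t) := S.measurable_val t

theorem AdaptedProcess.measurable_state (t : ℕ) : Measurable (S.toState t) :=
  measurable_id'' (S.filt.le t)

theorem AdaptedProcess.step_apply (t : ℕ) (ω : S.Ω) :
    S.step t (S.toState t ω) = (S.cond t ω).map (S.toState (t + 1)) :=
  Kernel.map_apply _ (S.measurable_state (t + 1)) _

instance (t : ℕ) : IsMarkovKernel (S.step t) := by
  have := S.isMarkov_cond t
  exact Kernel.IsMarkovKernel.map (mα := S.filt t) (S.cond t) (S.measurable_state (t + 1))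

/-- On rectangles this is the defining property of the conditional probability given `filt t`. The
state at each time is the same point `ω`, and only the `σ`-algebra changes. -/
theorem AdaptedProcess.map_state_eq (t : ℕ) :
    S.prob.map (fun ω => (S.toState t ω, S.toState (t + 1) ω)) =
      (S.prob.map (S.toState t)) ⊗ₘ S.step t := by
  have hm := S.measurable_state t
  have hm' := S.measurable_state (t + 1)
  have := Measure.isProbabilityMeasure_map (μ := S.prob) hm.aemeasurable
  have := Measure.isProbabilityMeasure_map (μ := S.prob) (hm.prodMk hm').aemeasurable
  refine Measure.ext_prod fun {s s'} hs hs' => ?_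
  obtain ⟨s₁, hs₁⟩ : ∃ s₁ : Set S.Ω, s₁ = S.toState t ⁻¹' s := ⟨_, rfl⟩
  obtain ⟨s₂, hs₂⟩ : ∃ s₂ : Set S.Ω, s₂ = S.toState (t + 1) ⁻¹' s' := ⟨_, rfl⟩
  have hm₁ : MeasurableSet[S.filt t] s₁ := hs₁ ▸ hs
  have hm₂ : MeasurableSet s₂ := hs₂ ▸ hm' hs'
  have hm₁' : MeasurableSet s₁ := S.filt.le t _ hm₁
  have := S.isMarkov_cond t
  have h1 : ∀ ω : S.Ω, S.step t (S.toState t ω) s' = ENNReal.ofReal ((S.cond t ω).real s₂) :=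
    fun ω => by rw [S.step_apply, Measure.map_apply hm' hs', ← hs₂, ofReal_measureReal]
  have hmr : Measurable fun ω : S.Ω => (S.cond t ω).real s₂ :=
    ((Kernel.measurable_coe (S.cond t) hm₂).ennreal_toReal).mono (S.filt.le t) le_rfl
  have hint : Integrable (fun ω : S.Ω => (S.cond t ω).real s₂) S.prob :=
    Integrable.of_bound hmr.aestronglyMeasurable 1 (ae_of_all _ fun ω => by
      rw [Real.norm_of_nonneg measureReal_nonneg]; exact measureReal_le_one)
  rw [Measure.map_apply (hm.prodMk hm') (hs.prod hs'), Measure.compProd_apply_prod hs hs',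
    setLIntegral_map hs (Kernel.measurable_coe (S.step t) hs') hm, ← hs₁]
  simp only [h1]
  rw [← ofReal_integral_eq_lintegral_ofReal hint.integrableOn
    (ae_of_all _ fun ω => measureReal_nonneg),
    integral_congr_ae (ae_restrict_of_ae (S.isCond t s₂ hm₂)),
    setIntegral_condExp (S.filt.le t) ((integrable_const _).indicator hm₂) hm₁,
    integral_indicator hm₂, Measure.restrict_restrict hm₂]
  simp only [integral_const, smul_eq_mul, mul_one, measureReal_restrict_apply_univ]
  rw [hs₁, hs₂, Set.inter_comm, ofReal_measureReal]
  rfl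

theorem upperExp_deviation_le {F : Set (X → Label)} (hF : F.Nonempty) [Nonempty X]
    (hmeas : IsMeasurableClass F) (n : ℕ) :
    upperExp S.prob (fun ω => ⨆ f : F, ENNReal.ofReal |S.deviation n (f : X → Label) ω|) ≤
      ENNReal.ofReal ((1 / (n : ℝ)) * pot ((2 : ℝ) • fun x (p : F × Bool) =>
        sgn p.2 * ((p.1 : X → Label) x : ℝ)) n 0) := by
  -- With label `1` the loss is `1 - f x`, so differences of function values are differences of
  -- losses with the factor `-1`.
  have hζ : Measurable fun x : X => ((x, ⟨1, by norm_num⟩) : Sample X) :=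
    measurable_id.prodMk measurable_const
  have hfm : ∀ f : F, Measurable fun x => ((f : X → Label) x : ℝ) := fun f =>
    measurable_subtype_coe.comp (hmeas.measurable_mem f f.2)
  have hloss : ∀ (x : X) (f : F), loss ((x, ⟨1, by norm_num⟩) : Sample X) (f : X → Label) =
      1 - ((f : X → Label) x : ℝ) := fun x f => by
    rw [loss, abs_of_nonneg]
    linarith [((f : X → Label) x).2.2]
  obtain ⟨h, hm, hle, hint⟩ := exists_measurable_majorant_abs hF hmeas (κ := S.step)
    (P := S.prob) S.measurable_obs S.measurable_state (r := fun t (ω : S.State (t + 1)) => S.toState t ω)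
    (fun t => measurable_id'' (S.filt.mono (Nat.le_succ t))) (n := n) (fun j _ ω => rfl)
    (fun j _ => S.map_state_eq j) (e := fun x (f : F) => ((f : X → Label) x : ℝ)) (B := 1)
    (fun x f => abs_label_le _) hfm hζ (c := -1) (fun a b f => by rw [hloss, hloss]; ring)
  have h0 : (0 : ℝ) ≤ 1 / n := by positivity
  refine (upperExp_le_lintegral S.prob (hm.const_mul (ENNReal.ofReal (1 / n)))
    fun ω => iSup_le fun f => ?_).trans ?_
  · rw [AdaptedProcess.deviation, abs_mul, abs_of_nonneg h0, ENNReal.ofReal_mul h0]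
    gcongr
    refine le_trans (le_of_eq ?_) (hle ω f)
    congr 2
    refine Finset.sum_congr rfl fun t _ => ?_
    have hm : Measurable fun ω => ((f : X → Label) (S.obs t ω) : ℝ) :=
      (hfm f).comp (S.measurable_obs t)
    rw [S.step_apply, integral_map (S.measurable_state (t + 1)).aemeasurable
      hm.aestronglyMeasurable]
    rfl
  · rw [lintegral_const_mul _ hm, ENNReal.ofReal_mul h0]
    gcongr

theorem umlln_of_sfat_lt_top {F : Set (X → Label)} (hF : F.Nonempty) [Nonempty X]
    (hmeas : IsMeasurableClass F) (h : ∀ γ : ℝ, 0 < γ → sfat F γ < ⊤) : UMLLN F := by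
  have : Nonempty F := hF.to_subtype
  refine le_antisymm (ENNReal.le_of_forall_pos_le_add fun δ hδ _ => ?_) zero_le
  rw [zero_add]
  have hpot := eventually_pot_signed_le (e := fun x (f : F) => 2 * ((f : X → Label) x : ℝ))
    (π := id) (L := 2) (B := 2) hF h (by norm_num)
    (fun x f => by rw [abs_mul, abs_two]; linarith [abs_label_le ((f : X → Label) x)])
    (fun x f g => by rw [← mul_sub, abs_mul, abs_two]; rfl) (δ := δ) (by exact_mod_cast hδ)
  refine limsup_le_of_le (h := ?_)
  filter_upwards [hpot, eventually_gt_atTop 0] with n hn h0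
  have h0' : (0 : ℝ) < n := by exact_mod_cast h0
  refine iSup_le fun S => (upperExp_deviation_le S hF hmeas n).trans ?_
  rw [← ENNReal.ofReal_coe_nnreal]
  refine ENNReal.ofReal_le_ofReal ?_
  have he : ((2 : ℝ) • fun x (p : F × Bool) => sgn p.2 * ((p.1 : X → Label) x : ℝ)) =
      fun x p => sgn p.2 * (2 * ((p.1 : X → Label) x : ℝ)) := by
    funext x p
    simp only [Pi.smul_apply, smul_eq_mul]
    ring
  rw [he, one_div, inv_mul_le_iff₀ h0', mul_comm]
  exact hn

end Adapted

/-! ### Learning under stochastic processes by empirical risk minimization -/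

section Snoc

variable {Z : Type*} [MeasurableSpace Z] {t : ℕ}

theorem measurable_fin_snoc :
    Measurable fun p : (Fin t → Z) × Z => (Fin.snoc p.1 p.2 : Fin (t + 1) → Z) := by
  refine measurable_pi_iff.2 (Fin.lastCases ?_ fun i => ?_)
  · simpa using measurable_snd
  · simp only [Fin.snoc_castSucc]
    exact (measurable_pi_apply i).comp measurable_fst

/-- The transition kernel that appends a new entry to a sequence. -/
noncomputable def snocKernel (η : Kernel (Fin t → Z) Z) :
    Kernel (Fin t → Z) (Fin (t + 1) → Z) :=
  (Kernel.id ×ₖ η).map fun p => Fin.snoc p.1 p.2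

variable (η : Kernel (Fin t → Z) Z) [IsMarkovKernel η]

instance isMarkovKernel_snocKernel : IsMarkovKernel (snocKernel η) := Kernel.IsMarkovKernel.map _ measurable_fin_snoc

theorem snocKernel_apply (a : Fin t → Z) :
    snocKernel η a = (η a).map fun w => (Fin.snoc a w : Fin (t + 1) → Z) := by
  rw [snocKernel, Kernel.map_apply _ measurable_fin_snoc, Kernel.prod_apply, Kernel.id_apply,
    Measure.dirac_prod, Measure.map_map measurable_fin_snoc measurable_prodMk_left]
  rfl

theorem compProd_snocKernel (μ : Measure (Fin t → Z)) [SFinite μ] :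
    μ ⊗ₘ snocKernel η =
      (μ ⊗ₘ η).map fun p => (p.1, (Fin.snoc p.1 p.2 : Fin (t + 1) → Z)) := by
  have hm : Measurable fun p : (Fin t → Z) × Z => (p.1, (Fin.snoc p.1 p.2 : Fin (t + 1) → Z)) :=
    measurable_fst.prodMk measurable_fin_snoc
  ext s hs
  rw [Measure.map_apply hm hs, Measure.compProd_apply hs, Measure.compProd_apply (hm hs)]
  refine lintegral_congr fun a => ?_
  have hma : Measurable fun w => (Fin.snoc a w : Fin (t + 1) → Z) :=
    measurable_fin_snoc.comp measurable_prodMk_left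
  rw [snocKernel_apply, Measure.map_apply hma (measurable_prodMk_left hs)]
  rfl

theorem integral_snocKernel {g : Z → ℝ} (hg : Measurable g) (a : Fin t → Z) :
    ∫ x, g (x (Fin.last t)) ∂snocKernel η a = ∫ w, g w ∂η a := by
  have hma : Measurable fun w => (Fin.snoc a w : Fin (t + 1) → Z) :=
    measurable_fin_snoc.comp measurable_prodMk_left
  have hg' : Measurable fun x : Fin (t + 1) → Z => g (x (Fin.last t)) :=
    hg.comp (measurable_pi_apply _)
  rw [snocKernel_apply, integral_map hma.aemeasurable hg'.aestronglyMeasurable]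
  simp

end Snoc

/-! ### Growing prefixes of a sample as a chain -/

section Chain

variable {Z : Type u} [MeasurableSpace Z] [Nonempty Z] {n : ℕ} (P : ProcessLaw Z n)

/-- The first `t` entries of a sequence of length `n`, padded if `n < t`. -/
noncomputable def padPast (n t : ℕ) (z : Fin n → Z) : Fin t → Z :=
  fun i => if h : (i : ℕ) < n then z ⟨i, h⟩ else Classical.arbitrary Z

theorem measurable_padPast (n t : ℕ) : Measurable (padPast (Z := Z) n t) := by
  refine measurable_pi_iff.2 fun i => ?_
  by_cases h : (i : ℕ) < n
  · simpa [padPast, h] using measurable_pi_apply _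
  · simp [padPast, h]

omit [MeasurableSpace Z] in
theorem padPast_eq_past (t : Fin n) (z : Fin n → Z) : padPast n t z = past t z := by
  funext i
  simp only [padPast, dif_pos (i.isLt.trans t.isLt)]
  rfl

omit [MeasurableSpace Z] in
theorem padPast_succ (t : Fin n) (z : Fin n → Z) :
    padPast n (t + 1) z = (Fin.snoc (past t z) (z t) : Fin (t + 1) → Z) := by
  funext i
  refine Fin.lastCases ?_ (fun i => ?_) i
  · simp [padPast]
  · simp only [Fin.snoc_castSucc, ← padPast_eq_past]
    rfl

omit [MeasurableSpace Z] in
theorem init_padPast_succ (t : ℕ) (z : Fin n → Z) :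
    (Fin.init (padPast n (t + 1) z) : Fin t → Z) = padPast n t z := rfl

/-- The transition kernels of the growing sequences under a process law. -/
noncomputable def ProcessLaw.step (t : ℕ) : Kernel (Fin t → Z) (Fin (t + 1) → Z) :=
  if h : t < n then snocKernel (P.cond ⟨t, h⟩)
  else Kernel.const _ (Measure.dirac fun _ => Classical.arbitrary Z)

instance (t : ℕ) : IsMarkovKernel (P.step t) := by
  unfold ProcessLaw.step
  split_ifs with h
  · have := P.isMarkov_cond ⟨t, h⟩
    exact isMarkovKernel_snocKernel (t := t) (P.cond ⟨t, h⟩)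
  · infer_instance

theorem ProcessLaw.step_eq (t : Fin n) : P.step t = snocKernel (P.cond t) := by
  rw [ProcessLaw.step, dif_pos t.isLt]

omit [Nonempty Z] in
theorem measurable_past (t : Fin n) : Measurable (past (A := Z) t) :=
  measurable_pi_iff.2 fun _ => measurable_pi_apply _

theorem ProcessLaw.map_padPast (t : Fin n) :
    P.law.map (fun z => (padPast n t z, padPast n (t + 1) z)) =
      (P.law.map (padPast n t)) ⊗ₘ P.step t := by
  have h1 : padPast (Z := Z) n t = past t := funext (padPast_eq_past t)
  have hm : Measurable fun p : (Fin (t : ℕ) → Z) × Z =>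
      (p.1, (Fin.snoc p.1 p.2 : Fin (t + 1) → Z)) :=
    measurable_fst.prodMk measurable_fin_snoc
  have := Measure.isProbabilityMeasure_map (μ := P.law) (measurable_past t).aemeasurable
  rw [P.step_eq, h1, compProd_snocKernel, ← P.isCond,
    Measure.map_map hm ((measurable_past t).prodMk (measurable_pi_apply t))]
  refine congrArg (fun g => P.law.map g) (funext fun z => ?_)
  rw [padPast_succ]
  rfl

end Chain

section ERM

variable {X : Type u} {F : Set (X → Label)}

theorem loss_nonneg (z : Sample X) (f : X → Label) : 0 ≤ loss z f := abs_nonneg _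

theorem exists_approx_minimizer (hF : F.Nonempty) {n : ℕ} (z : Fin n → Sample X) :
    ∃ f : F, ∀ g : F, ∑ t, loss (z t) (f : X → Label) ≤ ∑ t, loss (z t) (g : X → Label) + 1 := by
  have : Nonempty F := hF.to_subtype
  obtain ⟨f, hf⟩ := exists_lt_of_ciInf_lt
    (show ⨅ g : F, ∑ t, loss (z t) (g : X → Label) < (⨅ g : F, ∑ t, loss (z t) (g : X → Label)) + 1
      by linarith)
  refine ⟨f, fun g => hf.le.trans ?_⟩
  have hb : BddBelow (Set.range fun g : F => ∑ t, loss (z t) (g : X → Label)) :=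
    ⟨0, by rintro _ ⟨g, rfl⟩; exact Finset.sum_nonneg fun t _ => loss_nonneg _ _⟩
  linarith [ciInf_le hb g]

variable [MeasurableSpace X]

theorem measurable_loss {f : X → Label} (hf : Measurable f) :
    Measurable fun z : Sample X => loss z f :=
  ((measurable_subtype_coe.comp measurable_snd).sub
    (measurable_subtype_coe.comp (hf.comp measurable_fst))).abs

/-- Approximate empirical risk minimization: the excess of the conditional risk sum is at most twice
the uniform deviation plus the optimization error `1`. -/
theorem processValue_le [Nonempty X] (hF : F.Nonempty) (hmeas : IsMeasurableClass F) (n : ℕ) :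
    processValue F n ≤ ENNReal.ofReal (1 / n) * (2 * ENNReal.ofReal
      (pot ((2 : ℝ) • fun z (p : F × Bool) => sgn p.2 * loss z (p.1 : X → Label)) n 0) + 1) := by
  choose fhat hfhat using exists_approx_minimizer (F := F) hF (n := n)
  refine iInf_le_of_le fhat (iSup_le fun P => ?_)
  have : Nonempty F := hF.to_subtype
  have hlm : ∀ f : F, Measurable fun z : Sample X => loss z (f : X → Label) := fun f =>
    measurable_loss (hmeas.measurable_mem f f.2)
  obtain ⟨h, hm, hle, hint⟩ := exists_measurable_majorant_abs hF hmeas (κ := P.step)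
    (P := P.law) (obs := fun t (z : Fin (t + 1) → Sample X) => z (Fin.last t))
    (fun t => measurable_pi_apply _) (measurable_padPast n)
    (r := fun t (z : Fin (t + 1) → Sample X) => (Fin.init z : Fin t → Sample X))
    (fun t => measurable_pi_iff.2 fun i => measurable_pi_apply _) (n := n)
    (fun j _ ω => init_padPast_succ j ω) (fun j hj => P.map_padPast ⟨j, hj⟩)
    (e := fun z (f : F) => loss z (f : X → Label)) (B := 2)
    (fun z f => abs_loss_le z _) hlm measurable_id (c := 1) (fun a b f => by simp)
  have h0 : (0 : ℝ) ≤ 1 / n := by positivity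
  refine (upperExp_le_lintegral P.law (((hm.const_mul 2).add_const 1).const_mul
    (ENNReal.ofReal (1 / n))) fun z => ?_).trans ?_
  · have hdev : ∀ f : F, ENNReal.ofReal |∑ t, loss (z t) (f : X → Label) -
        ∑ t, ∫ w, loss w (f : X → Label) ∂(P.cond t (past t z))| ≤ h z := by
      intro f
      refine le_trans (le_of_eq ?_) (hle z f)
      congr 2
      rw [Finset.sum_range, ← Finset.sum_sub_distrib]
      refine Finset.sum_congr rfl fun t _ => ?_
      rw [P.step_eq, integral_snocKernel _ (hlm f), padPast_eq_past, padPast_succ, Fin.snoc_last]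
    rcases eq_or_ne (h z) ⊤ with htop | htop
    · rcases Nat.eq_zero_or_pos n with rfl | hn
      · simp [ProcessLaw.risk]
      · rw [htop]
        refine le_top.trans (le_of_eq ?_)
        have : ENNReal.ofReal (1 / n) ≠ 0 := by
          rw [Ne, ENNReal.ofReal_eq_zero, not_le]; positivity
        rw [ENNReal.mul_top two_ne_zero, top_add, ENNReal.mul_top this]
    · obtain ⟨H, hH⟩ : ∃ H : NNReal, h z = H := ⟨(h z).toNNReal, (ENNReal.coe_toNNReal htop).symm⟩
      have hdev' : ∀ f : F, |∑ t, loss (z t) (f : X → Label) -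
        ∑ t, ∫ w, loss w (f : X → Label) ∂(P.cond t (past t z))| ≤ H := fun f => by
        have := hdev f
        rw [hH, ← ENNReal.ofReal_coe_nnreal] at this
        exact (ENNReal.ofReal_le_ofReal_iff H.2).1 this
      have hR : P.risk z (fhat z : X → Label) - ⨅ f : F, P.risk z (f : X → Label) ≤
          1 / n * (2 * H + 1) := by
        rw [sub_le_comm]
        refine le_ciInf fun f => ?_
        rw [ProcessLaw.risk, ProcessLaw.risk, ← mul_sub]
        refine mul_le_mul_of_nonneg_left ?_ h0
        linarith [hfhat z f, abs_le.1 (hdev' f), abs_le.1 (hdev' (fhat z))]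
      refine (ENNReal.ofReal_le_ofReal hR).trans (le_of_eq ?_)
      rw [ENNReal.ofReal_mul h0, ENNReal.ofReal_add (by positivity) zero_le_one,
        ENNReal.ofReal_mul zero_le_two, ENNReal.ofReal_coe_nnreal, hH]
      simp
  · rw [lintegral_const_mul _ ((hm.const_mul 2).add_const 1),
      lintegral_add_right _ measurable_const, lintegral_const_mul _ hm]
    simp only [lintegral_const, measure_univ, mul_one]
    gcongr

theorem processLearnable_of_sfat_lt_top [Nonempty X] (hF : F.Nonempty)
    (hmeas : IsMeasurableClass F) (h : ∀ γ : ℝ, 0 < γ → sfat F γ < ⊤) : ProcessLearnable F := by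
  have : Nonempty F := hF.to_subtype
  refine le_antisymm (ENNReal.le_of_forall_pos_le_add fun δ hδ _ => ?_) zero_le
  rw [zero_add]
  have hδ' : (0 : ℝ) < δ := by exact_mod_cast hδ
  have hpot := eventually_pot_signed_le (e := fun z (f : F) => 2 * loss z (f : X → Label))
    (π := fun z : Sample X => z.1) (L := 2) (B := 4) hF h (by norm_num)
    (fun x f => by rw [abs_mul, abs_two]; linarith [abs_loss_le x (f : X → Label)])
    (fun x f g => by
      rw [← mul_sub, abs_mul, abs_two]
      exact mul_le_mul_of_nonneg_left (abs_loss_sub_loss_le _ _ _) zero_le_two)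
    (δ := δ / 3) (by positivity)
  have hinv : ∀ᶠ n : ℕ in atTop, 3 / (δ : ℝ) ≤ n :=
    tendsto_natCast_atTop_atTop.eventually_ge_atTop _
  refine limsup_le_of_le (h := ?_)
  filter_upwards [hpot, hinv, eventually_gt_atTop 0] with n hn hn' h0
  have h0' : (0 : ℝ) < n := by exact_mod_cast h0
  refine (processValue_le hF hmeas n).trans ?_
  have he : ((2 : ℝ) • fun z (p : F × Bool) => sgn p.2 * loss z (p.1 : X → Label)) =
      fun x p => sgn p.2 * (2 * loss x (p.1 : X → Label)) := by
    funext x p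
    simp only [Pi.smul_apply, smul_eq_mul]
    ring
  rw [he]
  rw [div_le_iff₀ hδ'] at hn'
  calc _ ≤ ENNReal.ofReal (1 / n) * (2 * ENNReal.ofReal (δ / 3 * n) + 1) := by gcongr
    _ = ENNReal.ofReal (1 / n * (2 * (δ / 3 * n) + 1)) := by
        rw [ENNReal.ofReal_mul (p := 1 / (n : ℝ)) (by positivity),
          ENNReal.ofReal_add (by positivity) zero_le_one, ENNReal.ofReal_mul zero_le_two]
        simp
    _ ≤ ENNReal.ofReal δ := by
        refine ENNReal.ofReal_le_ofReal ?_
        rw [one_div, inv_mul_le_iff₀ h0']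
        linarith
    _ = δ := ENNReal.ofReal_coe_nnreal

end ERM

/-! ### Sequential Rademacher complexity and the online lower bound -/

/-- The involution `τ` on coordinate `t` negates every summand. This replaces conditional
expectations of fair signs throughout the lower bounds. -/
theorem sum_mul_eq_zero_of_flip {C : Type*} [Fintype C] [DecidableEq C] {n : ℕ} (t : Fin n)
    {s : C → ℝ} {v : (Fin n → C) → ℝ} {τ : C → C} (hτ : Function.Involutive τ)
    (hs : ∀ c, s (τ c) = -s c) (hv : ∀ c a, v (Function.update c t a) = v c) :
    ∑ c : Fin n → C, s (c t) * v c = 0 := by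
  have hinv : Function.Involutive fun c : Fin n → C => Function.update c t (τ (c t)) := fun c => by
    simp [hτ (c t)]
  have h := Equiv.sum_comp hinv.toPerm fun c : Fin n → C => s (c t) * v c
  simp only [Function.Involutive.coe_toPerm, Function.update_self, hs, hv, neg_mul,
    Finset.sum_neg_distrib] at h
  linarith

theorem past_update {A : Type*} {n : ℕ} (t : Fin n) (c : Fin n → A) (a : A) :
    past t (Function.update c t a) = past t c := by
  funext i
  exact Function.update_of_ne (fun h => i.isLt.ne (congrArg Fin.val h)) _ _

theorem sgn_not (b : Bool) : sgn (!b) = -sgn b := by cases b <;> simp [sgn]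

theorem sum_sgn_mul_past {n : ℕ} (t : Fin n) (v : (Fin (t : ℕ) → Bool) → ℝ) :
    ∑ ε : Fin n → Bool, sgn (ε t) * v (past t ε) = 0 :=
  sum_mul_eq_zero_of_flip t (v := fun ε => v (past t ε)) Bool.involutive_not sgn_not
    fun c a => by rw [past_update]

theorem sum_sum_sgn_mul_past {n : ℕ} (v : ∀ t : Fin n, (Fin (t : ℕ) → Bool) → ℝ) :
    ∑ ε : Fin n → Bool, ∑ t, sgn (ε t) * v t (past t ε) = 0 := by
  rw [Finset.sum_comm]
  exact Finset.sum_eq_zero fun t _ => sum_sgn_mul_past t (v t)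

theorem limsup_eq_zero_of_eventually_le {u : ℕ → EReal} (h0 : ∀ n, 0 ≤ u n)
    (h : ∀ δ : ℝ, 0 < δ → ∀ᶠ n in atTop, u n ≤ (δ : EReal)) : limsup u atTop = 0 := by
  refine le_antisymm (EReal.le_of_forall_lt_iff_le.1 fun δ hδ => ?_)
    (le_limsup_of_frequently_le (Eventually.of_forall h0).frequently)
  exact limsup_le_of_le (h := h δ (by exact_mod_cast hδ))

section

variable {X : Type u} {F : Set (X → Label)}

theorem abs_sum_sgn_mul_label_le {n : ℕ} (ε : Fin n → Bool) (y : Fin n → Label) :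
    |∑ t, sgn (ε t) * (y t : ℝ)| ≤ n := by
  refine (Finset.abs_sum_le_sum_abs _ _).trans ?_
  calc _ ≤ ∑ _t : Fin n, (1 : ℝ) := Finset.sum_le_sum fun t _ => by
        rw [abs_mul, abs_sgn, one_mul]; exact abs_label_le _
    _ = n := by simp

theorem bddAbove_sum_sgn {n : ℕ} (ε : Fin n → Bool) (x : Fin n → X) :
    BddAbove (Set.range fun f : F => ∑ t, sgn (ε t) * ((f : X → Label) (x t) : ℝ)) :=
  bddAbove_range_of_abs_le fun f => abs_sum_sgn_mul_label_le ε fun t => (f : X → Label) (x t)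

theorem seqRadTree_eq {n : ℕ} (x : BinTree X n) :
    seqRadTree F x = 1 / n * ((∑ ε : Fin n → Bool,
      ⨆ f : F, ∑ t, sgn (ε t) * ((f : X → Label) (x t (past t ε)) : ℝ)) / 2 ^ n) := by
  simp only [seqRadTree, ← Real.mul_iSup_of_nonneg (show (0 : ℝ) ≤ 1 / n by positivity),
    ← Finset.mul_sum, mul_div_assoc]

/-- The witness `s` depends only on past signs, so its signed sum has mean zero and may be
subtracted freely. -/
theorem le_seqRadTree {n : ℕ} {x : BinTree X n} {c : ℝ} (s : BinTree ℝ n)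
    (h : ∀ ε : Fin n → Bool, ∃ f ∈ F, n * c ≤
      ∑ t, sgn (ε t) * ((f (x t (past t ε)) : ℝ) - s t (past t ε))) :
    (n : ℝ) * c ≤ n * seqRadTree F x := by
  rcases Nat.eq_zero_or_pos n with rfl | hn
  · simp
  have hn' : (0 : ℝ) < n := by exact_mod_cast hn
  rw [seqRadTree_eq, ← mul_assoc, mul_one_div_cancel hn'.ne', one_mul, le_div_iff₀ (by positivity)]
  have hz := sum_sum_sgn_mul_past s
  calc (n : ℝ) * c * 2 ^ n = ∑ ε : Fin n → Bool, (n * c + ∑ t, sgn (ε t) * s t (past t ε)) := by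
        rw [Finset.sum_add_distrib, hz]
        simp [mul_comm]
    _ ≤ _ := Finset.sum_le_sum fun ε _ => by
        obtain ⟨f, hf, hle⟩ := h ε
        refine le_trans ?_ (le_ciSup (bddAbove_sum_sgn ε fun t => x t (past t ε)) ⟨f, hf⟩)
        simp only [mul_sub, Finset.sum_sub_distrib] at hle
        linarith

theorem seqRad_nonneg [Nonempty X] (hF : F.Nonempty) (n : ℕ) : 0 ≤ seqRad F n := by
  obtain ⟨f, hf⟩ := hF
  let x : BinTree X n := fun _ _ => Classical.arbitrary X
  refine le_iSup_of_le x ?_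
  rcases Nat.eq_zero_or_pos n with rfl | hn
  · simp [seqRadTree]
  have hn' : (0 : ℝ) < n := by exact_mod_cast hn
  have h := le_seqRadTree (F := F) (x := x) (c := 0) (fun t p => (f (x t p) : ℝ))
    fun ε => ⟨f, hf, by simp⟩
  exact_mod_cast le_of_mul_le_mul_left h hn'

theorem sfat_lt_top_of_limsup_seqRad (h : limsup (fun n => seqRad F n) atTop = 0) (γ : ℝ)
    (hγ : 0 < γ) : sfat F γ < ⊤ := by
  by_contra hs
  have hfr : ∃ᶠ n in atTop, (γ : EReal) ≤ seqRad F n := by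
    refine ((frequently_shatters hs).and_eventually (eventually_gt_atTop 0)).mono ?_
    rintro n ⟨⟨x, s, hx⟩, hn⟩
    have hn' : (0 : ℝ) < n := by exact_mod_cast hn
    refine le_iSup_of_le x (EReal.coe_le_coe_iff.2 (le_of_mul_le_mul_left (le_seqRadTree s ?_) hn'))
    intro ε
    obtain ⟨f, hf, hle⟩ := hx ε
    refine ⟨f, hf, ?_⟩
    calc (n : ℝ) * γ = ∑ _t : Fin n, γ := by simp
      _ ≤ _ := Finset.sum_le_sum fun t _ => hle t
  have := le_limsup_of_frequently_le hfr
  rw [h] at this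
  exact hγ.not_ge (by exact_mod_cast this)

/-- The label `±1` encoded by a Boolean. -/
def signLabel (b : Bool) : Label := ⟨sgn b, by cases b <;> simp [sgn]⟩

theorem loss_signLabel (b : Bool) (x : X) (f : X → Label) :
    loss (x, signLabel b) f = 1 - sgn b * (f x : ℝ) := by
  have h := (f x).2
  cases b
  · rw [loss, abs_of_nonpos] <;> simp [signLabel, sgn] <;> linarith [h.1]
  · rw [loss, abs_of_nonneg] <;> simp [signLabel, sgn]; linarith [h.2]

theorem OnlineRule.regret_signLabel (hF : F.Nonempty) {n : ℕ} (R : OnlineRule F n)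
    (ε : Fin n → Bool) (x : Fin n → X) :
    R.regret (fun t => (x t, signLabel (ε t))) =
      1 / n * ((⨆ f : F, ∑ t, sgn (ε t) * ((f : X → Label) (x t) : ℝ)) -
        ∑ t, sgn (ε t) * ∫ ω, ((R.rule t (past t fun t => (x t, signLabel (ε t))) ω : X → Label)
          (x t) : ℝ) ∂(R.prob)) := by
  have : Nonempty F := hF.to_subtype
  have hinf : ⨅ f : F, ∑ t, loss (x t, signLabel (ε t)) (f : X → Label) =
      n - ⨆ f : F, ∑ t, sgn (ε t) * ((f : X → Label) (x t) : ℝ) := by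
    have hb := bddAbove_sum_sgn (F := F) ε x
    simp only [loss_signLabel, Finset.sum_sub_distrib, Finset.sum_const, Finset.card_univ,
      Fintype.card_fin, nsmul_eq_mul, mul_one]
    refine le_antisymm ?_ (le_ciInf fun f => sub_le_sub_left (le_ciSup hb f) _)
    rw [le_sub_comm]
    refine ciSup_le fun f => ?_
    rw [le_sub_comm]
    refine ciInf_le ⟨(n : ℝ) - n, ?_⟩ f
    rintro _ ⟨f, rfl⟩
    have := abs_le.1 (abs_sum_sgn_mul_label_le ε fun t => (f : X → Label) (x t))
    simp only
    linarith
  have hint : ∀ t, Integrable (fun ω => ((R.rule t (past t fun t => (x t, signLabel (ε t))) ω :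
      X → Label) (x t) : ℝ)) R.prob := fun t =>
    Integrable.of_bound (measurable_subtype_coe.comp (R.measurable_rule _ _ _)).aestronglyMeasurable
      1 (ae_of_all _ fun ω => abs_label_le _)
  have hsum : Integrable (fun ω => ∑ t, sgn (ε t) * ((R.rule t (past t fun t =>
      (x t, signLabel (ε t))) ω : X → Label) (x t) : ℝ)) R.prob :=
    integrable_finsetSum _ fun t _ => (hint t).const_mul _
  rw [OnlineRule.regret, hinf, integral_const_mul]
  congr 1
  simp only [loss_signLabel, Finset.sum_sub_distrib, Finset.sum_const, Finset.card_univ,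
    Fintype.card_fin, nsmul_eq_mul, mul_one, sub_sub_sub_cancel_left]
  rw [integral_sub (integrable_const _) hsum,
    integral_finsetSum _ fun t _ => (hint t).const_mul _]
  simp only [integral_const, probReal_univ, one_smul, integral_const_mul]

/-- With labels `±1` the loss is `1 - sgn b * f x`. For uniform signs, a prediction that depends
only on the past has signed mean zero, so the average regret is exactly `seqRadTree F x`, and some
sign vector attains at least the average. -/
theorem seqRad_le_onlineValue (hF : F.Nonempty) (n : ℕ) : seqRad F n ≤ onlineValue F n := by
  refine iSup_le fun x => le_iInf fun R => ?_
  have hz := sum_sum_sgn_mul_past (n := n) fun t p =>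
    ∫ ω, ((R.rule t (fun i => (x (Fin.castLE t.isLt.le i) (fun j => p (Fin.castLE i.isLt.le j)),
      signLabel (p i))) ω : X → Label) (x t p) : ℝ) ∂(R.prob)
  obtain ⟨ε, -, hε⟩ := Finset.exists_le_of_sum_le (s := (Finset.univ : Finset (Fin n → Bool)))
    (f := fun _ => seqRadTree F x)
    (g := fun ε => R.regret fun t => (x t (past t ε), signLabel (ε t))) Finset.univ_nonempty (by
      simp only [R.regret_signLabel hF _ fun t => x t (past t _)]
      rw [← Finset.mul_sum, Finset.sum_sub_distrib]
      have : (∑ ε : Fin n → Bool, ∑ t, sgn (ε t) * ∫ ω, ((R.rule t (past t fun t =>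
          (x t (past t ε), signLabel (ε t))) ω : X → Label) (x t (past t ε)) : ℝ) ∂(R.prob)) = 0 := hz
      rw [this, seqRadTree_eq]
      simp only [Finset.sum_const, Finset.card_univ, Fintype.card_pi, Fintype.card_bool,
        Finset.prod_const, Fintype.card_fin, nsmul_eq_mul]
      push_cast
      rw [sub_zero, mul_left_comm, mul_div_cancel₀ _ (by positivity)])
  exact le_iSup_of_le _ (EReal.coe_le_coe_iff.2 hε)

theorem limsup_seqRad_of_onlineLearnable [Nonempty X] (hF : F.Nonempty)
    (h : OnlineLearnable F) : limsup (fun n => seqRad F n) atTop = 0 :=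
  le_antisymm ((limsup_le_limsup (Eventually.of_forall (seqRad_le_onlineValue hF))).trans h.le)
    (le_limsup_of_frequently_le (Eventually.of_forall (seqRad_nonneg hF)).frequently)

theorem onlineLearnable_of_sfat_lt_top [Nonempty X] (hF : F.Nonempty)
    (h : ∀ γ : ℝ, 0 < γ → sfat F γ < ⊤) : OnlineLearnable F :=
  limsup_eq_zero_of_eventually_le
    (fun n => (seqRad_nonneg hF n).trans (seqRad_le_onlineValue hF n))
    fun _ hδ => onlineValue_le hF h hδ

end

/-! ### The uniform law of large numbers fails in infinite dimension -/

section Unif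

variable {C : Type*} [Fintype C] {Ω Ω' : Type*} [MeasurableSpace Ω] [MeasurableSpace Ω']

/-- The law of `g c` for a uniformly distributed `c`. -/
noncomputable def unif (g : C → Ω) : Measure Ω :=
  ∑ c, (Fintype.card C : ℝ≥0∞)⁻¹ • Measure.dirac (g c)

theorem lintegral_unif (g : C → Ω) {h : Ω → ℝ≥0∞} (hh : Measurable h) :
    ∫⁻ ω, h ω ∂unif g = (Fintype.card C : ℝ≥0∞)⁻¹ * ∑ c, h (g c) := by
  rw [unif, lintegral_finsetSum_measure, Finset.mul_sum]
  refine Finset.sum_congr rfl fun c _ => ?_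
  rw [lintegral_smul_measure, lintegral_dirac' _ hh, smul_eq_mul]

theorem integral_unif (g : C → Ω) {h : Ω → ℝ} (hh : Measurable h) :
    ∫ ω, h ω ∂unif g = (Fintype.card C : ℝ)⁻¹ * ∑ c, h (g c) := by
  rcases isEmpty_or_nonempty C with hC | hC
  · simp [unif]
  have hc : (Fintype.card C : ℝ≥0∞)⁻¹ ≠ ⊤ := by simp [Fintype.card_ne_zero]
  rw [unif, integral_finsetSum_measure fun c _ => ?_, Finset.mul_sum]
  · refine Finset.sum_congr rfl fun c _ => ?_
    rw [integral_smul_measure, integral_dirac' _ _ hh.stronglyMeasurable]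
    simp
  · exact (integrable_dirac' hh.stronglyMeasurable (by simp)).smul_measure hc

theorem unif_apply (g : C → Ω) {s : Set Ω} (hs : MeasurableSet s) :
    unif g s = (Fintype.card C : ℝ≥0∞)⁻¹ * ∑ c, s.indicator 1 (g c) := by
  rw [← lintegral_indicator_one hs, lintegral_unif g (measurable_one.indicator hs)]

instance [Nonempty C] (g : C → Ω) : IsProbabilityMeasure (unif g) := ⟨by
  rw [unif_apply g MeasurableSet.univ]
  simp only [Set.indicator_univ, Pi.one_apply, Finset.sum_const, Finset.card_univ, nsmul_eq_mul,
    mul_one]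
  exact ENNReal.inv_mul_cancel (by simp [Fintype.card_ne_zero]) (by simp)⟩

theorem map_unif (g : C → Ω) {k : Ω → Ω'} (hk : Measurable k) :
    (unif g).map k = unif fun c => k (g c) := by
  ext s hs
  rw [Measure.map_apply hk hs, unif_apply _ hs, unif_apply _ (hk hs)]
  rfl

theorem lintegral_le_upperExp {Ω : Type u} [MeasurableSpace Ω] (μ : Measure Ω) (g : Ω → ℝ≥0∞) :
    ∫⁻ ω, g ω ∂μ ≤ upperExp μ g :=
  le_iInf fun _ => le_iInf fun _ => le_iInf fun hh => lintegral_mono hh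

end Unif

/-- The discrete space of sign vectors. -/
@[ext]
structure SignSpace (n : ℕ) : Type u where
  down : Fin n → Bool

namespace SignSpace

variable {n : ℕ}

instance : MeasurableSpace (SignSpace.{u} n) := ⊤

instance : DiscreteMeasurableSpace (SignSpace.{u} n) := ⟨fun _ => trivial⟩

instance : Finite (SignSpace.{u} n) :=
  Finite.of_injective SignSpace.down fun _ _ => SignSpace.ext

/-- The entries of a sign vector before time `t`, the others being replaced by `false`. -/
def trunc (t : ℕ) (ω : SignSpace.{u} n) : SignSpace.{u} n :=
  ⟨fun i => if (i : ℕ) < t then ω.down i else false⟩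

theorem trunc_trunc {s t : ℕ} (h : s ≤ t) (ω : SignSpace.{u} n) :
    trunc s (trunc t ω) = trunc s ω := by
  refine SignSpace.ext (funext fun i => ?_)
  simp only [trunc]
  split_ifs with h1 h2
  · rfl
  · exact absurd (h1.trans_le h) h2
  · rfl

/-- The filtration generated by the successive signs. -/
def filt (n : ℕ) : Filtration ℕ (inferInstance : MeasurableSpace (SignSpace.{u} n)) where
  seq t := MeasurableSpace.comap (trunc t) ⊤
  mono' s t h := by
    rintro _ ⟨A, -, rfl⟩
    exact ⟨trunc s ⁻¹' A, trivial, by ext ω; simp [trunc_trunc h]⟩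
  le' _ := le_top

theorem measurable_filt {A : Type*} [MeasurableSpace A] {t : ℕ} {g : SignSpace.{u} n → A}
    (h : ∀ ω, g (trunc t ω) = g ω) : Measurable[filt n t] g := by
  rw [← funext h]
  exact measurable_from_top.comp (comap_measurable (trunc t))

theorem mem_trunc_iff {t : ℕ} {s : Set (SignSpace.{u} n)} (hs : MeasurableSet[filt n t] s)
    (ω : SignSpace.{u} n) : trunc t ω ∈ s ↔ ω ∈ s := by
  obtain ⟨A, -, rfl⟩ := hs
  simp [trunc_trunc le_rfl]

/-- The uniform distribution on sign vectors. -/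
noncomputable def law (n : ℕ) : Measure (SignSpace.{u} n) :=
  unif fun ε : Fin n → Bool => (⟨ε⟩ : SignSpace.{u} n)

instance : IsProbabilityMeasure (law.{u} n) := by unfold law; infer_instance

theorem integral_law (h : SignSpace.{u} n → ℝ) :
    ∫ ω, h ω ∂law n = (2 ^ n : ℝ)⁻¹ * ∑ ε : Fin n → Bool, h ⟨ε⟩ := by
  rw [law, integral_unif _ (measurable_of_countable h)]
  simp

theorem past_trunc (t : Fin n) {s : ℕ} (h : t ≤ s) (ω : SignSpace.{u} n) :
    past t (trunc s ω).down = past t ω.down := by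
  funext i
  exact if_pos (i.isLt.trans_le h)

theorem trunc_update (t : Fin n) (ε : Fin n → Bool) (b : Bool) :
    trunc t (⟨Function.update ε t b⟩ : SignSpace.{u} n) = trunc t ⟨ε⟩ := by
  refine SignSpace.ext (funext fun i => ?_)
  simp only [trunc]
  split_ifs with h
  · exact Function.update_of_ne (fun hi => h.ne (congrArg Fin.val hi)) _ _
  · rfl

/-- The sign at time `t` is fair given the past: sets of `filt n t` are invariant under a change of
coordinate `t`, so flipping it kills the second term of `h`. -/
theorem condExp_eq (t : Fin n) {h g : SignSpace.{u} n → ℝ} {v : (Fin (t : ℕ) → Bool) → ℝ}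
    (hg : ∀ ω, g (trunc t ω) = g ω) (hv : ∀ ω, h ω = g ω + sgn (ω.down t) * v (past t ω.down)) :
    g =ᵐ[law n] (law n)[h | filt n t] := by
  refine ae_eq_condExp_of_forall_setIntegral_eq ((filt n).le t) .of_finite
    (fun s _ _ => .of_finite s.toFinite) (fun s hs _ => ?_) ?_
  · have hs' : MeasurableSet s := trivial
    rw [← integral_indicator hs', ← integral_indicator hs', integral_law, integral_law]
    congr 1
    rw [← sub_eq_zero, ← Finset.sum_sub_distrib, ← neg_eq_zero, ← Finset.sum_neg_distrib]
    have := sum_mul_eq_zero_of_flip t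
      (v := fun ε => s.indicator (fun ω => v (past t ω.down)) (⟨ε⟩ : SignSpace.{u} n))
      Bool.involutive_not sgn_not fun c b => by
        by_cases hc : (⟨c⟩ : SignSpace.{u} n) ∈ s
        · have hc' : (⟨Function.update c t b⟩ : SignSpace.{u} n) ∈ s := by
            rwa [← mem_trunc_iff hs, trunc_update, mem_trunc_iff hs]
          rw [Set.indicator_of_mem hc, Set.indicator_of_mem hc', past_update]
        · have hc' : (⟨Function.update c t b⟩ : SignSpace.{u} n) ∉ s := by
            rwa [← mem_trunc_iff hs, trunc_update, mem_trunc_iff hs]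
          rw [Set.indicator_of_notMem hc, Set.indicator_of_notMem hc']
    rw [← this]
    refine Finset.sum_congr rfl fun ε _ => ?_
    by_cases hc : (⟨ε⟩ : SignSpace.{u} n) ∈ s
    · simp [Set.indicator_of_mem hc, hv]
    · simp [Set.indicator_of_notMem hc]
  · exact (measurable_filt hg).stronglyMeasurable.aestronglyMeasurable

end SignSpace

theorem sum_sq_sum_sgn (n : ℕ) : ∑ ε : Fin n → Bool, (∑ t, sgn (ε t)) ^ 2 = 2 ^ n * n := by
  have h : ∀ s t : Fin n, ∑ ε : Fin n → Bool, sgn (ε t) * sgn (ε s) = if s = t then 2 ^ n else 0 := by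
    intro s t
    split_ifs with h
    · subst h
      have : ∀ b, sgn b * sgn b = 1 := fun b => by cases b <;> simp [sgn]
      simp [this]
    · exact sum_mul_eq_zero_of_flip t (v := fun ε => sgn (ε s)) Bool.involutive_not sgn_not
        fun c b => by rw [Function.update_of_ne h]
  simp only [sq, Finset.sum_mul_sum]
  rw [Finset.sum_comm]
  simp only [Finset.sum_comm (γ := Fin n → Bool), h]
  simp [mul_comm]

section

variable {X : Type u} {n : ℕ}

/-- The process that moves to the next node of the tree or to a fixed point, according to the
next sign. -/
def treeVal (x : BinTree X n) (x₀ : X) (t : ℕ) (ω : SignSpace.{u} n) : X :=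
  if h : t < n then if ω.down ⟨t, h⟩ then x ⟨t, h⟩ (past ⟨t, h⟩ ω.down) else x₀ else x₀

theorem treeVal_trunc (x : BinTree X n) (x₀ : X) (t : ℕ) (ω : SignSpace.{u} n) :
    treeVal x x₀ t (SignSpace.trunc (t + 1) ω) = treeVal x x₀ t ω := by
  unfold treeVal
  by_cases h : t < n
  · rw [dif_pos h, dif_pos h]
    rw [SignSpace.past_trunc ⟨t, h⟩ (Nat.le_succ t)]
    simp [SignSpace.trunc]
  · rw [dif_neg h, dif_neg h]

variable [MeasurableSpace X]

/-- The adapted process that witnesses the failure of the law of large numbers. -/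
noncomputable def treeProcess (x : BinTree X n) (x₀ : X) : AdaptedProcess X :=
  AdaptedProcess.ofStandardBorel (SignSpace.law n) (SignSpace.filt n) (treeVal x x₀)
    fun t => SignSpace.measurable_filt (treeVal_trunc x x₀ t)

theorem deviation_treeProcess (x : BinTree X n) (x₀ : X) (f : X → Label) :
    ∀ᵐ ω ∂SignSpace.law n, (treeProcess x x₀).deviation n f ω =
      1 / n * ∑ t, sgn (ω.down t) * (((f (x t (past t ω.down)) : ℝ) - f x₀) / 2) := by
  have h : ∀ᵐ ω ∂SignSpace.law n, ∀ t : Fin n,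
      ((f (x t (past t ω.down)) : ℝ) + f x₀) / 2 =
        ∫ ω', (f (treeVal x x₀ t ω') : ℝ) ∂condExpKernel (SignSpace.law n) (SignSpace.filt n t) ω := by
    refine ae_all_iff.2 fun t => ?_
    refine (SignSpace.condExp_eq t (h := fun ω' => (f (treeVal x x₀ t ω') : ℝ))
      (v := fun p => ((f (x t p) : ℝ) - f x₀) / 2) (fun ω => ?_) fun ω => ?_).trans
      (condExp_ae_eq_integral_condExpKernel ((SignSpace.filt n).le t) .of_finite)
    · rw [SignSpace.past_trunc t le_rfl]
    · cases hb : ω.down t <;> simp [treeVal, hb, sgn] <;> ring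
  filter_upwards [h] with ω hω
  rw [AdaptedProcess.deviation, Finset.sum_range]
  congr 1
  refine Finset.sum_congr rfl fun t _ => ?_
  have := hω t
  change (f (treeVal x x₀ t ω) : ℝ) - ∫ ω', (f (treeVal x x₀ t ω') : ℝ)
    ∂condExpKernel (SignSpace.law n) (SignSpace.filt n t) ω = _
  rw [← this]
  cases hb : ω.down t <;> simp [treeVal, hb, sgn] <;> ring

/-- The deviation at the witness is half the signed sum of `f - s`, plus half the mean-zero sum of
`s`, minus half the base-point term `(∑ sgn) * f x₀`. The hypothesis `hn` makes the last term
negligible. -/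
theorem le_upperExp_deviation {F : Set (X → Label)} {γ : ℝ} (hγ : 0 < γ) {x : BinTree X n}
    (hx : Shatters F γ x) (x₀ : X) (hn : 2 ≤ γ ^ 2 * n) :
    ENNReal.ofReal (γ / 8) ≤ upperExp (treeProcess x x₀).prob fun ω =>
      ⨆ f : F, ENNReal.ofReal |(treeProcess x x₀).deviation n (f : X → Label) ω| := by
  obtain ⟨s, hs⟩ := hx
  choose f hfF hf using hs
  have hn0 : (0 : ℝ) < n := by
    by_contra! h
    nlinarith [sq_nonneg γ]
  refine le_trans ?_ (lintegral_le_upperExp _ _)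
  change _ ≤ ∫⁻ ω, _ ∂SignSpace.law n
  -- A pointwise lower bound for the deviation, with the base-point term replaced by its bound from
  -- the inequality of arithmetic and geometric means. Since the square of the sign sum has mean
  -- `n`, the mean of `b` is `γ / 4 - 1 / (4 * n * γ)`.
  let b : SignSpace.{u} n → ℝ := fun ω => 1 / (2 * n) * (n * γ + ∑ t, sgn (ω.down t) *
    s t (past t ω.down) - ((∑ t, sgn (ω.down t)) ^ 2 / (n * γ) + n * γ) / 2)
  have hb : ENNReal.ofReal (∫ ω, b ω ∂SignSpace.law n) ≤
      ∫⁻ ω, ENNReal.ofReal (b ω) ∂SignSpace.law n := ofReal_integral_le_lintegral .of_finite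
  have hbint : γ / 8 ≤ ∫ ω, b ω ∂SignSpace.law n := by
    rw [SignSpace.integral_law]
    simp only [b]
    rw [← Finset.mul_sum, Finset.sum_sub_distrib, Finset.sum_add_distrib, ← Finset.sum_div,
      Finset.sum_add_distrib, ← Finset.sum_div, sum_sq_sum_sgn, sum_sum_sgn_mul_past]
    simp only [Finset.sum_const, Finset.card_univ, Fintype.card_pi, Fintype.card_bool,
      Finset.prod_const, Fintype.card_fin, nsmul_eq_mul]
    push_cast
    have : (2 ^ n : ℝ)⁻¹ * (1 / (2 * n) * (2 ^ n * (n * γ) + 0 -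
        (2 ^ n * n / (n * γ) + 2 ^ n * (n * γ)) / 2)) = γ / 4 - 1 / (4 * (n * γ)) := by
      field_simp
      ring
    rw [this]
    have h2 : 1 / (4 * (n * γ)) ≤ γ / 8 := by
      rw [div_le_div_iff₀ (by positivity) (by norm_num)]
      nlinarith
    linarith
  refine (ENNReal.ofReal_le_ofReal hbint).trans (hb.trans (lintegral_mono_ae ?_))
  have hae : ∀ᵐ ω ∂SignSpace.law n, ∀ ε, (treeProcess x x₀).deviation n (f ε) ω =
      1 / n * ∑ t, sgn (ω.down t) * (((f ε (x t (past t ω.down)) : ℝ) - f ε x₀) / 2) :=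
    ae_all_iff.2 fun ε => deviation_treeProcess x x₀ (f ε)
  filter_upwards [hae] with ω hω
  refine le_iSup_of_le ⟨f ω.down, hfF _⟩ (ENNReal.ofReal_le_ofReal (le_trans ?_ (le_abs_self _)))
  change _ ≤ (treeProcess x x₀).deviation n (f ω.down) ω
  rw [hω]
  have h1 : (n : ℝ) * γ ≤ ∑ t, sgn (ω.down t) *
      ((f ω.down (x t (past t ω.down)) : ℝ) - s t (past t ω.down)) := by
    calc (n : ℝ) * γ = ∑ _t : Fin n, γ := by simp
      _ ≤ _ := Finset.sum_le_sum fun t _ => hf ω.down t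
  have h2 : (∑ t, sgn (ω.down t)) * (f ω.down x₀ : ℝ) ≤
      ((∑ t, sgn (ω.down t)) ^ 2 / (n * γ) + n * γ) / 2 := by
    have h3 : (∑ t, sgn (ω.down t)) * (f ω.down x₀ : ℝ) ≤ |∑ t, sgn (ω.down t)| := by
      refine (le_abs_self _).trans ?_
      rw [abs_mul]
      exact mul_le_of_le_one_right (abs_nonneg _) (abs_label_le _)
    refine h3.trans ?_
    have hc : 0 < n * γ := by positivity
    rw [← sq_abs, le_div_iff₀ two_pos, div_add' _ _ _ hc.ne', le_div_iff₀ hc]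
    nlinarith [sq_nonneg (|∑ t, sgn (ω.down t)| - n * γ)]
  have h4 : ∑ t, sgn (ω.down t) * (((f ω.down (x t (past t ω.down)) : ℝ) - f ω.down x₀) / 2) =
      (∑ t, sgn (ω.down t) * ((f ω.down (x t (past t ω.down)) : ℝ) - s t (past t ω.down)) +
        ∑ t, sgn (ω.down t) * s t (past t ω.down) - (∑ t, sgn (ω.down t)) * (f ω.down x₀ : ℝ)) / 2 := by
    rw [Finset.sum_mul, ← Finset.sum_add_distrib, ← Finset.sum_sub_distrib, Finset.sum_div]
    exact Finset.sum_congr rfl fun t _ => by ring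
  rw [h4]
  simp only [b]
  rw [show (1 : ℝ) / (2 * n) = 1 / n / 2 by ring, div_mul_eq_mul_div, ← mul_div_assoc]
  have : (0 : ℝ) ≤ 1 / n := by positivity
  gcongr

theorem sfat_lt_top_of_umlln {F : Set (X → Label)} [Nonempty X] (h : UMLLN F) (γ : ℝ)
    (hγ : 0 < γ) : sfat F γ < ⊤ := by
  by_contra hs
  have hlarge : ∀ᶠ n : ℕ in atTop, 2 / γ ^ 2 ≤ n :=
    tendsto_natCast_atTop_atTop.eventually_ge_atTop _
  have hfr : ∃ᶠ n : ℕ in atTop, ENNReal.ofReal (γ / 8) ≤ ⨆ S : AdaptedProcess X,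
      upperExp S.prob fun ω => ⨆ f : F, ENNReal.ofReal |S.deviation n (f : X → Label) ω| := by
    refine ((frequently_shatters hs).and_eventually hlarge).mono ?_
    rintro n ⟨⟨x, hx⟩, hn⟩
    refine le_iSup_of_le (treeProcess x (Classical.arbitrary X)) (le_upperExp_deviation hγ hx _ ?_)
    rwa [div_le_iff₀ (by positivity), mul_comm] at hn
  have := le_limsup_of_frequently_le hfr
  rw [h] at this
  simp only [nonpos_iff_eq_zero, ENNReal.ofReal_eq_zero] at this
  linarith

end

/-! ### Process learning fails in infinite dimension -/

section CoinLaw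

variable {Z : Type u} [MeasurableSpace Z] {C : Type*} [Fintype C] {n : ℕ}

/-- Exchanging coordinate `t` with a fresh innovation `a` preserves uniform measure. This is why
`coinLaw` has the stated conditional distributions. -/
theorem sum_sum_eq_card_mul_sum (t : Fin n) {φ : (Fin n → C) → C → ℝ≥0∞}
    (hφ : ∀ c a b, φ (Function.update c t a) b = φ c b) :
    ∑ c, ∑ a, φ c a = Fintype.card C * ∑ c, φ c (c t) := by
  have hinv : Function.Involutive fun p : (Fin n → C) × C =>
      (Function.update p.1 t p.2, p.1 t) := fun p => by simp
  have h := Equiv.sum_comp hinv.toPerm fun p : (Fin n → C) × C => φ p.1 p.2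
  simp only [Function.Involutive.coe_toPerm, hφ, Fintype.sum_prod_type, Finset.sum_const,
    Finset.card_univ, nsmul_eq_mul] at h
  rw [← h, Finset.mul_sum]

theorem measurable_unif {A : Type*} [MeasurableSpace A] {h : A → C → Z}
    (hh : ∀ c, Measurable fun a => h a c) : Measurable fun a => unif (h a) := by
  refine Measure.measurable_of_measurable_coe _ fun s hs => ?_
  simp only [unif_apply _ hs]
  exact (Finset.measurable_fun_sum _ fun c _ =>
    (measurable_one.indicator hs).comp (hh c)).const_mul _

omit [MeasurableSpace Z] [Fintype C] in
theorem past_eq_of_recursion {traj : (Fin n → C) → Fin n → Z}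
    {step : (t : Fin n) → (Fin (t : ℕ) → Z) → C → Z}
    (htraj : ∀ c t, traj c t = step t (past t (traj c)) (c t)) (c : Fin n → C) (t : Fin n) (a : C) :
    past t (traj (Function.update c t a)) = past t (traj c) := by
  have h : ∀ (m : ℕ) (i : Fin n), (i : ℕ) = m → i < t →
      traj (Function.update c t a) i = traj c i := by
    intro m
    induction m using Nat.strong_induction_on with
    | _ m ih =>
      rintro i rfl hi
      have hp : past i (traj (Function.update c t a)) = past i (traj c) :=
        funext fun j => ih j j.isLt _ rfl (lt_trans (Fin.lt_def.2 j.isLt) hi)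
      rw [htraj, hp, Function.update_of_ne hi.ne, ← htraj]
  exact funext fun i => h i _ rfl (Fin.lt_def.2 i.isLt)

/-- The law of a process whose entries are functions of the preceding entries and of independent
uniformly distributed innovations. -/
noncomputable def coinLaw [Nonempty C] (traj : (Fin n → C) → Fin n → Z)
    (step : (t : Fin n) → (Fin (t : ℕ) → Z) → C → Z)
    (hstep : ∀ t a, Measurable fun p => step t p a)
    (htraj : ∀ c t, traj c t = step t (past t (traj c)) (c t)) : ProcessLaw Z n where
  law := unif traj
  cond t := ⟨fun p => unif (step t p), measurable_unif (hstep t)⟩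
  isMarkov_cond t := ⟨fun p => inferInstanceAs (IsProbabilityMeasure (unif (step t p)))⟩
  isCond t := by
    have : IsMarkovKernel (⟨fun p => unif (step t p), measurable_unif (hstep t)⟩ :
      Kernel (Fin (t : ℕ) → Z) Z) :=
      ⟨fun p => inferInstanceAs (IsProbabilityMeasure (unif (step t p)))⟩
    rw [map_unif _ ((measurable_past t).prodMk (measurable_pi_apply t)),
      map_unif _ (measurable_past t)]
    ext S hS
    rw [Measure.compProd_apply hS, lintegral_unif _ (Kernel.measurable_kernel_prodMk_left hS),
      unif_apply _ hS]
    have h : ∀ p : Fin (t : ℕ) → Z, (⟨fun p => unif (step t p), measurable_unif (hstep t)⟩ :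
        Kernel (Fin (t : ℕ) → Z) Z) p (Prod.mk p ⁻¹' S) =
        (Fintype.card C : ℝ≥0∞)⁻¹ * ∑ a, S.indicator 1 (p, step t p a) := fun p => by
      change unif (step t p) _ = _
      rw [unif_apply _ (measurable_prodMk_left hS)]
      rfl
    simp only [h]
    rw [← Finset.mul_sum, sum_sum_eq_card_mul_sum t
      (φ := fun c a => S.indicator 1 (past t (traj c), step t (past t (traj c)) a))
      fun c a b => by rw [past_eq_of_recursion htraj],
      ENNReal.inv_mul_cancel_left (by simp [Fintype.card_ne_zero]) (by simp)]
    simp only [← htraj]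

theorem sum_le_upperExp_unif {Ω : Type u} [MeasurableSpace Ω] (k : C → Ω) (g : Ω → ℝ≥0∞) :
    (Fintype.card C : ℝ≥0∞)⁻¹ * ∑ c, g (k c) ≤ upperExp (unif k) g :=
  le_iInf fun h => le_iInf fun hm => le_iInf fun hh => by
    rw [lintegral_unif k hm]
    gcongr
    exact hh _

theorem coinLaw_risk {X : Type u} [MeasurableSpace X] [Nonempty C]
    {traj : (Fin n → C) → Fin n → Sample X}
    {step : (t : Fin n) → (Fin (t : ℕ) → Sample X) → C → Sample X}
    {hstep : ∀ t a, Measurable fun p => step t p a}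
    {htraj : ∀ c t, traj c t = step t (past t (traj c)) (c t)} (c : Fin n → C)
    {f : X → Label} (hf : Measurable f) :
    (coinLaw traj step hstep htraj).risk (traj c) f = 1 / n * ∑ t, (Fintype.card C : ℝ)⁻¹ *
      ∑ a, loss (step t (past t (traj c)) a) f := by
  rw [ProcessLaw.risk]
  congr 1
  exact Finset.sum_congr rfl fun t _ => integral_unif _ (measurable_loss hf)

end CoinLaw

/-! ### Two laws that revisit a branch of the tree -/

section Revisit

/-- The sign encoded by a label. -/
noncomputable def decodeLabel (y : Label) : Bool := decide (0 ≤ (y : ℝ))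

theorem decodeLabel_signLabel (b : Bool) : decodeLabel (signLabel b) = b := by
  cases b <;> simp [decodeLabel, signLabel, sgn]

theorem measurable_decodeLabel : Measurable decodeLabel := by
  refine measurable_to_bool ?_
  have : decodeLabel ⁻¹' {true} = {y : Label | 0 ≤ (y : ℝ)} := by
    ext y
    simp [decodeLabel]
  rw [this]
  exact measurableSet_le measurable_const measurable_subtype_coe

/-- A noisy copy of the opposite of the sign `b`. -/
def noisyNot (b : Bool) (a : Bool × Bool) : Bool := if a.2 then !b else a.1

/-- The noisy sign is the opposite of `b` with probability `3 / 4`, hence has mean `-sgn b / 2`. The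
damping lets the first visit outweigh the second when the branch is fixed. -/
theorem sum_sgn_noisyNot (b : Bool) : ∑ a, sgn (noisyNot b a) = -2 * sgn b := by
  cases b <;> simp [Fintype.sum_prod_type, noisyNot, sgn] <;> norm_num

variable {X : Type u} {k : ℕ} (x : BinTree X k)

/-- The sample that follows the branch `d` of the tree with the signs of the branch as labels, and
then visits the branch again, with the labels `noisyNot`. -/
def revisit (d : Fin k → Bool) (c : Fin (k + k) → Bool × Bool) : Fin (k + k) → Sample X :=
  Fin.addCases (fun j => (x j (past j d), signLabel (d j)))
    fun j => (x j (past j d), signLabel (noisyNot (d j) (c (Fin.natAdd k j))))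

/-- The signs of the branch drawn from the innovations. -/
def branchOf (c : Fin (k + k) → Bool × Bool) : Fin k → Bool := fun j => (c (Fin.castAdd k j)).1

/-- The step of `revisit` for a branch that is drawn at random along the way. -/
noncomputable def randomStep : (t : Fin (k + k)) → (Fin (t : ℕ) → Sample X) → Bool × Bool →
    Sample X :=
  Fin.addCases (motive := fun t => (Fin (t : ℕ) → Sample X) → Bool × Bool → Sample X)
    (fun j p a => (x j fun i => decodeLabel (p i).2, signLabel a.1))
    fun j p a => ((p ⟨j, by simp [j.pos]⟩).1,
      signLabel (noisyNot (decodeLabel (p ⟨j, by simp [j.pos]⟩).2) a))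

/-- The step of `revisit` for a fixed branch. -/
def fixedStep (d : Fin k → Bool) (t : Fin (k + k)) (a : Bool × Bool) : Sample X :=
  Fin.addCases (motive := fun _ => Sample X) (fun j => (x j (past j d), signLabel (d j)))
    (fun j => (x j (past j d), signLabel (noisyNot (d j) a))) t

theorem revisit_eq_fixedStep (d : Fin k → Bool) (c : Fin (k + k) → Bool × Bool)
    (t : Fin (k + k)) : revisit x d c t = fixedStep x d t (c t) := by
  refine Fin.addCases (fun j => ?_) (fun j => ?_) t
  · simp only [revisit, fixedStep, Fin.addCases_left]
  · simp only [revisit, fixedStep, Fin.addCases_right]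

theorem randomStep_left (d : Fin k → Bool) (c : Fin (k + k) → Bool × Bool) (j : Fin k)
    (a : Bool × Bool) :
    randomStep x (Fin.castAdd k j) (past (Fin.castAdd k j) (revisit x d c)) a =
      (x j (past j d), signLabel a.1) := by
  have h : ∀ i : Fin (j : ℕ), decodeLabel (past (Fin.castAdd k j) (revisit x d c) i).2 =
      past j d i := fun i => by
    change decodeLabel (revisit x d c (Fin.castAdd k (Fin.castLE j.isLt.le i))).2 = _
    rw [revisit, Fin.addCases_left, decodeLabel_signLabel]
    rfl
  rw [randomStep, Fin.addCases_left]
  exact Prod.ext (congrArg (x j) (funext h)) rfl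

theorem randomStep_right (d : Fin k → Bool) (c : Fin (k + k) → Bool × Bool) (j : Fin k)
    (a : Bool × Bool) :
    randomStep x (Fin.natAdd k j) (past (Fin.natAdd k j) (revisit x d c)) a =
      (x j (past j d), signLabel (noisyNot (d j) a)) := by
  have h : past (Fin.natAdd k j) (revisit x d c) ⟨j, by simp [j.pos]⟩ =
      (x j (past j d), signLabel (d j)) := by
    change revisit x d c (Fin.castAdd k j) = _
    rw [revisit, Fin.addCases_left]
  rw [randomStep, Fin.addCases_right, h, decodeLabel_signLabel]

theorem revisit_eq_randomStep (c : Fin (k + k) → Bool × Bool) (t : Fin (k + k)) :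
    revisit x (branchOf c) c t = randomStep x t (past t (revisit x (branchOf c) c)) (c t) := by
  refine Fin.addCases (fun j => ?_) (fun j => ?_) t
  · rw [randomStep_left, revisit, Fin.addCases_left]
    rfl
  · rw [randomStep_right, revisit, Fin.addCases_right]

variable [MeasurableSpace X]

theorem measurable_randomStep (t : Fin (k + k)) (a : Bool × Bool) :
    Measurable fun p => randomStep x t p a := by
  have hd : ∀ {m : ℕ} (i : Fin m), Measurable fun p : Fin m → Sample X => decodeLabel (p i).2 :=
    fun i => measurable_decodeLabel.comp (measurable_snd.comp (measurable_pi_apply i))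
  refine Fin.addCases (fun j => ?_) (fun j => ?_) t
  · simp only [randomStep, Fin.addCases_left]
    exact ((measurable_of_countable (x j)).comp (measurable_pi_iff.2 hd)).prodMk measurable_const
  · simp only [randomStep, Fin.addCases_right]
    exact (measurable_fst.comp (measurable_pi_apply _)).prodMk
      ((measurable_of_countable fun b => signLabel (noisyNot b a)).comp (hd _))

/-- The law of the revisited random branch. -/
noncomputable def randomLaw : ProcessLaw (Sample X) (k + k) :=
  coinLaw (fun c => revisit x (branchOf c) c) (randomStep x) (measurable_randomStep x)
    (revisit_eq_randomStep x)

/-- The law of the revisited fixed branch. -/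
noncomputable def fixedLaw (d : Fin k → Bool) : ProcessLaw (Sample X) (k + k) :=
  coinLaw (revisit x d) (fun t _ => fixedStep x d t) (fun _ _ => measurable_const)
    (revisit_eq_fixedStep x d)

/-- The correlation of a function with the signs along a branch. -/
def branchCorr (d : Fin k → Bool) (f : X → Label) : ℝ := ∑ j, sgn (d j) * (f (x j (past j d)) : ℝ)

omit [MeasurableSpace X] in
theorem avg_loss_noisyNot (b : Bool) (y : X) (f : X → Label) :
    (4 : ℝ)⁻¹ * ∑ a, loss (y, signLabel (noisyNot b a)) f = 1 + sgn b * (f y : ℝ) / 2 := by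
  simp only [loss_signLabel, Finset.sum_sub_distrib, ← Finset.sum_mul, sum_sgn_noisyNot]
  simp
  ring

theorem card_bool_prod_bool : (Fintype.card (Bool × Bool) : ℝ) = 4 := by
  rw [Fintype.card_prod, Fintype.card_bool]; norm_num

/-- During the first visit the next label is a fair coin given the past, so every function has
conditional risk `1`; only the second visit, with mean risk `1 + sgn * f / 2`, distinguishes
functions. -/
theorem randomLaw_risk (hk : 0 < k) (c : Fin (k + k) → Bool × Bool) {f : X → Label}
    (hf : Measurable f) : (randomLaw x).risk (revisit x (branchOf c) c) f =
      1 + branchCorr x (branchOf c) f / (4 * k) := by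
  have hk' : (0 : ℝ) < k := by exact_mod_cast hk
  have h4 : ∀ (y : X), (4 : ℝ)⁻¹ * ∑ a : Bool × Bool, loss (y, signLabel a.1) f = 1 := fun y => by
    simp only [loss_signLabel, Fintype.sum_prod_type, Fintype.sum_bool, sgn]
    norm_num
    ring
  rw [randomLaw, coinLaw_risk c hf, Fin.sum_univ_add]
  simp only [card_bool_prod_bool, randomStep_left, randomStep_right, h4, avg_loss_noisyNot,
    Finset.sum_add_distrib, ← Finset.sum_div, Finset.sum_const, Finset.card_univ,
    Fintype.card_fin, nsmul_eq_mul, mul_one, branchCorr]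
  push_cast
  field_simp
  ring

/-- Now the first visit has deterministic labels and contributes `-branchCorr`, against `+branchCorr
/ 2` from the second visit. Over `2 * k` rounds this reverses the sign in `randomLaw_risk`. -/
theorem fixedLaw_risk (hk : 0 < k) (d : Fin k → Bool) (c : Fin (k + k) → Bool × Bool)
    {f : X → Label} (hf : Measurable f) : (fixedLaw x d).risk (revisit x d c) f =
      1 - branchCorr x d f / (4 * k) := by
  have hk' : (0 : ℝ) < k := by exact_mod_cast hk
  have h4 : ∀ r : ℝ, (4 : ℝ)⁻¹ * ∑ _a : Bool × Bool, r = r := fun r => by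
    rw [Finset.sum_const, Finset.card_univ, nsmul_eq_mul, card_bool_prod_bool]
    ring
  rw [fixedLaw, coinLaw_risk c hf, Fin.sum_univ_add]
  simp only [card_bool_prod_bool, fixedStep, Fin.addCases_left, Fin.addCases_right, h4,
    avg_loss_noisyNot]
  simp only [loss_signLabel, Finset.sum_add_distrib, Finset.sum_sub_distrib, ← Finset.sum_div,
    Finset.sum_const, Finset.card_univ, Fintype.card_fin, nsmul_eq_mul, mul_one, branchCorr]
  push_cast
  field_simp
  ring

end Revisit

section

variable {k : ℕ}

/-- Swapping the first halves of two innovation vectors shows that a branch drawn independently of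
`c` may be replaced by the branch read off from `c`. -/
theorem sum_sum_branchOf {φ : (Fin k → Bool) → (Fin (k + k) → Bool × Bool) → ℝ≥0∞}
    (hφ : ∀ d c c', (∀ j, c (Fin.natAdd k j) = c' (Fin.natAdd k j)) → φ d c = φ d c') :
    ∑ c' : Fin (k + k) → Bool × Bool, ∑ c, φ (branchOf c') c =
      (Fintype.card (Fin (k + k) → Bool × Bool)) * ∑ c, φ (branchOf c) c := by
  let σ : (Fin (k + k) → Bool × Bool) × (Fin (k + k) → Bool × Bool) →
      (Fin (k + k) → Bool × Bool) × (Fin (k + k) → Bool × Bool) := fun p =>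
    (fun t => if (t : ℕ) < k then p.2 t else p.1 t, fun t => if (t : ℕ) < k then p.1 t else p.2 t)
  have hσ : Function.Involutive σ := fun p => by
    refine Prod.ext (funext fun t => ?_) (funext fun t => ?_) <;> by_cases h : (t : ℕ) < k <;>
      simp [σ, h]
  have h := Equiv.sum_comp hσ.toPerm fun p => φ (branchOf p.1) p.2
  have h' : ∀ p, φ (branchOf (σ p).1) (σ p).2 = φ (branchOf p.2) p.2 := fun p => by
    have h1 : branchOf (σ p).1 = branchOf p.2 := funext fun j => by simp [branchOf, σ]
    rw [h1]
    exact hφ _ _ _ fun j => by simp [σ]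
  simp only [Function.Involutive.coe_toPerm, h', Fintype.sum_prod_type, Finset.sum_const,
    Finset.card_univ, nsmul_eq_mul] at h
  exact h.symm

theorem sum_sgn_branchOf (v : ∀ j : Fin k, (Fin (j : ℕ) → Bool) → ℝ) :
    ∑ c : Fin (k + k) → Bool × Bool, ∑ j, sgn (branchOf c j) * v j (past j (branchOf c)) = 0 := by
  rw [Finset.sum_comm]
  refine Finset.sum_eq_zero fun j _ => ?_
  refine sum_mul_eq_zero_of_flip (Fin.castAdd k j) (s := fun a : Bool × Bool => sgn a.1)
    (v := fun c => v j (past j (branchOf c))) (τ := fun a => (!a.1, a.2))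
    (fun a => by simp) (fun a => sgn_not a.1) fun c a => ?_
  congr 1
  funext i
  refine congrArg Prod.fst (Function.update_of_ne (fun h => i.isLt.ne ?_) _ _)
  exact congrArg Fin.val h

variable {X : Type u} [MeasurableSpace X] {F : Set (X → Label)} {γ : ℝ} {x : BinTree X k}

omit [MeasurableSpace X] in
theorem revisit_congr (d : Fin k → Bool) {c c' : Fin (k + k) → Bool × Bool}
    (h : ∀ j, c (Fin.natAdd k j) = c' (Fin.natAdd k j)) : revisit x d c = revisit x d c' := by
  funext t
  refine Fin.addCases (fun j => ?_) (fun j => ?_) t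
  · simp only [revisit, Fin.addCases_left]
  · simp only [revisit, Fin.addCases_right, h]

omit [MeasurableSpace X] in
theorem abs_branchCorr_le (d : Fin k → Bool) (f : X → Label) : |branchCorr x d f| ≤ k :=
  abs_sum_sgn_mul_label_le d fun j => f (x j (past j d))

omit [MeasurableSpace X] in
theorem bddBelow_affine_branchCorr (d : Fin k → Bool) (a b : ℝ) :
    BddBelow (Set.range fun f : F => a + b * branchCorr x d (f : X → Label)) := by
  refine ⟨a - |b| * k, ?_⟩
  rintro _ ⟨f, rfl⟩
  have h : |b * branchCorr x d (f : X → Label)| ≤ |b| * k := by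
    rw [abs_mul]
    exact mul_le_mul_of_nonneg_left (abs_branchCorr_le d _) (abs_nonneg b)
  have := neg_abs_le (b * branchCorr x d (f : X → Label))
  simp only
  linarith

/-- The excess risk under `randomLaw` is compared with a fixed function `f₀`, that under `fixedLaw`
with the shattering function of the branch. When both are averaged over the branch, the correlation
of the learner cancels, leaving at least `k * γ / (4 * k)` for the sum of two terms, each bounded by
the value. -/
theorem le_processValueOf (hk : 0 < k) (hm : ∀ f ∈ F, Measurable f) (hx : Shatters F γ x)
    (fhat : (Fin (k + k) → Sample X) → F) : ENNReal.ofReal (γ / 8) ≤ processValueOf F fhat := by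
  obtain ⟨s, hs⟩ := hx
  choose f hfF hf using hs
  have hk' : (0 : ℝ) < k := by exact_mod_cast hk
  let f₀ : F := fhat (revisit x (fun _ => true) fun _ => (true, true))
  let V := processValueOf F fhat
  let N : ℕ := Fintype.card (Fin (k + k) → Bool × Bool)
  have hN : N ≠ 0 := Fintype.card_ne_zero
  let corr : (Fin k → Bool) → (X → Label) → ℝ := branchCorr x
  let hat : (Fin k → Bool) → (Fin (k + k) → Bool × Bool) → (X → Label) := fun d c =>
    fhat (revisit x d c)
  have hreg : ∀ (P : ProcessLaw (Sample X) (k + k)) (d : Fin k → Bool)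
      (c : Fin (k + k) → Bool × Bool) (b : ℝ), (∀ f : F, P.risk (revisit x d c) (f : X → Label) =
        1 + b * corr d (f : X → Label)) → ∀ g : F, b * (corr d (hat d c) - corr d (g : X → Label)) ≤
        P.risk (revisit x d c) (fhat (revisit x d c) : X → Label) -
          ⨅ f : F, P.risk (revisit x d c) (f : X → Label) := by
    intro P d c b h g
    simp only [h]
    have := ciInf_le (bddBelow_affine_branchCorr (F := F) (x := x) d 1 b) g
    simp only [corr, hat] at this ⊢
    linarith
  have h1 : (N : ℝ≥0∞)⁻¹ * ∑ c, ENNReal.ofReal (1 / (4 * k) *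
      (corr (branchOf c) (hat (branchOf c) c) - corr (branchOf c) f₀)) ≤ V := by
    refine le_trans ?_ ((sum_le_upperExp_unif _ _).trans (le_iSup (fun P : ProcessLaw (Sample X)
      (k + k) => upperExp P.law fun z => ENNReal.ofReal (P.risk z (fhat z : X → Label) -
        ⨅ f : F, P.risk z (f : X → Label))) (randomLaw x)))
    refine mul_le_mul_right (Finset.sum_le_sum fun c _ => ENNReal.ofReal_le_ofReal ?_) _
    refine hreg (randomLaw x) _ c _ (fun g => ?_) f₀
    rw [randomLaw_risk x hk c (hm g g.2)]
    simp only [corr]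
    ring
  have h2 : ∀ d, (N : ℝ≥0∞)⁻¹ * ∑ c, ENNReal.ofReal (1 / (4 * k) *
      (corr d (f d) - corr d (hat d c))) ≤ V := by
    intro d
    refine le_trans ?_ ((sum_le_upperExp_unif _ _).trans (le_iSup (fun P : ProcessLaw (Sample X)
      (k + k) => upperExp P.law fun z => ENNReal.ofReal (P.risk z (fhat z : X → Label) -
        ⨅ f : F, P.risk z (f : X → Label))) (fixedLaw x d)))
    refine mul_le_mul_right (Finset.sum_le_sum fun c _ => ENNReal.ofReal_le_ofReal ?_) _
    refine le_trans (le_of_eq ?_) (hreg (fixedLaw x d) d c (-(1 / (4 * k))) (fun g => ?_)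
      ⟨f d, hfF d⟩)
    · ring
    · rw [fixedLaw_risk x hk d c (hm g g.2)]
      simp only [corr]
      ring
  -- The bound for each fixed branch is averaged over a uniform branch, which turns the sample into
  -- that of `randomLaw`, so that `h1` and `h3` speak of the same sample.
  have h3 : (N : ℝ≥0∞)⁻¹ * ∑ c, ENNReal.ofReal (1 / (4 * k) *
      (corr (branchOf c) (f (branchOf c)) - corr (branchOf c) (hat (branchOf c) c))) ≤ V := by
    have h := Finset.sum_le_sum fun (c' : Fin (k + k) → Bool × Bool) (_ : c' ∈ Finset.univ) =>
      h2 (branchOf c')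
    rw [← Finset.mul_sum, sum_sum_branchOf (φ := fun d c => ENNReal.ofReal (1 / (4 * k) *
      (corr d (f d) - corr d (hat d c)))) fun d c c' hc => by simp only [hat, revisit_congr d hc],
      ENNReal.inv_mul_cancel_left (by simpa using hN) (by simp), Finset.sum_const,
      Finset.card_univ, nsmul_eq_mul] at h
    rw [mul_comm, ← div_eq_mul_inv]
    exact ENNReal.div_le_of_le_mul' h
  have h4 : (N : ℝ) * (k * γ) ≤ ∑ c : Fin (k + k) → Bool × Bool,
      (corr (branchOf c) (f (branchOf c)) - corr (branchOf c) f₀) := by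
    -- Both `f₀` and `s` are fixed before the branch is drawn, so their signed sums vanish on
    -- average.
    have hz := sum_sgn_branchOf (k := k) fun j p => ((f₀ : X → Label) (x j p) : ℝ) - s j p
    calc (N : ℝ) * (k * γ) = ∑ _c : Fin (k + k) → Bool × Bool, ∑ _j : Fin k, γ := by
          simp [N]
      _ ≤ ∑ c : Fin (k + k) → Bool × Bool, ∑ j, sgn (branchOf c j) *
          ((f (branchOf c) (x j (past j (branchOf c))) : ℝ) - s j (past j (branchOf c))) :=
        Finset.sum_le_sum fun c _ => Finset.sum_le_sum fun j _ => hf (branchOf c) j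
      _ = _ := by
        rw [← sub_zero (Finset.sum _ _), ← hz, ← Finset.sum_sub_distrib]
        refine Finset.sum_congr rfl fun c _ => ?_
        simp only [corr, branchCorr]
        rw [← Finset.sum_sub_distrib, ← Finset.sum_sub_distrib]
        exact Finset.sum_congr rfl fun j _ => by ring
  have h5 : ENNReal.ofReal (γ / 4) ≤ V + V := by
    refine le_trans ?_ (add_le_add h1 h3)
    rw [← mul_add, ← Finset.sum_add_distrib]
    calc ENNReal.ofReal (γ / 4) ≤ ENNReal.ofReal ((N : ℝ)⁻¹ * ∑ c : Fin (k + k) → Bool × Bool,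
          1 / (4 * k) * (corr (branchOf c) (f (branchOf c)) - corr (branchOf c) f₀)) := by
          refine ENNReal.ofReal_le_ofReal ?_
          have hN' : (0 : ℝ) < N := by exact_mod_cast Nat.pos_of_ne_zero hN
          rw [← Finset.mul_sum, le_inv_mul_iff₀ hN', one_div, le_inv_mul_iff₀ (by positivity)]
          linarith
      _ = (N : ℝ≥0∞)⁻¹ * ENNReal.ofReal (∑ c : Fin (k + k) → Bool × Bool,
          1 / (4 * k) * (corr (branchOf c) (f (branchOf c)) - corr (branchOf c) f₀)) := by
          rw [ENNReal.ofReal_mul (by positivity), ENNReal.ofReal_inv_of_pos (by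
            exact_mod_cast Nat.pos_of_ne_zero hN), ENNReal.ofReal_natCast]
      _ ≤ _ := by
          refine mul_le_mul_right ((Finset.le_sum_of_subadditive ENNReal.ofReal
            ENNReal.ofReal_zero.le (fun _ _ => ENNReal.ofReal_add_le) _ _).trans
            (Finset.sum_le_sum fun c _ => ?_)) _
          refine le_trans (le_of_eq ?_) ENNReal.ofReal_add_le
          congr 1
          ring
  have h6 : ENNReal.ofReal (γ / 4) = 2 * ENNReal.ofReal (γ / 8) := by
    rw [show γ / 4 = 2 * (γ / 8) by ring, ENNReal.ofReal_mul zero_le_two]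
    simp
  rw [h6, ← two_mul] at h5
  exact (ENNReal.mul_le_mul_iff_right two_ne_zero ENNReal.ofNat_ne_top).1 h5

theorem sfat_lt_top_of_processLearnable (hm : ∀ f ∈ F, Measurable f) (h : ProcessLearnable F)
    (γ : ℝ) (hγ : 0 < γ) : sfat F γ < ⊤ := by
  by_contra hs
  have hfr : ∃ᶠ k : ℕ in atTop, ENNReal.ofReal (γ / 8) ≤ processValue F (k + k) := by
    refine ((frequently_shatters hs).and_eventually (eventually_gt_atTop 0)).mono ?_
    rintro k ⟨⟨x, hx⟩, hk⟩
    exact le_iInf fun fhat => le_processValueOf hk hm hx fhat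
  have ht : Tendsto (fun k : ℕ => k + k) atTop atTop :=
    tendsto_atTop_mono (fun k => Nat.le_add_left k k) tendsto_id
  have := le_limsup_of_frequently_le (ht.frequently hfr)
  rw [h] at this
  simp only [nonpos_iff_eq_zero, ENNReal.ofReal_eq_zero] at this
  linarith

end

end ProcLearn

theorem mainTheorem3 {X : Type*} [MeasurableSpace X] [Nonempty X]
    (F : Set (X → ProcLearn.Label)) (hF : F.Nonempty) (hmeas : ProcLearn.IsMeasurableClass F) :
    List.TFAE
      [ ProcLearn.OnlineLearnable F,
        ProcLearn.UMLLN F,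
        ∀ γ : ℝ, 0 < γ → ProcLearn.sfat F γ < ⊤,
        limsup (fun n => ProcLearn.seqRad F n) atTop = 0,
        ProcLearn.ProcessLearnable F ] := by
  tfae_have 3 → 1 := ProcLearn.onlineLearnable_of_sfat_lt_top hF
  tfae_have 1 → 4 := ProcLearn.limsup_seqRad_of_onlineLearnable hF
  tfae_have 4 → 3 := ProcLearn.sfat_lt_top_of_limsup_seqRad
  tfae_have 3 → 2 := ProcLearn.umlln_of_sfat_lt_top hF hmeas
  tfae_have 2 → 3 := ProcLearn.sfat_lt_top_of_umlln
  tfae_have 3 → 5 := ProcLearn.processLearnable_of_sfat_lt_top hF hmeas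
  tfae_have 5 → 3 := ProcLearn.sfat_lt_top_of_processLearnable hmeas.measurable_mem
  tfae_finish
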